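/- **Proposition 3.7.** Let $T>0$ and let $U:(0,\infty)\to\mathbb R$ satisfy: 1. $U\in C^7(0,\infty)$ is strictly increasing and strictly concave, $U'(0+)=\infty$, $U'(\infty)=0$, and the limit $\lim_{x\to\infty}xU'(x)/U(x)$ exists and is less than $1$; moreover $U(0+)=0$. 2. The risk tolerance $R(x)=-U'(x)/U''(x)$ is strictly increasing on $(0,\infty)$, $R(0+)=0$, the one-sided derivative $\lim_{x\downarrow0}R(x)/x$ exists and is finite, and there is $K$ such that $\left|\frac{d^i}{dx^i}\big(R(x)^i\big)\right|\le K$ for all $x>0$ and $2\le i\le 5$. 3. The inverse $I:(0,\infty)\to(0,\infty)$ of $U'$ satisfies $I(y)\le\alpha+\kappa y^{-\alpha}$ for all $y>0$, with some constants $\alpha>0$ and $\kappa$. Let the state space $D$ of the slow factor be $\mathbb R$ or $(0,\infty)$. A function $h$ on $D$ is called at most polynomially growing if, for some $k\in\mathbb N$ and $a>0$, $|h(z)|\le a(1+|z|^k)$ for all $z\in D$ in the case $D=\mathbb R$, respectively $|h(z)|\le a(1+z^k+z^{-k})$ for all $z\in D$ in the case $D=(0,\infty)$. Let the Sharpe ratio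 $\lambda:D\to\mathbb R$ be $C^3$ with $\lambda,\lambda',\lambda'',\lambda'''$ at most polynomially growing. For each $z\in D$ let $v^{(0)}(\cdot,\cdot,z)\in C^{1,2}([0,T]\times(0,\infty))$ be the Merton value function with Sharpe ratio $\lambda(z)$, that is, the solution of $$v^{(0)}_t-\tfrac12\lambda(z)^2\frac{(v^{(0)}_x)^2}{v^{(0)}_{xx}}=0,\qquad v^{(0)}(T,x,z)=U(x),$$ with $v^{(0)}_x>0$, $v^{(0)}_{xx}<0$ and $\lim_{x\downarrow0}v^{(0)}(t,x,z)=0$ for every $t\in[0,T]$. Put $R(t,x;\lambda(z))=-v^{(0)}_x(t,x,z)/v^{(0)}_{xx}(t,x,z)$. Then all the derivatives below exist on $[0,T]\times(0,\infty)\times D$ (for mixed ones, the $x$-derivatives are taken first), and there are non-negative, at most polynomially growing functions $d_{ij}$ and $\widetilde d_{ij}$ on $D$ such that, for all $(t,x,z)\in[0,T]\times(0,\infty)\times D$, $$\begin{array}{ll} |v^{(0)}_z|\le d_{01}(z)\,v^{(0)},&|v^{(0)}_{xz}|\le d_{11}(z)\,v^{(0)}_x,\\ |v^{(0)}_{xxz}|\le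 d_{21}(z)\,|v^{(0)}_{xx}|,&|R_z|\le\widetilde d_{01}(z)\,R,\\ |v^{(0)}_{zz}|\le d_{02}(z)\,v^{(0)},&|R_{xz}|\le\widetilde d_{11}(z),\\ |v^{(0)}_{xzz}|\le d_{12}(z)\,v^{(0)}_x,&|R_{zz}|\le\widetilde d_{02}(z)\,R,\\ |v^{(0)}_{xxzz}|\le d_{22}(z)\,|v^{(0)}_{xx}|,&|v^{(0)}_{xzzz}|\le d_{13}(z)\,v^{(0)}_x, \end{array}$$ where $v^{(0)}$ and its derivatives are taken at $(t,x,z)$ and $R$ and its derivatives at $(t,x;\lambda(z))$. -/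

import Mathlib

open Set Filter Topology

namespace Merton

noncomputable section

/-- Risk tolerance `-f' / f''` of a function of wealth. -/
def tolerance (f : ℝ → ℝ) (x : ℝ) : ℝ := -deriv f x / deriv (deriv f) x

/-- The standing assumption on the utility function `U`, a function on `(0, ∞)`; its values
outside `(0, ∞)` play no role. -/
structure UtilityAssumption (U : ℝ → ℝ) : Prop where
  smooth : ContDiffOn ℝ 7 U (Ioi 0)
  strictMono : StrictMonoOn U (Ioi 0)
  strictConcave : StrictConcaveOn ℝ (Ioi 0) U
  inada_zero : Tendsto (deriv U) (𝓝[>] 0) atTop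
  inada_top : Tendsto (deriv U) atTop (𝓝 0)
  /-- The asymptotic elasticity is less than one. -/
  elasticity : ∃ a < 1, Tendsto (fun x => x * deriv U x / U x) atTop (𝓝 a)
  zero : Tendsto U (𝓝[>] 0) (𝓝 0)
  tolerance_zero : Tendsto (tolerance U) (𝓝[>] 0) (𝓝 0)
  tolerance_strictMono : StrictMonoOn (tolerance U) (Ioi 0)
  /-- With the value `0` at `0`, the risk tolerance has a finite derivative at `0`.
  (On `(0, ∞)` it is differentiable since `U` is smooth there.) -/
  tolerance_deriv_zero : ∃ r : ℝ, Tendsto (fun x => tolerance U x / x) (𝓝[>] 0) (𝓝 r)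
  tolerance_bound : ∃ K : ℝ, ∀ i : ℕ, 2 ≤ i → i ≤ 5 → ∀ x > 0,
    |iteratedDeriv i (fun ξ => tolerance U ξ ^ i) x| ≤ K
  /-- Polynomial growth of the inverse `I` of the marginal utility. -/
  inverse_growth : ∃ I : ℝ → ℝ, (∀ y > 0, 0 < I y ∧ deriv U (I y) = y) ∧
    ∃ α > 0, ∃ κ : ℝ, ∀ y > 0, I y ≤ α + κ * y ^ (-α)

/-- `M` is the Merton value function on `[0,T] × (0,∞)` for the utility `U` and the constant Sharpe
ratio `l`: the `C^{1,2}`, increasing and concave classical solution of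
`M_t - (l² / 2) M_x² / M_xx = 0`, `M(T, ·) = U`, which vanishes at zero wealth.  -/
structure IsMertonValue (U : ℝ → ℝ) (T l : ℝ) (M : ℝ → ℝ → ℝ) : Prop where
  continuous : ContinuousOn (fun p : ℝ × ℝ => M p.1 p.2) (Icc 0 T ×ˢ Ioi 0)
  smooth : ∀ t ∈ Icc 0 T, ContDiffOn ℝ 2 (M t) (Ioi 0)
  continuous_x : ContinuousOn (fun p : ℝ × ℝ => deriv (M p.1) p.2) (Icc 0 T ×ˢ Ioi 0)
  continuous_xx :
    ContinuousOn (fun p : ℝ × ℝ => deriv (deriv (M p.1)) p.2) (Icc 0 T ×ˢ Ioi 0)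
  increasing : ∀ t ∈ Icc 0 T, ∀ x > 0, 0 < deriv (M t) x
  concave : ∀ t ∈ Icc 0 T, ∀ x > 0, deriv (deriv (M t)) x < 0
  /-- The equation; the time derivative is one-sided at `0` and `T`, and it is continuous
  because the right-hand side is. -/
  equation : ∀ t ∈ Icc 0 T, ∀ x > 0,
    HasDerivWithinAt (fun s => M s x)
      (1 / 2 * l ^ 2 * (deriv (M t) x ^ 2 / deriv (deriv (M t)) x)) (Icc 0 T) t
  terminal : ∀ x > 0, M T x = U x
  /-- Without wealth there is nothing to invest, so the value is `U(0+) = 0`. Without this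
  condition the equation has further solutions in the same class. -/
  zero_wealth : ∀ t ∈ Icc 0 T, Tendsto (M t) (𝓝[>] 0) (𝓝 0)

/-- The two state spaces of the slow factor: `ℝ` and `(0, ∞)`. -/
inductive StateSpace
  | line
  | halfLine

/-- The points of the state space. -/
def StateSpace.carrier : StateSpace → Set ℝ
  | .line => univ
  | .halfLine => Ioi 0

/-- At most polynomial growth on the state space. -/
def StateSpace.PolyGrowth : StateSpace → (ℝ → ℝ) → Prop
  | .line, h => ∃ k : ℕ, ∃ a > 0, ∀ z, |h z| ≤ a * (1 + |z| ^ k)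
  | .halfLine, h => ∃ k : ℕ, ∃ a > 0, ∀ z > 0, |h z| ≤ a * (1 + z ^ k + (z ^ k)⁻¹)

/-- `d` is non-negative and at most polynomially growing on the state space. -/
def StateSpace.IsBound (D : StateSpace) (d : ℝ → ℝ) : Prop :=
  (∀ z ∈ D.carrier, 0 ≤ d z) ∧ D.PolyGrowth d

/-- The assumption on the Sharpe ratio `z ↦ lam z`: it is `C³`, and it and its derivatives up to
order three are at most polynomially growing. -/
structure SharpeAssumption (D : StateSpace) (lam : ℝ → ℝ) : Prop where
  smooth : ContDiffOn ℝ 3 lam D.carrier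
  growth : ∀ j ≤ 3, D.PolyGrowth (iteratedDeriv j lam)

/-- Partial derivative in the wealth of a function of `(t, x, z)`. -/
def dx (F : ℝ → ℝ → ℝ → ℝ) (t x z : ℝ) : ℝ := deriv (fun ξ => F t ξ z) x

/-- Partial derivative in the slow factor of a function of `(t, x, z)`. -/
def dz (F : ℝ → ℝ → ℝ → ℝ) (t x z : ℝ) : ℝ := deriv (fun ζ => F t x ζ) z

/-- The risk tolerance function `R = -v_x / v_xx`. -/
def riskTolerance (v : ℝ → ℝ → ℝ → ℝ) (t x z : ℝ) : ℝ := -dx v t x z / dx (dx v) t x z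

/-- At `(t, x, z)` the function `F` has `n` derivatives in the slow factor. -/
def HasDz (n : ℕ) (F : ℝ → ℝ → ℝ → ℝ) (t x z : ℝ) : Prop :=
  ∀ k < n, DifferentiableAt ℝ (fun ζ => dz^[k] F t x ζ) z

end

end Merton

/-!
The value function is identified with its dual representation, and the bounds are read off from
the explicit formula.

In the variable `w = -log y` the inverse marginal utility `G w = I (e^{-w})` solves `G' = R (G)`.
The assumption on the derivatives of `R^i` says exactly that the derivatives of `G` up to order six
are dominated by `G'` (`MarginalFlow.exists_bound`); for the first of these bounds, positivity of
`G'` on the whole line is used. For a constant Sharpe ratio `l` put `s = l √(T - t)`, and let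
`driftMean f s w` and `riseMean f s w` be the means of `f` under the normal laws of variance `s²`
and mean `w ∓ s² / 2`. The dual representation says that the value at wealth
`x = driftMean G s w` is `riseMean (U ∘ G) s w`, with marginal value `e^{-w}`.

A classical solution of the Merton equation is not assumed to satisfy growth conditions beyond
concavity and zero value at zero wealth, so the identification (`IsMertonValue.eq_riseMean`) needs
two comparison arguments.
* `IsMertonValue.riseMean_le` is a minimum principle along dual flows with bounded data. Applied to
  bounded approximations of `U` it shows that the value function dominates the dual representation
  (`IsMertonValue.riseMean_utility_le`). Applied to digital payoffs it shows that a large value at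
  some time forces a large value at time zero, whence a Gaussian growth estimate in the dual
      variable
  (`IsMertonValue.exists_growth`).
* `IsMertonValue.le_riseMean_dualUtility` is the opposite inequality, in the form
  `M t x ≤ x e^{-w} + φ t w` with `φ` the mean of the dual utility. At a positive maximum of the
  difference in `(t, x, w)`, the second order condition along one direction turns the nonlinear
  equation for `M` into the linear one for `φ`. The maximum exists because a barrier, a heat
  kernel at negative times, beats the growth estimate (`IsMertonValue.exists_confinement`).

Time and Sharpe ratio enter the explicit solution only through `s`, and the derivatives of Gaussian
means in `s` carry a factor `s`. Hence the derivatives in the slow factor `z` involve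
`s s' = (T - t) λ λ'` and its derivatives, which grow polynomially, and the ratios
`driftMean (G⁽ʲ⁾) / driftMean G'`, which are bounded; the ratios form a closed system under
differentiation (`MarginalFlow.exists_rates`). Marginal value and risk tolerance have logarithmic
derivatives of this kind, which gives all the bounds with one and the same function of `z`.
-/

namespace Merton

open MeasureTheory ProbabilityTheory Asymptotics

/-! ### Gaussian means -/

/-- The mean of `f` under the normal law with mean `w` and standard deviation `|s|`. -/
noncomputable def gaussMean (f : ℝ → ℝ) (s w : ℝ) : ℝ := ∫ z, f (w + s * z) ∂(gaussianReal 0 1)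

/-- Continuous functions of at most exponential growth. -/
structure ExpBounded (f : ℝ → ℝ) : Prop where
  continuous : Continuous f
  bound : ∃ C, ∀ w, |f w| ≤ C * Real.exp (C * |w|)

lemma ExpBounded.of_le {f : ℝ → ℝ} (hf : Continuous f) {A c : ℝ}
    (h : ∀ w, |f w| ≤ A * Real.exp (c * |w|)) : ExpBounded f := by
  refine ⟨hf, max A c, fun w => (h w).trans ?_⟩
  have hA : 0 ≤ A := by
    have := (abs_nonneg _).trans (h 0)
    simpa using this
  have h1 := le_max_left A c
  have h2 := le_max_right A c
  gcongr

lemma ExpBounded.of_bounded {f : ℝ → ℝ} (hf : Continuous f) {A : ℝ} (h : ∀ w, |f w| ≤ A) :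
    ExpBounded f :=
  .of_le hf (A := A) (c := 0) (by simpa using h)

lemma ExpBounded.const (c : ℝ) : ExpBounded (fun _ => c) :=
  .of_bounded continuous_const (fun _ => le_rfl)

lemma ExpBounded.add {f g : ℝ → ℝ} (hf : ExpBounded f) (hg : ExpBounded g) :
    ExpBounded (fun w => f w + g w) := by
  obtain ⟨C, hC⟩ := hf.bound
  obtain ⟨D, hD⟩ := hg.bound
  have hC0 : 0 ≤ C := by simpa using (abs_nonneg _).trans (hC 0)
  have hD0 : 0 ≤ D := by simpa using (abs_nonneg _).trans (hD 0)
  refine .of_le (hf.continuous.add hg.continuous) (A := C + D) (c := C + D) fun w => ?_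
  calc |f w + g w| ≤ |f w| + |g w| := abs_add_le _ _
    _ ≤ C * Real.exp (C * |w|) + D * Real.exp (D * |w|) := add_le_add (hC w) (hD w)
    _ ≤ C * Real.exp ((C + D) * |w|) + D * Real.exp ((C + D) * |w|) := by
      gcongr <;> linarith
    _ = _ := by ring

lemma ExpBounded.mul {f g : ℝ → ℝ} (hf : ExpBounded f) (hg : ExpBounded g) :
    ExpBounded (fun w => f w * g w) := by
  obtain ⟨C, hC⟩ := hf.bound
  obtain ⟨D, hD⟩ := hg.bound
  refine .of_le (hf.continuous.mul hg.continuous) (A := C * D) (c := C + D) fun w => ?_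
  rw [abs_mul]
  calc |f w| * |g w| ≤ (C * Real.exp (C * |w|)) * (D * Real.exp (D * |w|)) :=
        mul_le_mul (hC w) (hD w) (abs_nonneg _) ((abs_nonneg _).trans (hC w))
    _ = _ := by rw [add_mul, Real.exp_add]; ring

lemma ExpBounded.sub {f g : ℝ → ℝ} (hf : ExpBounded f) (hg : ExpBounded g) :
    ExpBounded (fun w => f w - g w) := by
  simpa [sub_eq_add_neg] using hf.add ((ExpBounded.const (-1)).mul hg)

lemma ExpBounded.exp_neg : ExpBounded (fun w => Real.exp (-w)) := by
  refine .of_le (by fun_prop) (A := 1) (c := 1) fun w => ?_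
  rw [abs_of_pos (Real.exp_pos _), one_mul, one_mul]
  exact Real.exp_le_exp.2 (neg_le_abs w)

lemma integrable_exp_abs (c : ℝ) :
    Integrable (fun z => Real.exp (c * |z|)) (gaussianReal 0 1) := by
  have h1 := integrable_exp_mul_gaussianReal (μ := 0) (v := 1) c
  have h2 := integrable_exp_mul_gaussianReal (μ := 0) (v := 1) (-c)
  exact ProbabilityTheory.integrable_exp_mul_abs h1 h2

/-- A bound that is uniform for parameters in a compact set; it dominates all the integrands
below. -/
lemma ExpBounded.dominate {f : ℝ → ℝ} (hf : ExpBounded f) (S W : ℝ) :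
    ∃ A c : ℝ, ∀ s w, |s| ≤ S → |w| ≤ W → ∀ z,
      |f (w + s * z)| ≤ A * Real.exp (c * |z|) ∧ |f (w + s * z) * z| ≤ A * Real.exp (c * |z|) := by
  obtain ⟨C, hC⟩ := hf.bound
  have hC0 : 0 ≤ C := by simpa using (abs_nonneg _).trans (hC 0)
  refine ⟨C * Real.exp (C * W), C * S + 1, fun s w hs hw z => ?_⟩
  have h0 : |f (w + s * z)| ≤ C * Real.exp (C * W) * Real.exp (C * S * |z|) := by
    refine (hC _).trans ?_
    rw [mul_assoc, ← Real.exp_add]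
    have : |w + s * z| ≤ W + S * |z| := by
      refine (abs_add_le _ _).trans (add_le_add hw ?_)
      rw [abs_mul]
      gcongr
    have h2 : C * |w + s * z| ≤ C * W + C * S * |z| := by nlinarith
    gcongr
  have hz1 : (1 : ℝ) ≤ Real.exp |z| := Real.one_le_exp (abs_nonneg _)
  have hz2 : |z| ≤ Real.exp |z| := by linarith [Real.add_one_le_exp |z|]
  have e : C * Real.exp (C * W) * Real.exp ((C * S + 1) * |z|)
      = C * Real.exp (C * W) * Real.exp (C * S * |z|) * Real.exp |z| := by
    rw [add_mul, Real.exp_add, one_mul]; ring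
  have hnn : 0 ≤ C * Real.exp (C * W) * Real.exp (C * S * |z|) := by positivity
  constructor
  · rw [e]
    nlinarith
  · rw [e, abs_mul]
    exact mul_le_mul h0 hz2 (abs_nonneg _) hnn

lemma ExpBounded.integrable {f : ℝ → ℝ} (hf : ExpBounded f) (s w : ℝ) :
    Integrable (fun z => f (w + s * z)) (gaussianReal 0 1) := by
  obtain ⟨A, c, h⟩ := hf.dominate |s| |w|
  have hc := hf.continuous
  exact ((integrable_exp_abs c).const_mul A).mono'
    (by fun_prop : Continuous fun z => f (w + s * z)).aestronglyMeasurable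
    (.of_forall fun z => (h s w le_rfl le_rfl z).1)

lemma ExpBounded.integrable_mul_id {f : ℝ → ℝ} (hf : ExpBounded f) (s w : ℝ) :
    Integrable (fun z => f (w + s * z) * z) (gaussianReal 0 1) := by
  obtain ⟨A, c, h⟩ := hf.dominate |s| |w|
  have hc := hf.continuous
  exact ((integrable_exp_abs c).const_mul A).mono'
    (by fun_prop : Continuous fun z => f (w + s * z) * z).aestronglyMeasurable
    (.of_forall fun z => (h s w le_rfl le_rfl z).2)

lemma gaussMean_zero (f : ℝ → ℝ) (w : ℝ) : gaussMean f 0 w = f w := by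
  simp [gaussMean]

lemma gaussMean_const (c s w : ℝ) : gaussMean (fun _ => c) s w = c := by
  simp [gaussMean]

lemma gaussMean_neg (f : ℝ → ℝ) (s w : ℝ) : gaussMean f (-s) w = gaussMean f s w := by
  have h := gaussianReal_map_neg (μ := 0) (v := 1)
  rw [neg_zero] at h
  unfold gaussMean
  conv_rhs => rw [← h]
  have e := (MeasurableEquiv.neg ℝ).measurableEmbedding.integral_map
    (μ := gaussianReal 0 1) (fun z => f (w + s * z))
  have e2 : ⇑(MeasurableEquiv.neg ℝ) = fun x : ℝ => -x := rfl
  rw [e2] at e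
  rw [e]
  simp

lemma gaussMean_add {f g : ℝ → ℝ} (hf : ExpBounded f) (hg : ExpBounded g) (s w : ℝ) :
    gaussMean (fun u => f u + g u) s w = gaussMean f s w + gaussMean g s w :=
  integral_add (hf.integrable s w) (hg.integrable s w)

lemma gaussMean_sub {f g : ℝ → ℝ} (hf : ExpBounded f) (hg : ExpBounded g) (s w : ℝ) :
    gaussMean (fun u => f u - g u) s w = gaussMean f s w - gaussMean g s w :=
  integral_sub (hf.integrable s w) (hg.integrable s w)

lemma gaussMean_const_mul (c : ℝ) (f : ℝ → ℝ) (s w : ℝ) :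
    gaussMean (fun u => c * f u) s w = c * gaussMean f s w :=
  integral_const_mul _ _

lemma gaussMean_mono {f g : ℝ → ℝ} (hf : ExpBounded f) (hg : ExpBounded g) (h : ∀ u, f u ≤ g u)
    (s w : ℝ) : gaussMean f s w ≤ gaussMean g s w :=
  integral_mono (hf.integrable s w) (hg.integrable s w) fun _ => h _

lemma gaussMean_nonneg {f : ℝ → ℝ} (h : ∀ u, 0 ≤ f u) (s w : ℝ) : 0 ≤ gaussMean f s w :=
  integral_nonneg fun _ => h _

lemma abs_gaussMean_le {f g : ℝ → ℝ} (hg : ExpBounded g)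
    (h : ∀ u, |f u| ≤ g u) (s w : ℝ) : |gaussMean f s w| ≤ gaussMean g s w :=
  norm_integral_le_of_norm_le (f := fun z => f (w + s * z)) (hg.integrable s w)
    (.of_forall fun _ => h _)

lemma continuous_gaussMean {f : ℝ → ℝ} (hf : ExpBounded f) :
    Continuous fun p : ℝ × ℝ => gaussMean f p.1 p.2 := by
  rw [continuous_iff_continuousAt]
  intro p
  obtain ⟨A, c, h⟩ := hf.dominate (|p.1| + 1) (|p.2| + 1)
  have hc := hf.continuous
  have h1 : ∀ᶠ q : ℝ × ℝ in 𝓝 p, |q.1| < |p.1| + 1 :=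
    (continuous_fst.abs.tendsto p).eventually (gt_mem_nhds (by simp))
  have h2 : ∀ᶠ q : ℝ × ℝ in 𝓝 p, |q.2| < |p.2| + 1 :=
    (continuous_snd.abs.tendsto p).eventually (gt_mem_nhds (by simp))
  refine tendsto_integral_filter_of_dominated_convergence (fun z => A * Real.exp (c * |z|))
    (.of_forall fun q =>
      (by fun_prop : Continuous fun z => f (q.2 + q.1 * z)).aestronglyMeasurable)
    ?_ ((integrable_exp_abs c).const_mul A) (.of_forall fun z => ?_)
  · filter_upwards [h1, h2] with q hq1 hq2
    exact .of_forall fun z => (h q.1 q.2 hq1.le hq2.le z).1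
  · exact (by fun_prop : Continuous fun q : ℝ × ℝ => f (q.2 + q.1 * z)).tendsto p

/-- Strict positivity: the normal law charges every interval. -/
lemma gaussMean_pos {f : ℝ → ℝ} (hf : ExpBounded f) (h : ∀ u, 0 ≤ f u) {s w : ℝ}
    (hpos : ∃ z, 0 < f (w + s * z)) : 0 < gaussMean f s w := by
  obtain ⟨z, hz⟩ := hpos
  have hc := hf.continuous
  have hcont : Continuous fun z => f (w + s * z) := by fun_prop
  have : (gaussianReal 0 1).IsOpenPosMeasure :=
    (gaussianReal_absolutelyContinuous' 0 one_ne_zero).isOpenPosMeasure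
  exact integral_pos_of_integrable_nonneg_nonzero hcont (hf.integrable s w) (fun _ => h _) hz.ne'

lemma integral_gaussianReal_eq (f : ℝ → ℝ) :
    ∫ z, f z ∂(gaussianReal 0 1) = ∫ z, gaussianPDFReal 0 1 z * f z := by
  simpa using integral_gaussianReal_eq_integral_smul (μ := 0) (v := 1) (f := f) one_ne_zero

lemma integrable_gaussianReal_iff {f : ℝ → ℝ} :
    Integrable f (gaussianReal 0 1) ↔ Integrable (fun z => gaussianPDFReal 0 1 z * f z) := by
  rw [gaussianReal_of_var_ne_zero 0 one_ne_zero,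
    integrable_withDensity_iff_integrable_smul' (measurable_gaussianPDF 0 1)
      (.of_forall fun _ => gaussianPDF_lt_top)]
  simp [toReal_gaussianPDF]

lemma gaussianPDFReal_standard (z : ℝ) :
    gaussianPDFReal 0 1 z = (√(2 * Real.pi))⁻¹ * Real.exp (-z ^ 2 / 2) := by
  simp [gaussianPDFReal_def]

/-- Integration by parts against the standard normal density. -/
lemma integral_mul_id_gaussianReal {h h' : ℝ → ℝ} (hd : ∀ z, HasDerivAt h (h' z) z)
    (hh : Integrable h (gaussianReal 0 1)) (hhz : Integrable (fun z => h z * z) (gaussianReal 0 1))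
    (hh' : Integrable h' (gaussianReal 0 1)) :
    ∫ z, h z * z ∂(gaussianReal 0 1) = ∫ z, h' z ∂(gaussianReal 0 1) := by
  have hv : ∀ z, HasDerivAt (fun z => -gaussianPDFReal 0 1 z) (z * gaussianPDFReal 0 1 z) z := by
    intro z
    have h1 : HasDerivAt (fun z : ℝ => -z ^ 2 / 2) (-z) z := by
      refine (((hasDerivAt_id z).pow 2).neg.div_const 2).congr_deriv ?_
      simp
      ring
    have h2 := ((h1.exp).const_mul (√(2 * Real.pi))⁻¹).neg
    simp only [gaussianPDFReal_standard]
    refine h2.congr_deriv ?_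
    ring
  rw [integrable_gaussianReal_iff] at hh hhz hh'
  rw [integral_gaussianReal_eq, integral_gaussianReal_eq]
  have key := integral_mul_deriv_eq_deriv_mul_of_integrable (u := h) (u' := h')
    (v := fun z => -gaussianPDFReal 0 1 z) (v' := fun z => z * gaussianPDFReal 0 1 z)
    (fun z _ => hd z) (fun z _ => hv z)
    (hhz.congr (.of_forall fun z => by simp; ring))
    (hh'.neg.congr (.of_forall fun z => by simp; ring))
    (hh.neg.congr (.of_forall fun z => by simp; ring))
  calc _ = ∫ z, h z * (z * gaussianPDFReal 0 1 z) := by congr 1; ext z; ring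
    _ = -∫ z, h' z * -gaussianPDFReal 0 1 z := key
    _ = _ := by rw [← integral_neg]; congr 1; ext z; ring

/-- Change of measure: exponential weights shift the normal law. -/
lemma gaussMean_exp_neg_mul (f : ℝ → ℝ) (s w : ℝ) :
    gaussMean (fun u => Real.exp (-u) * f u) s (w + s ^ 2 / 2)
      = Real.exp (-w) * gaussMean f s (w - s ^ 2 / 2) := by
  unfold gaussMean
  rw [integral_gaussianReal_eq, integral_gaussianReal_eq, ← integral_const_mul,
    ← integral_add_right_eq_self (μ := volume)
      (fun z => Real.exp (-w) * (gaussianPDFReal 0 1 z * f (w - s ^ 2 / 2 + s * z))) s]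
  congr 1
  ext z
  simp only [gaussianPDFReal_standard]
  have e1 : w + s ^ 2 / 2 + s * z = w - s ^ 2 / 2 + s * (z + s) := by ring
  rw [← e1]
  have e2 : Real.exp (-z ^ 2 / 2) * Real.exp (-(w + s ^ 2 / 2 + s * z))
      = Real.exp (-w) * Real.exp (-(z + s) ^ 2 / 2) := by
    rw [← Real.exp_add, ← Real.exp_add]; congr 1; ring
  linear_combination (√(2 * Real.pi))⁻¹ * f (w + s ^ 2 / 2 + s * z) * e2

lemma hasDerivAt_gaussMean_right {f f' : ℝ → ℝ} (hd : ∀ u, HasDerivAt f (f' u) u)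
    (hf : ExpBounded f) (hf' : ExpBounded f') (s w : ℝ) :
    HasDerivAt (fun w => gaussMean f s w) (gaussMean f' s w) w := by
  obtain ⟨A, c, h⟩ := hf'.dominate |s| (|w| + 1)
  have hc := hf.continuous
  have hc' := hf'.continuous
  have hU : {u : ℝ | |u| < |w| + 1} ∈ 𝓝 w :=
    (continuous_abs.tendsto w).eventually (gt_mem_nhds (by simp))
  refine (hasDerivAt_integral_of_dominated_loc_of_deriv_le hU
    (F := fun w z => f (w + s * z)) (F' := fun w z => f' (w + s * z))
    (bound := fun z => A * Real.exp (c * |z|))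
    (.of_forall fun q => (by fun_prop : Continuous fun z => f (q + s * z)).aestronglyMeasurable)
    (hf.integrable s w)
    (by fun_prop : Continuous fun z => f' (w + s * z)).aestronglyMeasurable
    (.of_forall fun z u hu => (h s u le_rfl (le_of_lt hu) z).1)
    ((integrable_exp_abs c).const_mul A) (.of_forall fun z u _ => ?_)).2
  simpa using (hd (u + s * z)).comp_add_const u (s * z)

/-- The heat equation for Gaussian means, in terms of the standard deviation. The formula holds for
every real `s`, so that there is no singularity at `s = 0`. -/
lemma hasDerivAt_gaussMean_left {f f' f'' : ℝ → ℝ} (hd : ∀ u, HasDerivAt f (f' u) u)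
    (hd' : ∀ u, HasDerivAt f' (f'' u) u)
    (hf : ExpBounded f) (hf' : ExpBounded f') (hf'' : ExpBounded f'') (s w : ℝ) :
    HasDerivAt (fun s => gaussMean f s w) (s * gaussMean f'' s w) s := by
  obtain ⟨A, c, h⟩ := hf'.dominate (|s| + 1) |w|
  have hc := hf.continuous
  have hc' := hf'.continuous
  have hU : {u : ℝ | |u| < |s| + 1} ∈ 𝓝 s :=
    (continuous_abs.tendsto s).eventually (gt_mem_nhds (by simp))
  have key := (hasDerivAt_integral_of_dominated_loc_of_deriv_le hU
    (F := fun s z => f (w + s * z)) (F' := fun s z => f' (w + s * z) * z)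
    (bound := fun z => A * Real.exp (c * |z|))
    (.of_forall fun q => (by fun_prop : Continuous fun z => f (w + q * z)).aestronglyMeasurable)
    (hf.integrable s w)
    (by fun_prop : Continuous fun z => f' (w + s * z) * z).aestronglyMeasurable
    (.of_forall fun z u hu => (h u w (le_of_lt hu) le_rfl z).2)
    ((integrable_exp_abs c).const_mul A) (.of_forall fun z u _ => ?_)).2
  · refine key.congr_deriv ?_
    have hst := integral_mul_id_gaussianReal (h := fun z => f' (w + s * z))
      (h' := fun z => s * f'' (w + s * z)) (fun z => ?_) (hf'.integrable s w)
      (hf'.integrable_mul_id s w) ((hf''.integrable s w).const_mul s)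
    · rw [hst, integral_const_mul, gaussMean]
    · have h1 : HasDerivAt (fun z => w + s * z) s z := by
        simpa using ((hasDerivAt_id z).const_mul s).const_add w
      exact ((hd' (w + s * z)).comp z h1).congr_deriv (by ring)
  · have h1 : HasDerivAt (fun u => w + u * z) z u := by
      simpa using ((hasDerivAt_id u).mul_const z).const_add w
    exact (hd (w + u * z)).comp u h1

/-- Joint strict differentiability in the standard deviation and the mean. -/
lemma hasStrictFDerivAt_gaussMean {f f' f'' : ℝ → ℝ} (hd : ∀ u, HasDerivAt f (f' u) u)
    (hd' : ∀ u, HasDerivAt f' (f'' u) u)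
    (hf : ExpBounded f) (hf' : ExpBounded f') (hf'' : ExpBounded f'') (p : ℝ × ℝ) :
    HasStrictFDerivAt (fun p : ℝ × ℝ => gaussMean f p.1 p.2)
      ((p.1 * gaussMean f'' p.1 p.2) • ContinuousLinearMap.fst ℝ ℝ ℝ
        + gaussMean f' p.1 p.2 • ContinuousLinearMap.snd ℝ ℝ ℝ) p := by
  have c1 : Continuous fun q : ℝ × ℝ => q.1 * gaussMean f'' q.1 q.2 :=
    continuous_fst.mul (continuous_gaussMean hf'')
  have c2 := continuous_gaussMean hf'
  have := hasStrictFDerivAt_uncurry_coprod (u := p) (f := gaussMean f)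
    (f₁ := fun s w => ContinuousLinearMap.toSpanSingleton ℝ (s * gaussMean f'' s w))
    (f₂ := fun s w => ContinuousLinearMap.toSpanSingleton ℝ (gaussMean f' s w))
    (.of_forall fun q => (hasDerivAt_gaussMean_left hd hd' hf hf' hf'' q.1 q.2).hasFDerivAt)
    (.of_forall fun q => (hasDerivAt_gaussMean_right hd hf hf' q.1 q.2).hasFDerivAt)
    ?_ ?_
  · refine this.congr_fderiv ?_
    ext <;> simp [Function.HasUncurry.uncurry]
  · exact ((ContinuousLinearMap.toSpanSingletonCLE (𝕜 := ℝ) (E :=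
      ℝ)).continuous.comp c1).continuousAt
  · exact ((ContinuousLinearMap.toSpanSingletonCLE (𝕜 := ℝ) (E :=
      ℝ)).continuous.comp c2).continuousAt

/-- The mean of `f` under the normal law with standard deviation `|s|` and mean `w - s² / 2`. -/
noncomputable def driftMean (f : ℝ → ℝ) (s w : ℝ) : ℝ := gaussMean f s (w - s ^ 2 / 2)

lemma continuous_driftMean {f : ℝ → ℝ} (hf : ExpBounded f) :
    Continuous fun p : ℝ × ℝ => driftMean f p.1 p.2 :=
  (continuous_gaussMean hf).comp
    (by fun_prop : Continuous fun p : ℝ × ℝ => (p.1, p.2 - p.1 ^ 2 / 2))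

lemma hasDerivAt_driftMean_right {f f' : ℝ → ℝ} (hd : ∀ u, HasDerivAt f (f' u) u)
    (hf : ExpBounded f) (hf' : ExpBounded f') (s w : ℝ) :
    HasDerivAt (fun w => driftMean f s w) (driftMean f' s w) w :=
  (hasDerivAt_gaussMean_right hd hf hf' s _).comp_sub_const w (s ^ 2 / 2)

lemma hasStrictFDerivAt_driftMean {f f' f'' : ℝ → ℝ} (hd : ∀ u, HasDerivAt f (f' u) u)
    (hd' : ∀ u, HasDerivAt f' (f'' u) u)
    (hf : ExpBounded f) (hf' : ExpBounded f') (hf'' : ExpBounded f'') (p : ℝ × ℝ) :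
    HasStrictFDerivAt (fun p : ℝ × ℝ => driftMean f p.1 p.2)
      ((p.1 * (driftMean f'' p.1 p.2 - driftMean f' p.1 p.2)) • ContinuousLinearMap.fst ℝ ℝ ℝ
        + driftMean f' p.1 p.2 • ContinuousLinearMap.snd ℝ ℝ ℝ) p := by
  have h0 : HasStrictFDerivAt (fun p : ℝ × ℝ => (p.1, p.2 - p.1 ^ 2 / 2))
      ((ContinuousLinearMap.fst ℝ ℝ ℝ).prod
        (ContinuousLinearMap.snd ℝ ℝ ℝ - p.1 • ContinuousLinearMap.fst ℝ ℝ ℝ)) p := by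
    have h2 : HasStrictFDerivAt (fun p : ℝ × ℝ => p.1 ^ 2 / 2)
        (p.1 • ContinuousLinearMap.fst ℝ ℝ ℝ) p := by
      have h3 : HasStrictDerivAt (fun s : ℝ => s ^ 2 / 2) p.1 p.1 := by
        simpa using ((hasStrictDerivAt_id p.1).pow 2).div_const 2
      exact h3.comp_hasStrictFDerivAt p hasStrictFDerivAt_fst
    exact hasStrictFDerivAt_fst.prodMk (hasStrictFDerivAt_snd.sub h2)
  have h1 := (hasStrictFDerivAt_gaussMean hd hd' hf hf' hf'' (p.1, p.2 - p.1 ^ 2 / 2)).comp p h0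
  refine h1.congr_fderiv ?_
  ext <;> simp [driftMean]
  ring

/-- Chain rule for a Gaussian mean along a differentiable curve. -/
lemma hasDerivAt_driftMean_curve {f f' f'' : ℝ → ℝ} (hd : ∀ u, HasDerivAt f (f' u) u)
    (hd' : ∀ u, HasDerivAt f' (f'' u) u)
    (hf : ExpBounded f) (hf' : ExpBounded f') (hf'' : ExpBounded f'') {s w : ℝ → ℝ} {s' w' z : ℝ}
    (hs : HasDerivAt s s' z) (hw : HasDerivAt w w' z) :
    HasDerivAt (fun z => driftMean f (s z) (w z))
      (s z * s' * (driftMean f'' (s z) (w z) - driftMean f' (s z) (w z))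
        + w' * driftMean f' (s z) (w z)) z := by
  have h := ((hasStrictFDerivAt_driftMean hd hd' hf hf' hf''
      (s z, w z)).hasFDerivAt).comp_hasDerivAt
    z (hs.prodMk hw)
  refine h.congr_deriv ?_
  simp
  ring

/-! ### The utility in logarithmic marginal units -/

namespace UtilityAssumption

variable {U : ℝ → ℝ}

lemma contDiffOn_deriv (hU : UtilityAssumption U) : ContDiffOn ℝ 6 (deriv U) (Ioi 0) :=
  hU.smooth.deriv_of_isOpen isOpen_Ioi (by norm_num)

lemma contDiffOn_deriv_deriv (hU : UtilityAssumption U) :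
    ContDiffOn ℝ 5 (deriv (deriv U)) (Ioi 0) :=
  hU.contDiffOn_deriv.deriv_of_isOpen isOpen_Ioi (by norm_num)

lemma hasDerivAt (hU : UtilityAssumption U) {x : ℝ} (hx : 0 < x) : HasDerivAt U (deriv U x) x :=
  ((hU.smooth.contDiffAt (Ioi_mem_nhds hx)).differentiableAt (by norm_num)).hasDerivAt

lemma hasDerivAt_deriv (hU : UtilityAssumption U) {x : ℝ} (hx : 0 < x) :
    HasDerivAt (deriv U) (deriv (deriv U) x) x :=
  ((hU.contDiffOn_deriv.contDiffAt (Ioi_mem_nhds hx)).differentiableAt (by norm_num)).hasDerivAt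

lemma tolerance_pos (hU : UtilityAssumption U) {x : ℝ} (hx : 0 < x) : 0 < tolerance U x := by
  have h2 : (0 : ℝ) ≤ tolerance U (x / 2) := by
    refine le_of_tendsto hU.tolerance_zero ?_
    filter_upwards [Ioo_mem_nhdsGT (half_pos hx)] with y hy
    exact (hU.tolerance_strictMono hy.1 (half_pos hx) hy.2).le
  exact h2.trans_lt (hU.tolerance_strictMono (half_pos hx) hx (half_lt_self hx))

lemma deriv_pos (hU : UtilityAssumption U) {x : ℝ} (hx : 0 < x) : 0 < deriv U x := by
  have h0 : 0 ≤ deriv U x := by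
    have h := hU.strictMono.monotoneOn.derivWithin_nonneg (x := x)
    rwa [derivWithin_of_mem_nhds (Ioi_mem_nhds hx)] at h
  refine h0.lt_of_ne fun h => ?_
  have := hU.tolerance_pos hx
  simp [tolerance, ← h] at this

lemma deriv_deriv_neg (hU : UtilityAssumption U) {x : ℝ} (hx : 0 < x) :
    deriv (deriv U) x < 0 := by
  have h := hU.tolerance_pos hx
  have h' := hU.deriv_pos hx
  unfold tolerance at h
  by_contra! hc
  have : -deriv U x / deriv (deriv U) x ≤ 0 := div_nonpos_of_nonpos_of_nonneg (by linarith) hc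
  linarith

lemma strictAntiOn_deriv (hU : UtilityAssumption U) : StrictAntiOn (deriv U) (Ioi 0) := by
  refine strictAntiOn_of_deriv_neg (convex_Ioi 0) hU.contDiffOn_deriv.continuousOn fun x hx => ?_
  rw [interior_Ioi] at hx
  exact hU.deriv_deriv_neg hx

lemma contDiffOn_tolerance (hU : UtilityAssumption U) : ContDiffOn ℝ 5 (tolerance U) (Ioi 0) :=
  (hU.contDiffOn_deriv.of_le (by norm_num)).neg.div hU.contDiffOn_deriv_deriv
    fun _ hx => (hU.deriv_deriv_neg hx).ne

lemma pos (hU : UtilityAssumption U) {x : ℝ} (hx : 0 < x) : 0 < U x := by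
  have h2 : (0 : ℝ) ≤ U (x / 2) := le_of_tendsto hU.zero <| by
    filter_upwards [Ioo_mem_nhdsGT (half_pos hx)] with y hy
    exact (hU.strictMono hy.1 (half_pos hx) hy.2).le
  exact h2.trans_lt (hU.strictMono (half_pos hx) hx (half_lt_self hx))

end UtilityAssumption

/-- The inverse marginal utility in the variable `w = -log y`, together with its derivatives:
`G 0 w = I (e^{-w})`, and `G j` is the `j`-th derivative of `G 0`. In this variable
`G 0` solves the autonomous equation `G' = R (G)`, with `R` the risk tolerance. -/
structure MarginalFlow (U : ℝ → ℝ) (G : ℕ → ℝ → ℝ) : Prop where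
  pos : ∀ w, 0 < G 0 w
  marginal : ∀ w, deriv U (G 0 w) = Real.exp (-w)
  hasDerivAt : ∀ j < 6, ∀ w, HasDerivAt (G j) (G (j + 1) w) w
  one : ∀ w, G 1 w = tolerance U (G 0 w)
  continuous_six : Continuous (G 6)

/-- Iterates of the vector field `R ∂ₓ` applied to the identity. -/
noncomputable def flowCoeff (R : ℝ → ℝ) : ℕ → ℝ → ℝ
  | 0 => id
  | j + 1 => fun x => R x * deriv (flowCoeff R j) x

lemma contDiffOn_flowCoeff {R : ℝ → ℝ} (hR : ContDiffOn ℝ 5 R (Ioi 0)) (j n : ℕ) (h : j + n = 6) :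
    ContDiffOn ℝ n (flowCoeff R j) (Ioi 0) := by
  induction j generalizing n with
  | zero => exact contDiffOn_id
  | succ j ih =>
    have h1 := (ih (n + 1) (by omega)).deriv_of_isOpen (m := n) isOpen_Ioi (by norm_cast)
    refine (hR.of_le ?_).mul h1
    have : n ≤ 5 := by omega
    exact_mod_cast this

lemma UtilityAssumption.exists_marginalFlow {U : ℝ → ℝ} (hU : UtilityAssumption U) :
    ∃ G, MarginalFlow U G := by
  obtain ⟨I, hI, -⟩ := hU.inverse_growth
  have hpos : ∀ w : ℝ, 0 < I (Real.exp (-w)) := fun w => (hI _ (Real.exp_pos _)).1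
  have hmarg : ∀ w : ℝ, deriv U (I (Real.exp (-w))) = Real.exp (-w) :=
    fun w => (hI _ (Real.exp_pos _)).2
  have hG : ∀ w : ℝ, HasDerivAt (fun w => I (Real.exp (-w))) (tolerance U (I (Real.exp
      (-w)))) w := by
    intro w
    set x := I (Real.exp (-w)) with hx
    have hx0 : 0 < x := hpos w
    have hs : HasStrictDerivAt (deriv U) (deriv (deriv U) x) x :=
      (hU.contDiffOn_deriv.contDiffAt (Ioi_mem_nhds hx0)).hasStrictDerivAt (by norm_num)
    have hinv := hs.to_local_left_inverse (hU.deriv_deriv_neg hx0).ne (g := I) <| by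
      filter_upwards [Ioi_mem_nhds hx0] with u hu
      have h := hI _ (hU.deriv_pos hu)
      exact hU.strictAntiOn_deriv.injOn h.1 hu h.2
    have hm : deriv U x = Real.exp (-w) := hmarg w
    rw [hm] at hinv
    have he : HasDerivAt (fun w : ℝ => Real.exp (-w)) (-Real.exp (-w)) w := by
      simpa using (hasDerivAt_neg w).exp
    refine (hinv.hasDerivAt.comp w he).congr_deriv ?_
    rw [tolerance, hm, div_eq_mul_inv]
    ring
  have hS := fun j n h => contDiffOn_flowCoeff hU.contDiffOn_tolerance j n h
  refine ⟨fun j w => flowCoeff (tolerance U) j (I (Real.exp (-w))), hpos, hmarg, ?_, ?_, ?_⟩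
  · intro j hj w
    have h1 : HasDerivAt (flowCoeff (tolerance U) j) (deriv (flowCoeff (tolerance U) j)
        (I (Real.exp (-w)))) (I (Real.exp (-w))) := by
      refine (((hS j (6 - j) (by omega)).contDiffAt (Ioi_mem_nhds (hpos w))).differentiableAt
        ?_).hasDerivAt
      have : 6 - j ≠ 0 := by omega
      exact_mod_cast this
    exact (h1.comp w (hG w)).congr_deriv (mul_comm _ _)
  · intro w
    simp [flowCoeff]
  · refine (hS 6 0 rfl).continuousOn.comp_continuous ?_ hpos
    exact continuous_iff_continuousAt.2 fun w => (hG w).continuousAt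

/-- A positive function on the whole line with `p'' ≤ c² p` satisfies `p' ≤ c p`. Otherwise, since
`(p' - c p) e^{c w}` is antitone, `p` would be driven below zero far to the left. -/
lemma deriv_le_of_deriv_deriv_le {p p' p'' : ℝ → ℝ} (hp : ∀ w, HasDerivAt p (p' w) w)
    (hp' : ∀ w, HasDerivAt p' (p'' w) w) (hpos : ∀ w, 0 < p w) {c : ℝ} (hc : 0 ≤ c)
    (h : ∀ w, p'' w ≤ c ^ 2 * p w) (w₀ : ℝ) : p' w₀ ≤ c * p w₀ := by
  by_contra! hlt
  set h₀ := p' w₀ - c * p w₀ with hh₀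
  have h₀pos : 0 < h₀ := by linarith
  have hk : Antitone fun w => (p' w - c * p w) * Real.exp (c * w) := by
    have hd : ∀ w, HasDerivAt (fun w => (p' w - c * p w) * Real.exp (c * w))
        ((p'' w - c ^ 2 * p w) * Real.exp (c * w)) w := by
      intro w
      have he : HasDerivAt (fun w => Real.exp (c * w)) (Real.exp (c * w) * c) w := by
        simpa using ((hasDerivAt_id w).const_mul c).exp
      refine (((hp' w).fun_sub ((hp w).const_mul c)).fun_mul he).congr_deriv ?_
      ring
    refine antitone_of_hasDerivAt_nonpos hd fun w => ?_
    have := h w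
    exact mul_nonpos_of_nonpos_of_nonneg (by linarith) (Real.exp_pos _).le
  have hlow : ∀ w ≤ w₀, h₀ ≤ p' w := by
    intro w hw
    have h1 : h₀ * Real.exp (c * w₀) ≤ (p' w - c * p w) * Real.exp (c * w) := hk hw
    have h2 : Real.exp (c * w) ≤ Real.exp (c * w₀) :=
      Real.exp_le_exp.2 (mul_le_mul_of_nonneg_left hw hc)
    have h3 : h₀ * Real.exp (c * w) ≤ (p' w - c * p w) * Real.exp (c * w) :=
      (mul_le_mul_of_nonneg_left h2 h₀pos.le).trans h1
    have h4 := le_of_mul_le_mul_right h3 (Real.exp_pos _)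
    have := mul_nonneg hc (hpos w).le
    linarith
  have hmono : MonotoneOn (fun w => p w - h₀ * w) (Iic w₀) := by
    refine monotoneOn_of_hasDerivWithinAt_nonneg (convex_Iic w₀)
      (f' := fun w => p' w - h₀) ?_ ?_ ?_
    · exact fun w _ => ((hp w).sub ((hasDerivAt_id w).const_mul h₀)).continuousAt.continuousWithinAt
    · intro w _
      simpa using ((hp w).fun_sub ((hasDerivAt_id w).const_mul h₀)).hasDerivWithinAt
    · intro w hw
      rw [interior_Iic] at hw
      exact sub_nonneg.2 (hlow w (le_of_lt hw))
  have hq : 0 < p w₀ / h₀ := div_pos (hpos _) h₀pos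
  have h5 := hmono (a := w₀ - p w₀ / h₀) (b := w₀) (by simp [hq.le]) (by simp) (by linarith)
  simp only at h5
  have h6 : h₀ * (w₀ - p w₀ / h₀) = h₀ * w₀ - p w₀ := by field_simp
  rw [h6] at h5
  linarith [hpos (w₀ - p w₀ / h₀)]

lemma abs_deriv_le_of_abs_deriv_deriv_le {p p' p'' : ℝ → ℝ} (hp : ∀ w, HasDerivAt p (p' w) w)
    (hp' : ∀ w, HasDerivAt p' (p'' w) w) (hpos : ∀ w, 0 < p w) {c : ℝ} (hc : 0 ≤ c)
    (h : ∀ w, |p'' w| ≤ c ^ 2 * p w) (w : ℝ) : |p' w| ≤ c * p w := by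
  refine abs_le.2 ⟨?_, deriv_le_of_deriv_deriv_le hp hp' hpos hc
    (fun w => (le_abs_self _).trans (h w)) w⟩
  have := deriv_le_of_deriv_deriv_le (p := fun w => p (-w)) (p' := fun w => -p' (-w))
    (p'' := fun w => p'' (-w))
    (fun w => ((hp (-w)).comp w (hasDerivAt_neg w)).congr_deriv (by simp))
    (fun w => ((hp' (-w)).comp w (hasDerivAt_neg w)).neg.congr_deriv (by simp))
    (fun w => hpos _) hc (fun w => (le_abs_self _).trans (h _)) (-w)
  simp at this
  linarith

namespace MarginalFlow

variable {U : ℝ → ℝ} {G : ℕ → ℝ → ℝ}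

lemma one_pos (hG : MarginalFlow U G) (hU : UtilityAssumption U) (w : ℝ) : 0 < G 1 w :=
  (hG.one w).symm ▸ hU.tolerance_pos (hG.pos w)

lemma continuous (hG : MarginalFlow U G) {j : ℕ} (hj : j ≤ 6) : Continuous (G j) := by
  rcases hj.lt_or_eq with h | rfl
  · exact continuous_iff_continuousAt.2 fun w => (hG.hasDerivAt j h w).continuousAt
  · exact hG.continuous_six

lemma apply_neg_log (hG : MarginalFlow U G) (hU : UtilityAssumption U) {x : ℝ} (hx : 0 < x) :
    G 0 (-Real.log (deriv U x)) = x := by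
  refine hU.strictAntiOn_deriv.injOn (hG.pos _) hx ?_
  rw [hG.marginal, neg_neg, Real.exp_log (hU.deriv_pos hx)]

lemma strictMono (hG : MarginalFlow U G) (hU : UtilityAssumption U) : StrictMono (G 0) :=
  strictMono_of_hasDerivAt_pos (fun w => hG.hasDerivAt 0 (by norm_num) w) (hG.one_pos hU)

lemma tendsto_atBot (hG : MarginalFlow U G) (hU : UtilityAssumption U) :
    Tendsto (G 0) atBot (𝓝[>] 0) := by
  refine tendsto_nhdsWithin_iff.2 ⟨?_, .of_forall hG.pos⟩
  rw [Metric.tendsto_nhds]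
  intro ε hε
  filter_upwards [eventually_lt_atBot (-Real.log (deriv U ε))] with w hw
  have := hG.strictMono hU hw
  rw [hG.apply_neg_log hU hε] at this
  rwa [Real.dist_eq, sub_zero, abs_of_pos (hG.pos w)]

lemma tendsto_atTop (hG : MarginalFlow U G) (hU : UtilityAssumption U) :
    Tendsto (G 0) atTop atTop := by
  refine tendsto_atTop_mono' atTop (f₁ := G 0) .rfl ?_
  refine Filter.tendsto_atTop.2 fun b => ?_
  filter_upwards [eventually_gt_atTop (-Real.log (deriv U (max b 1)))] with w hw
  have := hG.strictMono hU hw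
  rw [hG.apply_neg_log hU (by positivity)] at this
  exact (le_max_left _ _).trans this.le

/-- Differentiation in wealth, expressed in the variable `w`. -/
lemma deriv_comp (hG : MarginalFlow U G) (hU : UtilityAssumption U) {f A A' : ℝ → ℝ}
    {n : ℕ} (hf : ∀ w, f (G 0 w) = G 1 w ^ (n + 1) * A w) (hA : ∀ w, HasDerivAt A (A' w) w)
    (w : ℝ) :
    deriv f (G 0 w) = G 1 w ^ n * ((n + 1) * (G 2 w / G 1 w) * A w + A' w) := by
  have hp := (hG.one_pos hU w).ne'
  have hx := hG.pos w
  have h1 : HasDerivAt (fun w => G 1 w ^ (n + 1) * A w)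
      (((n + 1) * G 1 w ^ n * G 2 w) * A w + G 1 w ^ (n + 1) * A' w) w := by
    refine (((hG.hasDerivAt 1 (by norm_num) w).fun_pow (n + 1)).fun_mul (hA w)).congr_deriv ?_
    simp
  have hlog : HasDerivAt (fun x => -Real.log (deriv U x)) (G 1 w)⁻¹ (G 0 w) := by
    refine ((hU.hasDerivAt_deriv hx).log (hU.deriv_pos hx).ne').neg.congr_deriv ?_
    rw [hG.one, tolerance, inv_div, div_neg]
  have hw : -Real.log (deriv U (G 0 w)) = w := by
    rw [hG.marginal, Real.log_exp, neg_neg]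
  have h2 : HasDerivAt f ((((n + 1) * G 1 w ^ n * G 2 w) * A w + G 1 w ^ (n + 1) * A' w)
      * (G 1 w)⁻¹) (G 0 w) := by
    rw [← hw] at h1
    have h3 := HasDerivAt.comp (G 0 w) h1 hlog
    rw [hw] at h3
    refine h3.congr_of_eventuallyEq ?_
    filter_upwards [Ioi_mem_nhds hx] with x hx
    conv_lhs => rw [← hG.apply_neg_log hU hx]
    exact hf _
  rw [h2.deriv]
  field_simp
  ring

/-- The derivatives of the inverse marginal utility are dominated by the first one. This is what
the bounds on the derivatives `(R^i)^{(i)}` mean in the variable `w`: up to polynomials in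
quantities bounded before, `(R^i)^{(i)}` is `i` times the ratio of the derivatives of order `i + 1`
and `1`. -/
lemma exists_bound (hG : MarginalFlow U G) (hU : UtilityAssumption U) :
    ∃ C, 1 ≤ C ∧ ∀ j, 1 ≤ j → j ≤ 6 → ∀ w, |G j w| ≤ C * G 1 w := by
  obtain ⟨K, hK⟩ := hU.tolerance_bound
  have hpos := hG.one_pos hU
  set b : ℕ → ℝ → ℝ := fun j w => G (j + 1) w / G 1 w with hb
  have hbd : ∀ j, 1 ≤ j → j < 5 → ∀ w, HasDerivAt (b j) (b (j + 1) w - b j w * b 1 w) w := by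
    intro j hj hj5 w
    refine ((hG.hasDerivAt (j + 1) (by omega) w).div (hG.hasDerivAt 1 (by norm_num) w)
      (hpos w).ne').congr_deriv ?_
    have := (hpos w).ne'
    simp only [hb]
    field_simp
  have hpow : ∀ (i : ℕ) (w : ℝ), tolerance U (G 0 w) ^ i = G 1 w ^ i * 1 := by
    intro i w
    rw [hG.one, mul_one]
  have hstep := fun {f A A' : ℝ → ℝ} {n : ℕ} =>
    hG.deriv_comp hU (f := f) (A := A) (A' := A') (n := n)
  have h1 := hbd 1 le_rfl (by norm_num)
  have h2 := hbd 2 (by norm_num) (by norm_num)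
  have h3 := hbd 3 (by norm_num) (by norm_num)
  have h4 := hbd 4 (by norm_num) (by norm_num)
  have hb1 : ∀ w, G 2 w / G 1 w = b 1 w := fun w => rfl
  have hc := fun w : ℝ => hasDerivAt_const w (1 : ℝ)
  -- `(R^i)^{(i)}` as a polynomial in the ratios `b`, one wealth derivative at a time
  have B2 : ∀ w, |2 * b 2 w| ≤ K := by
    intro w
    have e1 : ∀ w, deriv (fun x => tolerance U x ^ 2) (G 0 w) = G 1 w ^ 1 * (2 * b 1 w) :=
      fun w => (hstep (n := 1) (A := fun w => 1)
        (A' := fun w => 0)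
        (hpow 2) hc w).trans (by rw [hb1]; push_cast; ring)
    have e2 : ∀ w, deriv (deriv (fun x => tolerance U x ^ 2)) (G 0 w) = G 1 w ^ 0 * (2 * b 2 w) :=
      fun w => (hstep (n := 0) (A := fun w => 2 * b 1 w)
        (A' := fun w => 2 * b 2 w + (-2) * b 1 w ^ 2)
        e1 (fun w => ((h1 w).const_mul 2).congr_deriv
        (by norm_num; ring)) w).trans (by rw [hb1]; push_cast; ring)
    have := hK 2 (by norm_num) (by norm_num) _ (hG.pos w)
    rw [iteratedDeriv_eq_iterate] at this
    simp only [Function.iterate_succ, Function.iterate_zero, Function.comp_apply, id_eq] at this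
    rwa [e2 w, pow_zero, one_mul] at this
  have B3 : ∀ w, |(-3) * b 1 w ^ 3 + 6 * (b 1 w * b 2 w) + 3 * b 3 w| ≤ K := by
    intro w
    have e1 : ∀ w, deriv (fun x => tolerance U x ^ 3) (G 0 w) = G 1 w ^ 2 * (3 * b 1 w) :=
      fun w => (hstep (n := 2) (A := fun w => 1)
        (A' := fun w => 0)
        (hpow 3) hc w).trans (by rw [hb1]; push_cast; ring)
    have e2 : ∀ w, deriv (deriv (fun x => tolerance U x ^ 3)) (G 0 w)
        = G 1 w ^ 1 * (3 * b 1 w ^ 2 + 3 * b 2 w) :=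
      fun w => (hstep (n := 1) (A := fun w => 3 * b 1 w)
        (A' := fun w => 3 * b 2 w + (-3) * b 1 w ^ 2)
        e1 (fun w => ((h1 w).const_mul 3).congr_deriv
        (by norm_num; ring)) w).trans (by rw [hb1]; push_cast; ring)
    have e3 : ∀ w, deriv (deriv (deriv (fun x => tolerance U x ^ 3))) (G 0 w)
        = G 1 w ^ 0 * ((-3) * b 1 w ^ 3 + 6 * (b 1 w * b 2 w) + 3 * b 3 w) :=
      fun w => (hstep (n := 0) (A := fun w => 3 * b 1 w ^ 2 + 3 * b 2 w)
        (A' := fun w => 3 * (b 1 w * b 2 w) + (-6) * b 1 w ^ 3 + 3 * b 3 w)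
        e2 (fun w => ((((h1 w).fun_pow 2).const_mul 3).fun_add ((h2 w).const_mul 3)).congr_deriv
        (by norm_num; ring)) w).trans (by rw [hb1]; push_cast; ring)
    have := hK 3 (by norm_num) (by norm_num) _ (hG.pos w)
    rw [iteratedDeriv_eq_iterate] at this
    simp only [Function.iterate_succ, Function.iterate_zero, Function.comp_apply, id_eq] at this
    rwa [e3 w, pow_zero, one_mul] at this
  have B4 : ∀ w, |(-20) * (b 1 w ^ 2 * b 2 w) + 20 * (b 1 w * b 3 w) + 20 * b 2 w ^ 2
      + 4 * b 4 w| ≤ K := by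
    intro w
    have e1 : ∀ w, deriv (fun x => tolerance U x ^ 4) (G 0 w) = G 1 w ^ 3 * (4 * b 1 w) :=
      fun w => (hstep (n := 3) (A := fun w => 1)
        (A' := fun w => 0)
        (hpow 4) hc w).trans (by rw [hb1]; push_cast; ring)
    have e2 : ∀ w, deriv (deriv (fun x => tolerance U x ^ 4)) (G 0 w)
        = G 1 w ^ 2 * (8 * b 1 w ^ 2 + 4 * b 2 w) :=
      fun w => (hstep (n := 2) (A := fun w => 4 * b 1 w)
        (A' := fun w => 4 * b 2 w + (-4) * b 1 w ^ 2)
        e1 (fun w => ((h1 w).const_mul 4).congr_deriv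
        (by norm_num; ring)) w).trans (by rw [hb1]; push_cast; ring)
    have e3 : ∀ w, deriv (deriv (deriv (fun x => tolerance U x ^ 4))) (G 0 w)
        = G 1 w ^ 1 * (20 * (b 1 w * b 2 w) + 4 * b 3 w) :=
      fun w => (hstep (n := 1) (A := fun w => 8 * b 1 w ^ 2 + 4 * b 2 w)
        (A' := fun w => 12 * (b 1 w * b 2 w) + (-16) * b 1 w ^ 3 + 4 * b 3 w)
        e2 (fun w => ((((h1 w).fun_pow 2).const_mul 8).fun_add ((h2 w).const_mul 4)).congr_deriv
        (by norm_num; ring)) w).trans (by rw [hb1]; push_cast; ring)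
    have e4 : ∀ w, deriv (deriv (deriv (deriv (fun x => tolerance U x ^ 4)))) (G 0 w)
        = G 1 w ^ 0 * ((-20) * (b 1 w ^ 2 * b 2 w) + 20 * (b 1 w * b 3 w) + 20 * b 2 w ^ 2
        + 4 * b 4 w) :=
      fun w => (hstep (n := 0) (A := fun w => 20 * (b 1 w * b 2 w) + 4 * b 3 w)
        (A' := fun w => 20 * b 2 w ^ 2 + (-40) * (b 1 w ^ 2 * b 2 w) + 16 * (b 1 w * b 3 w)
            + 4 * b 4 w)
        e3 (fun w => ((((h1 w).fun_mul (h2 w)).const_mul 20).fun_add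
            ((h3 w).const_mul 4)).congr_deriv
        (by norm_num; ring)) w).trans (by rw [hb1]; push_cast; ring)
    have := hK 4 (by norm_num) (by norm_num) _ (hG.pos w)
    rw [iteratedDeriv_eq_iterate] at this
    simp only [Function.iterate_succ, Function.iterate_zero, Function.comp_apply, id_eq] at this
    rwa [e4 w, pow_zero, one_mul] at this
  have B5 : ∀ w, |45 * b 1 w ^ 5 + (-150) * (b 1 w ^ 3 * b 2 w) + 50 * (b 1 w * b 2 w ^ 2)
      + 45 * (b 1 w * b 4 w) + 125 * (b 2 w * b 3 w) + 5 * b 5 w| ≤ K := by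
    intro w
    have e1 : ∀ w, deriv (fun x => tolerance U x ^ 5) (G 0 w) = G 1 w ^ 4 * (5 * b 1 w) :=
      fun w => (hstep (n := 4) (A := fun w => 1)
        (A' := fun w => 0)
        (hpow 5) hc w).trans (by rw [hb1]; push_cast; ring)
    have e2 : ∀ w, deriv (deriv (fun x => tolerance U x ^ 5)) (G 0 w)
        = G 1 w ^ 3 * (15 * b 1 w ^ 2 + 5 * b 2 w) :=
      fun w => (hstep (n := 3) (A := fun w => 5 * b 1 w)
        (A' := fun w => 5 * b 2 w + (-5) * b 1 w ^ 2)
        e1 (fun w => ((h1 w).const_mul 5).congr_deriv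
        (by norm_num; ring)) w).trans (by rw [hb1]; push_cast; ring)
    have e3 : ∀ w, deriv (deriv (deriv (fun x => tolerance U x ^ 5))) (G 0 w)
        = G 1 w ^ 2 * (15 * b 1 w ^ 3 + 40 * (b 1 w * b 2 w) + 5 * b 3 w) :=
      fun w => (hstep (n := 2) (A := fun w => 15 * b 1 w ^ 2 + 5 * b 2 w)
        (A' := fun w => 25 * (b 1 w * b 2 w) + (-30) * b 1 w ^ 3 + 5 * b 3 w)
        e2 (fun w => ((((h1 w).fun_pow 2).const_mul 15).fun_add ((h2 w).const_mul 5)).congr_deriv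
        (by norm_num; ring)) w).trans (by rw [hb1]; push_cast; ring)
    have e4 : ∀ w, deriv (deriv (deriv (deriv (fun x => tolerance U x ^ 5)))) (G 0 w)
        = G 1 w ^ 1 * ((-15) * b 1 w ^ 4 + 45 * (b 1 w ^ 2 * b 2 w) + 45 * (b 1 w * b 3 w)
        + 40 * b 2 w ^ 2 + 5 * b 4 w) :=
      fun w => (hstep (n := 1) (A := fun w => 15 * b 1 w ^ 3 + 40 * (b 1 w * b 2 w) + 5 * b 3 w)
        (A' := fun w => (-35) * (b 1 w ^ 2 * b 2 w) + (-45) * b 1 w ^ 4 + 40 * b 2 w ^ 2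
            + 35 * (b 1 w * b 3 w) + 5 * b 4 w)
        e3 (fun w => (((((h1 w).fun_pow 3).const_mul 15).fun_add
            (((h1 w).fun_mul (h2 w)).const_mul 40)).fun_add ((h3 w).const_mul 5)).congr_deriv
        (by norm_num; ring)) w).trans (by rw [hb1]; push_cast; ring)
    have e5 : ∀ w, deriv (deriv (deriv (deriv (deriv (fun x => tolerance U x ^ 5))))) (G 0 w)
        = G 1 w ^ 0 * (45 * b 1 w ^ 5 + (-150) * (b 1 w ^ 3 * b 2 w)
        + 50 * (b 1 w * b 2 w ^ 2) + 45 * (b 1 w * b 4 w) + 125 * (b 2 w * b 3 w) + 5 * b 5 w) :=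
      fun w => (hstep (n := 0) (A := fun w => (-15) * b 1 w ^ 4 + 45 * (b 1 w ^ 2 * b 2 w)
          + 45 * (b 1 w * b 3 w) + 40 * b 2 w ^ 2 + 5 * b 4 w)
        (A' := fun w => (-195) * (b 1 w ^ 3 * b 2 w) + 60 * b 1 w ^ 5
            + 10 * (b 1 w * b 2 w ^ 2) + 125 * (b 2 w * b 3 w) + (-45) * (b 1 w ^ 2 * b 3 w)
            + 40 * (b 1 w * b 4 w) + 5 * b 5 w)
        e4 (fun w => (((((((h1 w).fun_pow 4).const_mul (-15)).fun_add
            ((((h1 w).fun_pow 2).fun_mul (h2 w)).const_mul 45)).fun_add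
            (((h1 w).fun_mul (h3 w)).const_mul 45)).fun_add
            (((h2 w).fun_pow 2).const_mul 40)).fun_add ((h4 w).const_mul 5)).congr_deriv
        (by norm_num; ring)) w).trans (by rw [hb1]; push_cast; ring)
    have := hK 5 (by norm_num) (by norm_num) _ (hG.pos w)
    rw [iteratedDeriv_eq_iterate] at this
    simp only [Function.iterate_succ, Function.iterate_zero, Function.comp_apply, id_eq] at this
    rwa [e5 w, pow_zero, one_mul] at this
  have hK0 : 0 ≤ K := (abs_nonneg _).trans (B2 0)
  have ofB : ∀ {f : ℝ → ℝ}, (∀ w, |f w| ≤ K) → f =O[⊤] fun _ => (1 : ℝ) := fun h =>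
    isBigO_top.2 ⟨K, fun w => by simpa using h w⟩
  have hmul : ∀ {f g : ℝ → ℝ}, f =O[⊤] (fun _ => (1 : ℝ)) → g =O[⊤] (fun _ => (1 : ℝ)) →
      (fun w => f w * g w) =O[⊤] fun _ => (1 : ℝ) := fun hf hg => by simpa using hf.mul hg
  have hpw : ∀ {f : ℝ → ℝ} (n : ℕ), f =O[⊤] (fun _ => (1 : ℝ)) →
      (fun w => f w ^ n) =O[⊤] fun _ => (1 : ℝ) := fun n hf => by simpa using hf.pow n
  -- `b 1` does not occur alone in a bound: it is controlled by `b 2`, as `G 1` is positive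
  have O1 : b 1 =O[⊤] fun _ => (1 : ℝ) := by
    refine isBigO_top.2 ⟨√(K / 2), fun w => ?_⟩
    have := abs_deriv_le_of_abs_deriv_deriv_le (hG.hasDerivAt 1 (by norm_num))
      (hG.hasDerivAt 2 (by norm_num)) hpos (Real.sqrt_nonneg (K / 2)) (fun w => ?_) w
    · simp only [hb, norm_one, mul_one, Real.norm_eq_abs, abs_div, abs_of_pos (hpos w)]
      rwa [div_le_iff₀ (hpos w)]
    · have h := B2 w
      simp only [hb, abs_mul, abs_div, abs_of_pos (hpos w), abs_two] at h
      rw [Real.sq_sqrt (by positivity), ← div_le_iff₀ (hpos w)]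
      linarith
  have O2 : b 2 =O[⊤] fun _ => (1 : ℝ) :=
    ((ofB B2).const_mul_left (1 / 2)).congr_left fun w => by ring
  have O3 : b 3 =O[⊤] fun _ => (1 : ℝ) :=
    ((((ofB B3).add ((hpw 3 O1).const_mul_left 3)).sub
      ((hmul O1 O2).const_mul_left 6)).const_mul_left (1 / 3)).congr_left fun w => by ring
  have O4 : b 4 =O[⊤] fun _ => (1 : ℝ) :=
    (((((ofB B4).add ((hmul (hpw 2 O1) O2).const_mul_left 20)).sub
      ((hmul O1 O3).const_mul_left 20)).sub ((hpw 2 O2).const_mul_left 20)).const_mul_left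
      (1 / 4)).congr_left fun w => by ring
  have O5 : b 5 =O[⊤] fun _ => (1 : ℝ) :=
    (((((((ofB B5).sub ((hpw 5 O1).const_mul_left 45)).add
      ((hmul (hpw 3 O1) O2).const_mul_left 150)).sub ((hmul O1 (hpw 2 O2)).const_mul_left 50)).sub
      ((hmul O1 O4).const_mul_left 45)).sub ((hmul O2 O3).const_mul_left 125)).const_mul_left
      (1 / 5)).congr_left fun w => by ring
  have hall : ∀ j, ∃ C, 1 ≤ j → j ≤ 6 → ∀ w, |G j w| ≤ C * G 1 w := by
    have conv : ∀ {j}, b j =O[⊤] (fun _ => (1 : ℝ)) → ∃ C, ∀ w, |G (j + 1) w| ≤ C * G 1 w := by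
      intro j h
      obtain ⟨C, hC⟩ := isBigO_top.1 h
      refine ⟨C, fun w => ?_⟩
      have := hC w
      simp only [hb, norm_one, mul_one, Real.norm_eq_abs, abs_div, abs_of_pos (hpos w)] at this
      rwa [div_le_iff₀ (hpos w)] at this
    intro j
    by_cases hj : 1 ≤ j ∧ j ≤ 6
    · obtain ⟨C, hC⟩ : ∃ C, ∀ w, |G j w| ≤ C * G 1 w := by
        obtain ⟨h1, h6⟩ := hj
        interval_cases j
        · exact ⟨1, fun w => by rw [one_mul, abs_of_pos (hpos w)]⟩
        · exact conv O1
        · exact conv O2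
        · exact conv O3
        · exact conv O4
        · exact conv O5
      exact ⟨C, fun _ _ => hC⟩
    · exact ⟨0, fun h1 h6 => absurd ⟨h1, h6⟩ hj⟩
  choose C hC using hall
  refine ⟨1 + ∑ j ∈ Finset.range 7, |C j|, ?_, fun j hj hj6 w => (hC j hj hj6 w).trans ?_⟩
  · have := Finset.sum_nonneg fun j (_ : j ∈ Finset.range 7) => abs_nonneg (C j)
    linarith
  · have h := Finset.single_le_sum (fun j _ => abs_nonneg (C j))
      (Finset.mem_range.2 (by omega : j < 7))
    have := hpos w
    gcongr
    linarith [le_abs_self (C j)]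

/-- The risk tolerance is at most linear. -/
lemma exists_one_le_mul_zero (hG : MarginalFlow U G) (hU : UtilityAssumption U) :
    ∃ C, 1 ≤ C ∧ ∀ w, G 1 w ≤ C * G 0 w := by
  obtain ⟨C, hC1, hC⟩ := hG.exists_bound hU
  refine ⟨C, hC1, fun w => ?_⟩
  have hanti : Antitone fun w => G 1 w - C * G 0 w := by
    refine antitone_of_hasDerivAt_nonpos (fun w => (hG.hasDerivAt 1 (by norm_num) w).fun_sub
      ((hG.hasDerivAt 0 (by norm_num) w).const_mul C)) fun w => ?_
    have := (le_abs_self _).trans (hC 2 (by norm_num) (by norm_num) w)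
    simpa using this
  have hlim : Tendsto (fun w => G 1 w - C * G 0 w) atBot (𝓝 (0 - C * 0)) := by
    have h0 := hG.tendsto_atBot hU
    have h1 : Tendsto (G 1) atBot (𝓝 0) :=
      (hU.tolerance_zero.comp h0).congr fun w => (hG.one w).symm
    exact h1.sub ((tendsto_nhds_of_tendsto_nhdsWithin h0).const_mul C)
  have := hanti.ge_of_tendsto hlim w
  simp only [mul_zero, sub_zero] at this
  linarith

lemma expBounded (hG : MarginalFlow U G) (hU : UtilityAssumption U) {j : ℕ} (hj : j ≤ 6) :
    ExpBounded (G j) := by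
  obtain ⟨C, hC1, hC⟩ := hG.exists_bound hU
  obtain ⟨c, hc1, hc⟩ := hG.exists_one_le_mul_zero hU
  have hpos := hG.one_pos hU
  -- `log G` has a bounded derivative
  have hlog : ∀ w, HasDerivAt (fun w => Real.log (G 0 w)) (G 1 w / G 0 w) w := fun w =>
    (hG.hasDerivAt 0 (by norm_num) w).log (hG.pos w).ne'
  have h0 : ∀ w, G 0 w ≤ G 0 0 * Real.exp (c * |w|) := by
    intro w
    have h := convex_univ.norm_image_sub_le_of_norm_hasDerivWithin_le (C := c)
      (fun w _ => (hlog w).hasDerivWithinAt) (fun w _ => ?_) (mem_univ 0) (mem_univ w)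
    · rw [Real.norm_eq_abs, Real.norm_eq_abs, sub_zero] at h
      have h' := (le_abs_self _).trans h
      rw [← Real.exp_log (hG.pos 0), ← Real.exp_add, ← Real.log_le_iff_le_exp (hG.pos w)]
      linarith
    · rw [Real.norm_eq_abs, abs_of_pos (div_pos (hpos w) (hG.pos w)), div_le_iff₀ (hG.pos w)]
      exact hc w
  rcases Nat.eq_zero_or_pos j with rfl | h1
  · exact .of_le (hG.continuous hj) fun w => (abs_of_pos (hG.pos w)).trans_le (h0 w)
  · refine .of_le (hG.continuous hj) (A := C * (c * G 0 0)) (c := c)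
      fun w => (hC j h1 hj w).trans ?_
    have h2 : G 1 w ≤ c * (G 0 0 * Real.exp (c * |w|)) :=
      (hc w).trans (mul_le_mul_of_nonneg_left (h0 w) (by linarith))
    calc C * G 1 w ≤ C * (c * (G 0 0 * Real.exp (c * |w|))) :=
          mul_le_mul_of_nonneg_left h2 (by linarith)
      _ = _ := by ring

end MarginalFlow

/-! ### One-variable calculus -/

lemma second_deriv_nonneg_of_isLocalMin {f f' : ℝ → ℝ} {c a : ℝ} (hmin : IsLocalMin f a)
    (hf : ∀ᶠ x in 𝓝 a, HasDerivAt f (f' x) x) (hf' : HasDerivAt f' c a) : 0 ≤ c := by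
  by_contra! hc
  have e : deriv f =ᶠ[𝓝 a] f' := hf.mono fun x hx => hx.deriv
  have h1 : deriv (deriv f) a = c := by rw [e.deriv_eq, hf'.deriv]
  have hmax := isLocalMax_of_deriv_deriv_neg (h1 ▸ hc) hmin.deriv_eq_zero
    hf.self_of_nhds.continuousAt
  have hconst : f =ᶠ[𝓝 a] fun _ => f a := by
    filter_upwards [hmin, hmax] with x h h' using le_antisymm h' h
  have : deriv (deriv f) a = 0 := by
    rw [hconst.deriv.deriv_eq]
    simp
  linarith

lemma nonneg_of_hasDerivWithinAt_of_forall_le {f : ℝ → ℝ} {a b c : ℝ} (hab : a < b)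
    (hf : HasDerivWithinAt f c (Icc a b) a) (h : ∀ t ∈ Icc a b, f a ≤ f t) : 0 ≤ c := by
  have h1 := hf.mono Ioc_subset_Icc_self
  rw [hasDerivWithinAt_iff_tendsto_slope' (by simp), nhdsWithin_Ioc_eq_nhdsGT hab] at h1
  refine ge_of_tendsto h1 ?_
  filter_upwards [Ioc_mem_nhdsGT hab] with t ht
  rw [slope_def_field]
  exact div_nonneg (sub_nonneg.2 (h t (Ioc_subset_Icc_self ht))) (sub_nonneg.2 ht.1.le)

/-- A product is differentiable where one factor vanishes and is differentiable and the other is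
merely continuous. -/
lemma hasDerivWithinAt_mul_of_eq_zero {u v : ℝ → ℝ} {s : Set ℝ} {a v' : ℝ}
    (hu : ContinuousWithinAt u s a) (hv : HasDerivWithinAt v v' s a) (h0 : v a = 0) :
    HasDerivWithinAt (fun t => u t * v t) (u a * v') s a := by
  rw [hasDerivWithinAt_iff_tendsto_slope] at hv ⊢
  refine ((hu.mono sdiff_subset).tendsto.mul hv).congr fun t => ?_
  simp only [slope_def_field, h0]
  ring

lemma le_tangent_of_concaveOn {f : ℝ → ℝ} {s : Set ℝ} {f' x y : ℝ} (hc : ConcaveOn ℝ s f)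
    (hx : x ∈ s) (hy : y ∈ s) (hd : HasDerivAt f f' x) : f y ≤ f x + f' * (y - x) := by
  rcases lt_trichotomy x y with h | rfl | h
  · have := hc.slope_le_of_hasDerivAt hx hy h hd
    rw [slope_def_field, div_le_iff₀ (sub_pos.2 h)] at this
    linarith
  · simp
  · have := hc.le_slope_of_hasDerivAt hy hx h hd
    rw [slope_def_field, le_div_iff₀ (sub_pos.2 h)] at this
    linarith

/-! ### Elementary properties of the value function -/

namespace IsMertonValue

variable {U : ℝ → ℝ} {T l : ℝ} {M : ℝ → ℝ → ℝ} {t : ℝ}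

lemma hasDerivAt (hM : IsMertonValue U T l M) (ht : t ∈ Icc 0 T) {x : ℝ} (hx : 0 < x) :
    HasDerivAt (M t) (deriv (M t) x) x :=
  (((hM.smooth t ht).contDiffAt (Ioi_mem_nhds hx)).differentiableAt (by norm_num)).hasDerivAt

lemma hasDerivAt_deriv (hM : IsMertonValue U T l M) (ht : t ∈ Icc 0 T) {x : ℝ} (hx : 0 < x) :
    HasDerivAt (deriv (M t)) (deriv (deriv (M t)) x) x :=
  ((((hM.smooth t ht).deriv_of_isOpen (m := 1) isOpen_Ioi (by norm_num)).contDiffAt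
    (Ioi_mem_nhds hx)).differentiableAt (by norm_num)).hasDerivAt

lemma continuousOn_wealth (hM : IsMertonValue U T l M) (ht : t ∈ Icc 0 T) :
    ContinuousOn (M t) (Ioi 0) := fun _ hx => (hM.hasDerivAt ht hx).continuousAt.continuousWithinAt

lemma strictMonoOn (hM : IsMertonValue U T l M) (ht : t ∈ Icc 0 T) :
    StrictMonoOn (M t) (Ioi 0) := by
  refine strictMonoOn_of_deriv_pos (convex_Ioi 0) (hM.continuousOn_wealth ht) fun x hx => ?_
  rw [interior_Ioi] at hx
  exact hM.increasing t ht x hx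

lemma concaveOn (hM : IsMertonValue U T l M) (ht : t ∈ Icc 0 T) :
    ConcaveOn ℝ (Ioi 0) (M t) := by
  refine concaveOn_of_deriv2_nonpos (convex_Ioi 0) (hM.continuousOn_wealth ht) ?_ ?_ ?_
  · rw [interior_Ioi]
    exact fun x hx => (hM.hasDerivAt ht hx).differentiableAt.differentiableWithinAt
  · rw [interior_Ioi]
    exact fun x hx => (hM.hasDerivAt_deriv ht hx).differentiableAt.differentiableWithinAt
  · intro x hx
    rw [interior_Ioi] at hx
    exact (hM.concave t ht x hx).le

lemma le_tangent (hM : IsMertonValue U T l M) (ht : t ∈ Icc 0 T) {x y : ℝ} (hx : 0 < x)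
    (hy : 0 < y) : M t y ≤ M t x + deriv (M t) x * (y - x) :=
  le_tangent_of_concaveOn (hM.concaveOn ht) hx hy (hM.hasDerivAt ht hx)

lemma pos (hM : IsMertonValue U T l M) (ht : t ∈ Icc 0 T) {x : ℝ} (hx : 0 < x) : 0 < M t x := by
  have h2 : (0 : ℝ) ≤ M t (x / 2) := le_of_tendsto (hM.zero_wealth t ht) <| by
    filter_upwards [Ioo_mem_nhdsGT (half_pos hx)] with y hy
    exact (hM.strictMonoOn ht hy.1 (half_pos hx) hy.2).le
  exact h2.trans_lt (hM.strictMonoOn ht (half_pos hx) hx (half_lt_self hx))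

/-- Concavity, together with the value zero at zero wealth: secants through the origin decrease. -/
lemma mul_le_mul_of_le (hM : IsMertonValue U T l M) (ht : t ∈ Icc 0 T) {x y : ℝ} (hx : 0 < x)
    (hxy : x ≤ y) : M t y * x ≤ M t x * y := by
  have hy := hx.trans_le hxy
  have hlim : Tendsto (fun z => M t z + (M t y - M t z) / (y - z) * (x - z)) (𝓝[>] 0)
      (𝓝 (0 + (M t y - 0) / (y - 0) * (x - 0))) := by
    have hid : Tendsto (fun z : ℝ => z) (𝓝[>] 0) (𝓝 0) :=
      tendsto_nhdsWithin_of_tendsto_nhds tendsto_id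
    have h0 := hM.zero_wealth t ht
    exact h0.add (((h0.const_sub _).div (hid.const_sub y) (by linarith)).mul (hid.const_sub x))
  have h : 0 + (M t y - 0) / (y - 0) * (x - 0) ≤ M t x := by
    refine le_of_tendsto hlim ?_
    filter_upwards [Ioo_mem_nhdsGT hx] with z hz
    have hzy : 0 < y - z := by linarith [hz.2]
    have h1 : 0 ≤ (y - x) / (y - z) := div_nonneg (by linarith) hzy.le
    have h2 : 0 ≤ (x - z) / (y - z) := div_nonneg (by linarith [hz.2]) hzy.le
    have h3 : (y - x) / (y - z) + (x - z) / (y - z) = 1 := by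
      rw [← add_div, div_eq_one_iff_eq hzy.ne']
      ring
    have := (hM.concaveOn ht).2 (show z ∈ Ioi 0 from hz.1) (show y ∈ Ioi 0 from hy) h1 h2 h3
    simp only [smul_eq_mul] at this
    have e : (y - x) / (y - z) * z + (x - z) / (y - z) * y = x := by
      field_simp
      ring
    rw [e] at this
    refine le_of_eq_of_le ?_ this
    field_simp
    ring
  simp only [zero_add, sub_zero] at h
  rw [div_mul_eq_mul_div, div_le_iff₀ hy] at h
  exact h

lemma antitone_time (hM : IsMertonValue U T l M) {x : ℝ} (hx : 0 < x) :
    AntitoneOn (fun t => M t x) (Icc 0 T) := by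
  refine antitoneOn_of_hasDerivWithinAt_nonpos (convex_Icc 0 T)
    (fun t ht => (hM.equation t ht x hx).continuousWithinAt)
    (fun t ht => (hM.equation t (interior_subset ht) x hx).mono interior_subset) fun t ht => ?_
  have h := hM.concave t (interior_subset ht) x hx
  exact mul_nonpos_of_nonneg_of_nonpos (by positivity)
    (div_nonpos_of_nonneg_of_nonpos (sq_nonneg _) h.le)

end IsMertonValue

/-! ### Means with rising drift -/

/-- The mean of `p` under the normal law with standard deviation `|s|` and mean `w + s² / 2`. -/
noncomputable def riseMean (p : ℝ → ℝ) (s w : ℝ) : ℝ := gaussMean p s (w + s ^ 2 / 2)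

lemma continuous_riseMean {f : ℝ → ℝ} (hf : ExpBounded f) :
    Continuous fun p : ℝ × ℝ => riseMean f p.1 p.2 :=
  (continuous_gaussMean hf).comp
    (by fun_prop : Continuous fun p : ℝ × ℝ => (p.1, p.2 + p.1 ^ 2 / 2))

lemma riseMean_exp_neg_mul (f : ℝ → ℝ) (s w : ℝ) :
    riseMean (fun u => Real.exp (-u) * f u) s w = Real.exp (-w) * driftMean f s w :=
  gaussMean_exp_neg_mul f s w

/-- Functions with `p' = e^{-w} a` and `a' = b` have simple derivatives under `riseMean`: in terms
of the variables `s² / 2` and `w` they are `e^{-w}` times the drifted means of `b` and `a`. -/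
lemma hasDerivAt_riseMean_curve {p a b : ℝ → ℝ} (hp : ∀ u, HasDerivAt p (Real.exp (-u) * a u) u)
    (ha : ∀ u, HasDerivAt a (b u) u) (hpb : ExpBounded p) (hab : ExpBounded a) (hbb : ExpBounded b)
    {s w : ℝ → ℝ} {s' w' z : ℝ} (hs : HasDerivAt s s' z) (hw : HasDerivAt w w' z) :
    HasDerivAt (fun z => riseMean p (s z) (w z))
      (Real.exp (-w z) * (s z * s' * driftMean b (s z) (w z)
          + w' * driftMean a (s z) (w z))) z := by
  have he : ∀ u : ℝ, HasDerivAt (fun u : ℝ => Real.exp (-u)) (-Real.exp (-u)) u := fun u => by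
    simpa using (hasDerivAt_neg u).exp
  have hp' : ∀ u, HasDerivAt (fun u => Real.exp (-u) * a u)
      (Real.exp (-u) * b u - Real.exp (-u) * a u) u := fun u =>
    ((he u).fun_mul (ha u)).congr_deriv (by ring)
  have hB := ExpBounded.exp_neg
  have h := ((hasStrictFDerivAt_gaussMean hp hp' hpb (hB.mul hab)
    ((hB.mul hbb).sub (hB.mul hab)) (s z, w z + s z ^ 2 / 2)).hasFDerivAt).comp_hasDerivAt z
    (hs.prodMk (hw.fun_add ((hs.fun_pow 2).div_const 2)))
  refine h.congr_deriv ?_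
  have e1 := riseMean_exp_neg_mul a (s z) (w z)
  have e2 := riseMean_exp_neg_mul b (s z) (w z)
  unfold riseMean at e1 e2
  simp [gaussMean_sub (hB.mul hbb) (hB.mul hab), e1, e2]
  ring

/-- Uniform limits of Gaussian means at `+∞`, with means shifted by a bounded amount. -/
lemma eventually_gaussMean_atTop {f : ℝ → ℝ} (hf : Continuous f) {A a : ℝ} (hA : ∀ u, |f u| ≤ A)
    (h : Tendsto f atTop (𝓝 a)) (S : ℝ) {ε : ℝ} (hε : 0 < ε) :
    ∀ᶠ w in atTop, ∀ s r, |s| ≤ S → |r| ≤ S → |gaussMean f s (w + r) - a| < ε := by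
  have key : Tendsto (fun q : (ℝ × ℝ) × ℝ => gaussMean f q.1.1 (q.2 + q.1.2))
      (𝓟 {q : ℝ × ℝ | |q.1| ≤ S ∧ |q.2| ≤ S} ×ˢ atTop) (𝓝 (gaussMean (fun _ => a) 0 0)) := by
    refine tendsto_integral_filter_of_dominated_convergence (fun _ => A)
      (.of_forall fun q =>
        (by fun_prop : Continuous fun z => f (q.2 + q.1.2 + q.1.1 * z)).aestronglyMeasurable)
      (.of_forall fun q => .of_forall fun z => hA _) (integrable_const _) (.of_forall fun z => ?_)
    refine h.comp (tendsto_atTop_mono' _ (f₁ := fun q : (ℝ × ℝ) × ℝ => q.2 + (-S - S * |z|)) ?_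
      (tendsto_atTop_add_const_right _ _ tendsto_snd))
    have h1 : ∀ᶠ q : (ℝ × ℝ) × ℝ in 𝓟 {q : ℝ × ℝ | |q.1| ≤ S ∧ |q.2| ≤ S} ×ˢ atTop,
        |q.1.1| ≤ S ∧ |q.1.2| ≤ S := tendsto_fst.eventually (mem_principal_self _)
    filter_upwards [h1] with q hq
    have h2 := neg_abs_le (q.1.1 * z)
    rw [abs_mul] at h2
    have h3 := mul_le_mul_of_nonneg_right hq.1 (abs_nonneg z)
    have h4 := neg_abs_le q.1.2
    linarith [hq.2]
  rw [gaussMean_const] at key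
  have := (Metric.tendsto_nhds.1 key ε hε)
  rw [eventually_prod_iff] at this
  obtain ⟨pa, hpa, pb, hpb, H⟩ := this
  rw [eventually_principal] at hpa
  filter_upwards [hpb] with w hw s r hs hr
  exact H (hpa (s, r) ⟨hs, hr⟩) hw

lemma eventually_gaussMean_atBot {f : ℝ → ℝ} (hf : Continuous f) {A a : ℝ} (hA : ∀ u, |f u| ≤ A)
    (h : Tendsto f atBot (𝓝 a)) (S : ℝ) {ε : ℝ} (hε : 0 < ε) :
    ∀ᶠ w in atBot, ∀ s r, |s| ≤ S → |r| ≤ S → |gaussMean f s (w + r) - a| < ε := by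
  have := eventually_gaussMean_atTop (f := fun u => f (-u)) (by fun_prop) (fun u => hA _)
    (h.comp tendsto_neg_atTop_atBot) S hε
  filter_upwards [tendsto_neg_atBot_atTop.eventually this] with w hw s r hs hr
  have := hw (-s) (-r) (by simpa) (by simpa)
  rw [← gaussMean_neg] at this
  have e : gaussMean (fun u => f (-u)) (- -s) (-w + -r) = gaussMean f (-s) (w + r) := by
    unfold gaussMean
    congr 1
    ext z
    ring_nf
  rw [e, gaussMean_neg] at this
  exact this

/-! ### Minimum principle along dual flows -/

/-- The standard deviation `l √(t₀ - t)` of the dual flow, as a function of time. -/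
lemma hasDerivAt_mul_sqrt_sub {l t₀ t : ℝ} (ht : t < t₀) :
    HasDerivAt (fun t => l * √(t₀ - t)) (-(l / (2 * √(t₀ - t)))) t := by
  have h := (((hasDerivAt_id t).const_sub t₀).sqrt (by simp; linarith)).const_mul l
  refine h.congr_deriv ?_
  simp
  ring

lemma mul_sqrt_sub_mul_deriv {l t₀ t : ℝ} (ht : t < t₀) :
    l * √(t₀ - t) * (-(l / (2 * √(t₀ - t)))) = -(l ^ 2 / 2) := by
  have : √(t₀ - t) ≠ 0 := (Real.sqrt_pos.2 (sub_pos.2 ht)).ne'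
  field_simp

/-- Data `(g, p)` with `p' = e^{-w} g'` describe a utility `g ↦ p` parametrized by the logarithm of
its marginal utility. If this utility is dominated by the value function at time `t₀`, then so is
the corresponding Merton value at all earlier times. The proof is a minimum principle: at a negative
minimum of `M - p` along the dual flow the marginal utilities agree, and the second order condition
contradicts the equations. -/
lemma IsMertonValue.riseMean_le {U : ℝ → ℝ} {T l : ℝ} {M : ℝ → ℝ → ℝ}
    (hM : IsMertonValue U T l M) (hl : l ≠ 0) {t₀ : ℝ} (ht₀ : t₀ ∈ Icc 0 T)
    {g g' g'' p : ℝ → ℝ} (hg : ∀ w, HasDerivAt g (g' w) w) (hg' : ∀ w, HasDerivAt g' (g'' w) w)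
    (hp : ∀ w, HasDerivAt p (Real.exp (-w) * g' w) w)
    (Eg' : ExpBounded g') (Eg'' : ExpBounded g'')
    (hg'0 : ∀ w, 0 ≤ g' w) (hg'pos : ∃ w, 0 < g' w) (hg0 : ∀ w, 0 < g w)
    {gtop ptop pbot A : ℝ} (hgtop : Tendsto g atTop (𝓝 gtop)) (hptop : Tendsto p atTop (𝓝 ptop))
    (hpbot : Tendsto p atBot (𝓝 pbot)) (hpbot0 : pbot ≤ 0) (hpA : ∀ w, |p w| ≤ A)
    (hle : ∀ w, p w ≤ M t₀ (g w)) {t : ℝ} (ht : t ∈ Icc 0 t₀) (w : ℝ) :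
    riseMean p (l * √(t₀ - t)) w ≤ M t (driftMean g (l * √(t₀ - t)) w) := by
  have hgc : Continuous g := continuous_iff_continuousAt.2 fun w => (hg w).continuousAt
  have hpc : Continuous p := continuous_iff_continuousAt.2 fun w => (hp w).continuousAt
  have hmono : Monotone g := monotone_of_hasDerivAt_nonneg hg hg'0
  have hgle : ∀ w, g w ≤ gtop := fun w => hmono.ge_of_tendsto hgtop w
  have hgabs : ∀ w, |g w| ≤ gtop := fun w => by rw [abs_of_pos (hg0 w)]; exact hgle w
  have hgtop0 : 0 < gtop := (hg0 0).trans_le (hgle 0)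
  have Eg : ExpBounded g := .of_bounded hgc hgabs
  have Ep : ExpBounded p := .of_bounded hpc hpA
  set σ : ℝ → ℝ := fun t => l * √(t₀ - t) with hσ
  set J : ℝ → ℝ → ℝ := fun t w => driftMean g (σ t) w with hJ
  set P : ℝ → ℝ → ℝ := fun t w => riseMean p (σ t) w with hP
  have hσc : Continuous σ := by fun_prop
  have hJpos : ∀ t w, 0 < J t w := fun t w =>
    gaussMean_pos Eg (fun u => (hg0 u).le) ⟨0, hg0 _⟩
  have hsub : ∀ {t}, t ∈ Icc 0 t₀ → t ∈ Icc 0 T := fun h => ⟨h.1, h.2.trans ht₀.2⟩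
  have hJc : Continuous fun q : ℝ × ℝ => J q.1 q.2 :=
    (continuous_driftMean Eg).comp ((hσc.comp continuous_fst).prodMk continuous_snd)
  have hPc : Continuous fun q : ℝ × ℝ => P q.1 q.2 :=
    (continuous_riseMean Ep).comp ((hσc.comp continuous_fst).prodMk continuous_snd)
  by_contra! hlt
  change M t (J t w) < P t w at hlt
  obtain ⟨ε, hε, hεlt⟩ : ∃ ε > 0, M t (J t w) - P t w + ε * (1 + t₀ - t) < 0 := by
    have h1 : 0 < 1 + t₀ - t := by linarith [ht.2]
    refine ⟨(P t w - M t (J t w)) / (2 * (1 + t₀ - t)), by apply div_pos <;> linarith, ?_⟩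
    have : (P t w - M t (J t w)) / (2 * (1 + t₀ - t)) * (1 + t₀ - t)
        = (P t w - M t (J t w)) / 2 := by field_simp
    rw [this]
    linarith
  set F : ℝ → ℝ → ℝ := fun t w => M t (J t w) - P t w + ε * (1 + t₀ - t) with hF
  -- the function is nonnegative near the two ends of the line
  have hS : ∃ S, ∀ t ∈ Icc 0 t₀, |σ t| ≤ S ∧ |σ t ^ 2 / 2| ≤ S := by
    obtain ⟨S₁, hS₁⟩ := isCompact_Icc.exists_bound_of_continuousOn (s := Icc 0 t₀) hσc.continuousOn
    obtain ⟨S₂, hS₂⟩ := isCompact_Icc.exists_bound_of_continuousOn (s := Icc 0 t₀)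
      (f := fun t => σ t ^ 2 / 2) (by fun_prop)
    exact ⟨max S₁ S₂, fun t ht => ⟨(hS₁ t ht).trans (le_max_left _ _),
      (hS₂ t ht).trans (le_max_right _ _)⟩⟩
  obtain ⟨S, hS⟩ := hS
  have htop : ∀ᶠ w in atTop, ∀ t ∈ Icc 0 t₀, 0 ≤ F t w := by
    have hMc : ContinuousAt (M t₀) gtop := (hM.hasDerivAt ht₀ hgtop0).continuousAt
    obtain ⟨δ, hδ, hδM⟩ := Metric.continuousAt_iff.1 hMc (ε / 2) (half_pos hε)
    have hpM : ptop ≤ M t₀ gtop := le_of_tendsto_of_tendsto' hptop (hMc.tendsto.comp hgtop) hle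
    filter_upwards [eventually_gaussMean_atTop hgc hgabs hgtop S hδ,
      eventually_gaussMean_atTop hpc hpA hptop S (half_pos hε)] with w h1 h2 t ht
    have h1' := h1 (σ t) (-(σ t ^ 2 / 2)) (hS t ht).1 (by rw [abs_neg]; exact (hS t ht).2)
    have h2' := h2 (σ t) (σ t ^ 2 / 2) (hS t ht).1 (hS t ht).2
    rw [← sub_eq_add_neg] at h1'
    have h3 := hδM (x := J t w) h1'
    rw [Real.dist_eq] at h3
    have h4 : M t₀ (J t w) ≤ M t (J t w) :=
      hM.antitone_time (hJpos t w) (hsub ht) ht₀ ht.2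
    have h5 : ε ≤ ε * (1 + t₀ - t) := le_mul_of_one_le_right hε.le (by linarith [ht.2])
    have h6 := (abs_lt.1 h3).1
    have h7 : P t w - ptop < ε / 2 := (abs_lt.1 h2').2
    simp only [hF]
    linarith
  have hbot : ∀ᶠ w in atBot, ∀ t ∈ Icc 0 t₀, 0 ≤ F t w := by
    filter_upwards [eventually_gaussMean_atBot hpc hpA hpbot S hε] with w h2 t ht
    have h2' := h2 (σ t) (σ t ^ 2 / 2) (hS t ht).1 (hS t ht).2
    have h4 := hM.pos (hsub ht) (hJpos t w)
    have h5 : ε ≤ ε * (1 + t₀ - t) := le_mul_of_one_le_right hε.le (by linarith [ht.2])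
    have h7 : P t w - pbot < ε := (abs_lt.1 h2').2
    simp only [hF]
    linarith
  obtain ⟨L₁, hL₁⟩ := eventually_atTop.1 htop
  obtain ⟨L₂, hL₂⟩ := eventually_atBot.1 hbot
  set K : Set (ℝ × ℝ) := Icc 0 t₀ ×ˢ Icc (min L₂ w) (max L₁ w) with hK
  have hKc : IsCompact K := isCompact_Icc.prod isCompact_Icc
  have hFc : ContinuousOn (fun q : ℝ × ℝ => F q.1 q.2) K := by
    have h1 : ContinuousOn (fun q : ℝ × ℝ => M q.1 (J q.1 q.2)) K :=
      hM.continuous.comp (f := fun q : ℝ × ℝ => (q.1, J q.1 q.2))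
        (continuous_fst.prodMk hJc).continuousOn fun q hq => ⟨hsub hq.1, hJpos _ _⟩
    exact (h1.sub hPc.continuousOn).add (by fun_prop)
  obtain ⟨⟨t₁, w₁⟩, hq₁, hmin⟩ := hKc.exists_isMinOn
    ⟨(t, w), ht, min_le_right _ _, le_max_right _ _⟩ hFc
  have ht₁ : t₁ ∈ Icc 0 t₀ := hq₁.1
  have hneg : F t₁ w₁ < 0 := (hmin (a := (t, w)) ⟨ht, min_le_right _ _,
      le_max_right _ _⟩).trans_lt hεlt
  have hglob : ∀ t ∈ Icc 0 t₀, ∀ w, F t₁ w₁ ≤ F t w := by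
    intro t ht u
    rcases le_total u (min L₂ w) with h | h
    · exact hneg.le.trans (hL₂ u (h.trans (min_le_left _ _)) t ht)
    · rcases le_total (max L₁ w) u with h' | h'
      · exact hneg.le.trans (hL₁ u ((le_max_left _ _).trans h') t ht)
      · exact hmin (a := (t, u)) ⟨ht, h, h'⟩
  have ht₁lt : t₁ < t₀ := by
    refine ht₁.2.lt_of_ne fun h => ?_
    have : F t₁ w₁ = M t₀ (g w₁) - p w₁ + ε := by
      simp [hF, hJ, hP, hσ, h, driftMean, riseMean, gaussMean_zero]
    linarith [hle w₁]
  -- first and second order conditions in `w`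
  have hT := hsub ht₁
  have hσ₁ : σ t₁ ≠ 0 := mul_ne_zero hl (Real.sqrt_pos.2 (sub_pos.2 ht₁lt)).ne'
  set J' := driftMean g' (σ t₁) w₁ with hJ'
  set J'' := driftMean g'' (σ t₁) w₁ with hJ''
  have hJ'pos : 0 < J' := by
    obtain ⟨u, hu⟩ := hg'pos
    refine gaussMean_pos Eg' hg'0 ⟨(u - (w₁ - σ t₁ ^ 2 / 2)) / σ t₁, ?_⟩
    rwa [mul_div_cancel₀ _ hσ₁, add_sub_cancel]
  have hJw : ∀ u, HasDerivAt (J t₁) (driftMean g' (σ t₁) u) u := fun u =>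
    hasDerivAt_driftMean_right hg Eg Eg' _ u
  have hJw' : ∀ u, HasDerivAt (fun u => driftMean g' (σ t₁) u) (driftMean g'' (σ t₁) u) u :=
      fun u =>
    hasDerivAt_driftMean_right hg' Eg' Eg'' _ u
  have hPw : ∀ u, HasDerivAt (P t₁) (Real.exp (-u) * driftMean g' (σ t₁) u) u := fun u => by
    simpa using hasDerivAt_riseMean_curve hp hg' Ep Eg' Eg'' (hasDerivAt_const u (σ t₁))
      (hasDerivAt_id u)
  have hMJ : ∀ u, HasDerivAt (fun u => deriv (M t₁) (J t₁ u))
      (deriv (deriv (M t₁)) (J t₁ u) * driftMean g' (σ t₁) u) u := fun u =>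
    (hM.hasDerivAt_deriv hT (hJpos t₁ u)).comp u (hJw u)
  have hFw : ∀ u, HasDerivAt (F t₁)
      ((deriv (M t₁) (J t₁ u) - Real.exp (-u)) * driftMean g' (σ t₁) u) u := fun u => by
    have h1 := (hM.hasDerivAt hT (hJpos t₁ u)).comp u (hJw u)
    exact ((h1.sub (hPw u)).add_const _).congr_deriv (by ring)
  have hFww : HasDerivAt (fun u => (deriv (M t₁) (J t₁ u) - Real.exp (-u)) * driftMean g' (σ t₁) u)
      ((deriv (deriv (M t₁)) (J t₁ w₁) * J' + Real.exp (-w₁)) * J'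
        + (deriv (M t₁) (J t₁ w₁) - Real.exp (-w₁)) * J'') w₁ := by
    have he : HasDerivAt (fun u : ℝ => Real.exp (-u)) (-Real.exp (-w₁)) w₁ := by
      simpa using (hasDerivAt_neg w₁).exp
    exact (((hMJ w₁).fun_sub he).fun_mul (hJw' w₁)).congr_deriv (by ring)
  have hlm : IsLocalMin (F t₁) w₁ := .of_forall fun u => hglob t₁ ht₁ u
  have hfoc : deriv (M t₁) (J t₁ w₁) = Real.exp (-w₁) := by
    have := hlm.hasDerivAt_eq_zero (hFw w₁)
    rcases mul_eq_zero.1 this with h | h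
    · linarith
    · exact absurd h hJ'pos.ne'
  have hsoc := second_deriv_nonneg_of_isLocalMin hlm (.of_forall hFw) hFww
  rw [hfoc, sub_self, zero_mul, add_zero] at hsoc
  have hsoc' := nonneg_of_mul_nonneg_left hsoc hJ'pos
  -- first order condition in time; concavity replaces the chain rule for `M t (J t w₁)`
  set x₁ := J t₁ w₁ with hx₁
  have hx₁pos : 0 < x₁ := hJpos _ _
  have hσ' := hasDerivAt_mul_sqrt_sub (l := l) ht₁lt
  have hσσ' := mul_sqrt_sub_mul_deriv (l := l) ht₁lt
  have hJt : HasDerivAt (fun t => J t w₁) (-(l ^ 2 / 2) * (J'' - J')) t₁ := by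
    refine (hasDerivAt_driftMean_curve hg hg' Eg Eg' Eg'' hσ'
        (hasDerivAt_const t₁ w₁)).congr_deriv ?_
    rw [hσσ', zero_mul, add_zero]
  have hPt : HasDerivAt (fun t => P t w₁) (Real.exp (-w₁) * (-(l ^ 2 / 2) * J'')) t₁ := by
    refine (hasDerivAt_riseMean_curve hp hg' Ep Eg' Eg'' hσ'
        (hasDerivAt_const t₁ w₁)).congr_deriv ?_
    rw [hσσ', zero_mul, add_zero]
  have hsub' : Icc t₁ t₀ ⊆ Icc 0 T := fun s hs => ⟨ht₁.1.trans hs.1, hs.2.trans ht₀.2⟩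
  have hMt := (hM.equation t₁ hT x₁ hx₁pos).mono hsub'
  have hcont : ContinuousWithinAt (fun t => deriv (M t) x₁) (Icc t₁ t₀) t₁ := by
    have h1 := hM.continuous_x.comp (f := fun t : ℝ => (t, x₁)) (s := Icc t₁ t₀)
      (by fun_prop) fun s hs => ⟨hsub' hs, hx₁pos⟩
    exact h1 t₁ ⟨le_rfl, ht₁lt.le⟩
  have hprod := hasDerivWithinAt_mul_of_eq_zero hcont ((hJt.sub_const x₁).hasDerivWithinAt)
    (by simp [hx₁])
  have hk := ((hMt.fun_add hprod).fun_sub hPt.hasDerivWithinAt).fun_add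
    ((((hasDerivAt_id t₁).const_sub (1 + t₀)).const_mul ε).hasDerivWithinAt (s := Icc t₁ t₀))
  have htime := nonneg_of_hasDerivWithinAt_of_forall_le ht₁lt hk fun s hs => by
    have hs0 : s ∈ Icc 0 t₀ := ⟨ht₁.1.trans hs.1, hs.2⟩
    have h1 := hM.le_tangent (hsub hs0) hx₁pos (hJpos s w₁)
    have h2 := hglob s hs0 w₁
    simp only [hF] at h2
    simp only [id_eq]
    rw [← hx₁] at h2 ⊢
    linarith
  rw [hfoc] at htime
  have hMxx := hM.concave t₁ hT x₁ hx₁pos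
  have hfin : Real.exp (-w₁) ^ 2 / deriv (deriv (M t₁)) x₁ + Real.exp (-w₁) * J' ≤ 0 := by
    have h1 : Real.exp (-w₁) / deriv (deriv (M t₁)) x₁ ≤ -J' := by
      rw [div_le_iff_of_neg hMxx]
      linarith
    have h2 := mul_le_mul_of_nonneg_left h1 (Real.exp_pos (-w₁)).le
    have h3 : Real.exp (-w₁) ^ 2 / deriv (deriv (M t₁)) x₁
        = Real.exp (-w₁) * (Real.exp (-w₁) / deriv (deriv (M t₁)) x₁) := by ring
    linarith
  have hl2 : 0 < l ^ 2 := by positivity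
  nlinarith

/-! ### The value function dominates the dual representation -/

namespace UtilityAssumption

variable {U : ℝ → ℝ}

lemma le_tangent (hU : UtilityAssumption U) {x y : ℝ} (hx : 0 < x) (hy : 0 < y) :
    U y ≤ U x + deriv U x * (y - x) :=
  le_tangent_of_concaveOn hU.strictConcave.concaveOn hx hy (hU.hasDerivAt hx)

lemma mul_deriv_le (hU : UtilityAssumption U) {x : ℝ} (hx : 0 < x) : x * deriv U x ≤ U x := by
  have h1 : Tendsto (fun y => U x + deriv U x * (y - x)) (𝓝[>] 0)
      (𝓝 (U x + deriv U x * (0 - x))) :=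
    tendsto_nhdsWithin_of_tendsto_nhds (by fun_prop : Continuous _).continuousAt
  have := le_of_tendsto_of_tendsto hU.zero h1 <| by
    filter_upwards [self_mem_nhdsWithin] with y hy using hU.le_tangent hx hy
  linarith

end UtilityAssumption

namespace MarginalFlow

variable {U : ℝ → ℝ} {G : ℕ → ℝ → ℝ}

lemma hasDerivAt_utility (hG : MarginalFlow U G) (hU : UtilityAssumption U) (w : ℝ) :
    HasDerivAt (fun w => U (G 0 w)) (Real.exp (-w) * G 1 w) w := by
  have h := (hU.hasDerivAt (hG.pos w)).comp w (hG.hasDerivAt 0 (by norm_num) w)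
  rwa [hG.marginal] at h

lemma expBounded_utility (hG : MarginalFlow U G) (hU : UtilityAssumption U) :
    ExpBounded fun w => U (G 0 w) := by
  obtain ⟨C, hC⟩ := ((ExpBounded.const (U 1)).add
    ((ExpBounded.const (deriv U 1)).mul (hG.expBounded hU (j := 0) (by norm_num)))).bound
  refine .of_le (continuous_iff_continuousAt.2 fun w => (hG.hasDerivAt_utility hU w).continuousAt)
    (A := C) (c := C) fun w => ?_
  · refine le_trans ?_ ((le_abs_self _).trans (hC w))
    rw [abs_of_pos (hU.pos (hG.pos w))]
    have h1 := hU.le_tangent zero_lt_one (hG.pos w)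
    have h2 := hU.deriv_pos zero_lt_one
    linarith

end MarginalFlow

/-- The value function dominates the dual representation. The bounded approximations of the
utility used here have the dual functions `y ↦ sup_x (U x - x (y + c))` with `c > 0`. -/
lemma IsMertonValue.riseMean_utility_le {U : ℝ → ℝ} {T l : ℝ} {M : ℝ → ℝ → ℝ}
    {G : ℕ → ℝ → ℝ} (hM : IsMertonValue U T l M) (hU : UtilityAssumption U)
    (hG : MarginalFlow U G) (hl : l ≠ 0) {t : ℝ} (ht : t ∈ Icc 0 T) (w : ℝ) :
    riseMean (fun w => U (G 0 w)) (l * √(T - t)) w ≤ M t (driftMean (G 0) (l * √(T - t)) w) := by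
  obtain ⟨C, hC1, hC⟩ := hG.exists_bound hU
  have hT : T ∈ Icc 0 T := ⟨ht.1.trans ht.2, le_rfl⟩
  have E0 := hG.expBounded hU (j := 0) (by norm_num)
  have EU := hG.expBounded_utility hU
  have hGm := (hG.strictMono hU).monotone
  set η : ℝ → ℝ → ℝ := fun c u => -Real.log (Real.exp (-u) + c) with hη
  set g : ℝ → ℝ → ℝ := fun c u => G 0 (η c u) with hg
  set p : ℝ → ℝ → ℝ := fun c u => U (g c u) - c * g c u with hp
  have hsum : ∀ {c}, 0 < c → ∀ u, 0 < Real.exp (-u) + c := fun hc u => by positivity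
  have hexpη : ∀ {c}, 0 < c → ∀ u, Real.exp (-η c u) = Real.exp (-u) + c := fun hc u => by
    rw [hη, neg_neg, Real.exp_log (hsum hc u)]
  have hηle : ∀ {c}, 0 < c → ∀ u, η c u ≤ u := fun {c} hc u => by
    have := hexpη hc u
    rw [← neg_le_neg_iff, ← Real.exp_le_exp, this]
    linarith
  have hηle' : ∀ {c}, 0 < c → ∀ u, η c u ≤ -Real.log c := fun {c} hc u =>
    neg_le_neg (Real.log_le_log hc (by linarith [Real.exp_pos (-u)]))
  have hgpos : ∀ c u, 0 < g c u := fun c u => hG.pos _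
  have he : ∀ u : ℝ, HasDerivAt (fun u : ℝ => Real.exp (-u)) (-Real.exp (-u)) u := fun u => by
    simpa using (hasDerivAt_neg u).exp
  have hbdd : ∀ c, 0 < c → riseMean (p c) (l * √(T - t)) w
      ≤ M t (driftMean (g c) (l * √(T - t)) w) := by
    intro c hc
    set η' : ℝ → ℝ := fun u => Real.exp (-u) / (Real.exp (-u) + c) with hη'
    have hs0 := fun u => (hsum hc u).ne'
    have hη'0 : ∀ u, 0 ≤ η' u := fun u => (div_pos (Real.exp_pos _) (hsum hc u)).le
    have hη'1 : ∀ u, η' u ≤ 1 := fun u => (div_le_one (hsum hc u)).2 (by linarith)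
    have dη : ∀ u, HasDerivAt (η c) (η' u) u := fun u => by
      refine (((he u).add_const c).log (hs0 u)).neg.congr_deriv ?_
      simp only [hη']
      ring
    have dη' : ∀ u, HasDerivAt η' (-(η' u * (1 - η' u))) u := fun u => by
      refine ((he u).div ((he u).add_const c) (hs0 u)).congr_deriv ?_
      simp only [hη']
      have := hs0 u
      field_simp
      ring
    have dg : ∀ u, HasDerivAt (g c) (G 1 (η c u) * η' u) u := fun u =>
      (hG.hasDerivAt 0 (by norm_num) (η c u)).comp u (dη u)
    have dg' : ∀ u, HasDerivAt (fun u => G 1 (η c u) * η' u)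
        (G 2 (η c u) * η' u * η' u + G 1 (η c u) * -(η' u * (1 - η' u))) u := fun u =>
      ((hG.hasDerivAt 1 (by norm_num) (η c u)).comp u (dη u)).mul (dη' u)
    have dp : ∀ u, HasDerivAt (p c) (Real.exp (-u) * (G 1 (η c u) * η' u)) u := fun u => by
      refine (((hU.hasDerivAt (hgpos c u)).comp u (dg u)).sub ((dg u).const_mul c)).congr_deriv ?_
      rw [hg, hG.marginal, hexpη hc]
      ring
    obtain ⟨B, hB1, hB⟩ := hG.exists_one_le_mul_zero hU
    set X := G 0 (-Real.log c) with hX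
    have hX0 : 0 < X := hG.pos _
    have hgX : ∀ u, g c u ≤ X := fun u => hGm (hηle' hc u)
    have hG1 : ∀ u, |G 1 (η c u)| ≤ B * X := fun u => by
      rw [abs_of_pos (hG.one_pos hU _)]
      exact (hB _).trans (mul_le_mul_of_nonneg_left (hgX u) (by linarith))
    have hG2 : ∀ u, |G 2 (η c u)| ≤ C * (B * X) := fun u =>
      (hC 2 (by norm_num) (by norm_num) _).trans
        (mul_le_mul_of_nonneg_left ((le_abs_self _).trans (hG1 u)) (by linarith))
    have cη : Continuous (η c) := continuous_iff_continuousAt.2 fun u => (dη u).continuousAt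
    have cη' : Continuous η' := continuous_iff_continuousAt.2 fun u => (dη' u).continuousAt
    have c1 := hG.continuous (j := 1) (by norm_num)
    have c2 := hG.continuous (j := 2) (by norm_num)
    have Eη' : ExpBounded η' := .of_bounded cη' fun u => by
      rw [abs_of_nonneg (hη'0 u)]
      exact hη'1 u
    have EG1 : ExpBounded fun u => G 1 (η c u) := .of_bounded (c1.comp cη) hG1
    have EG2 : ExpBounded fun u => G 2 (η c u) := .of_bounded (c2.comp cη) hG2
    have Eg' := EG1.mul Eη'
    have Eg'' : ExpBounded fun u =>
        G 2 (η c u) * η' u * η' u + G 1 (η c u) * -(η' u * (1 - η' u)) := by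
      simpa only [neg_one_mul] using ((EG2.mul Eη').mul Eη').add (EG1.mul
        ((ExpBounded.const (-1)).mul (Eη'.mul ((ExpBounded.const 1).sub Eη'))))
    have hexp_top : Tendsto (fun u : ℝ => Real.exp (-u)) atTop (𝓝 0) :=
      Real.tendsto_exp_neg_atTop_nhds_zero
    have hηtop : Tendsto (η c) atTop (𝓝 (-Real.log c)) := by
      have h1 := ((hexp_top.add_const c).log (by simpa using hc.ne')).neg
      rwa [zero_add] at h1
    have hgtop : Tendsto (g c) atTop (𝓝 X) :=
      ((hG.continuous (j := 0) (by norm_num)).tendsto _).comp hηtop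
    have hptop : Tendsto (p c) atTop (𝓝 (U X - c * X)) :=
      ((hU.hasDerivAt hX0).continuousAt.tendsto.comp hgtop).sub (hgtop.const_mul c)
    have hηbot : Tendsto (η c) atBot atBot :=
      tendsto_atBot_mono (fun u => hηle hc u) tendsto_id
    have hgbot : Tendsto (g c) atBot (𝓝[>] 0) := (hG.tendsto_atBot hU).comp hηbot
    have hpbot : Tendsto (p c) atBot (𝓝 (0 - c * 0)) :=
      (hU.zero.comp hgbot).sub ((tendsto_nhds_of_tendsto_nhdsWithin hgbot).const_mul c)
    refine hM.riseMean_le hl hT dg dg' dp Eg' Eg''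
      (fun u => mul_nonneg (hG.one_pos hU _).le (hη'0 u))
      ⟨0, mul_pos (hG.one_pos hU _) (div_pos (Real.exp_pos _) (hsum hc 0))⟩ (hgpos c)
      hgtop hptop hpbot (by simp) (A := U X + c * X) (fun u => ?_) (fun u => ?_) ht w
    · have h1 := hU.strictMono.monotoneOn (hgpos c u) hX0 (hgX u)
      have h2 := hU.pos (hgpos c u)
      have h3 := mul_le_mul_of_nonneg_left (hgX u) hc.le
      have h4 := mul_pos hc (hgpos c u)
      simp only [hp]
      rw [abs_le]
      constructor <;> linarith [hU.pos hX0]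
    · rw [hM.terminal _ (hgpos c u)]
      have h4 := mul_pos hc (hgpos c u)
      simp only [hp]
      linarith
  -- let `c` tend to zero
  have hηlim : ∀ u, Tendsto (fun c => η c u) (𝓝[>] 0) (𝓝 u) := by
    intro u
    have h1 : Continuous fun c : ℝ => Real.exp (-u) + c := by fun_prop
    have h2 : Tendsto (fun c => η c u) (𝓝 0) (𝓝 (-Real.log (Real.exp (-u) + 0))) :=
      ((h1.tendsto 0).log (by simp [Real.exp_ne_zero])).neg
    rw [add_zero, Real.log_exp, neg_neg] at h2
    exact h2.mono_left nhdsWithin_le_nhds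
  have cG := hG.continuous (j := 0) (by norm_num)
  have hglim : ∀ u, Tendsto (fun c => g c u) (𝓝[>] 0) (𝓝 (G 0 u)) := fun u =>
    (cG.tendsto u).comp (hηlim u)
  have hcont_g : ∀ {c}, 0 < c → Continuous (g c) := fun {c} hc => by
    refine cG.comp (Continuous.neg (Continuous.log (by fun_prop) fun u => (hsum hc u).ne'))
  have hUc : ∀ {f : ℝ → ℝ}, Continuous f → (∀ u, 0 < f u) → Continuous fun u => U (f u) :=
    fun hf h0 => hU.smooth.continuousOn.comp_continuous hf h0
  set s := l * √(T - t) with hs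
  have hJlim : Tendsto (fun c => driftMean (g c) s w) (𝓝[>] 0) (𝓝 (driftMean (G 0) s w)) := by
    refine tendsto_integral_filter_of_dominated_convergence
      (fun z => G 0 (w - s ^ 2 / 2 + s * z)) ?_ ?_ (E0.integrable _ _)
      (.of_forall fun z => hglim _)
    · filter_upwards [self_mem_nhdsWithin] with c hc
      exact ((hcont_g hc).comp (by fun_prop)).aestronglyMeasurable
    · filter_upwards [self_mem_nhdsWithin] with c hc
      refine .of_forall fun z => ?_
      rw [Real.norm_eq_abs, abs_of_pos (hgpos _ _)]
      exact hGm (hηle hc _)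
  have hPlim : Tendsto (fun c => riseMean (p c) s w) (𝓝[>] 0)
      (𝓝 (riseMean (fun w => U (G 0 w)) s w)) := by
    refine tendsto_integral_filter_of_dominated_convergence
      (fun z => U (G 0 (w + s ^ 2 / 2 + s * z)) + G 0 (w + s ^ 2 / 2 + s * z)) ?_ ?_
      ((EU.add E0).integrable _ _) (.of_forall fun z => ?_)
    · filter_upwards [self_mem_nhdsWithin] with c hc
      have h1 := hcont_g hc
      have h2 := hUc h1 (hgpos c)
      have h3 : Continuous (p c) := h2.sub (h1.const_mul c)
      exact (h3.comp (by fun_prop)).aestronglyMeasurable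
    · filter_upwards [Ioc_mem_nhdsGT one_pos] with c hc
      refine .of_forall fun z => ?_
      set u := w + s ^ 2 / 2 + s * z
      have h1 : g c u ≤ G 0 u := hGm (hηle hc.1 _)
      have h2 := hU.strictMono.monotoneOn (hgpos c u) (hG.pos u) h1
      have h3 := hU.pos (hgpos c u)
      have h4 := mul_pos hc.1 (hgpos c u)
      have h5 := mul_le_of_le_one_left (hgpos c u).le hc.2
      simp only [hp]
      rw [Real.norm_eq_abs, abs_le]
      constructor <;> linarith [hU.pos (hG.pos u)]
    · set u := w + s ^ 2 / 2 + s * z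
      have h1 := ((hU.hasDerivAt (hG.pos u)).continuousAt.tendsto.comp (hglim u)).sub
        ((tendsto_nhdsWithin_of_tendsto_nhds (s := Ioi (0 : ℝ)) tendsto_id).mul (hglim u))
      simpa using h1
  have hJ0 : 0 < driftMean (G 0) s w :=
    gaussMean_pos E0 (fun u => (hG.pos u).le) ⟨0, hG.pos _⟩
  refine le_of_tendsto_of_tendsto hPlim
    ((hM.hasDerivAt ht hJ0).continuousAt.tendsto.comp hJlim) ?_
  filter_upwards [self_mem_nhdsWithin] with c hc using hbdd c hc

/-! ### Growth of the value function -/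

lemma hasDerivAt_max_zero_pow (n : ℕ) (x : ℝ) :
    HasDerivAt (fun x : ℝ => max x 0 ^ (n + 2)) ((n + 2) * max x 0 ^ (n + 1)) x := by
  rcases lt_trichotomy x 0 with h | rfl | h
  · have e : (fun x : ℝ => max x 0 ^ (n + 2)) =ᶠ[𝓝 x] fun _ => 0 := by
      filter_upwards [gt_mem_nhds h] with y hy
      simp [max_eq_right (le_of_lt hy)]
    simpa [max_eq_right h.le] using (hasDerivAt_const x (0 : ℝ)).congr_of_eventuallyEq e
  · have h := hasDerivWithinAt_mul_of_eq_zero (s := univ) (a := 0) (u :=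
      fun x : ℝ => max x 0 ^ (n + 1))
      (v := fun x => x) (by fun_prop) (hasDerivAt_id 0).hasDerivWithinAt rfl
    rw [hasDerivWithinAt_univ] at h
    have e : (fun x : ℝ => max x 0 ^ (n + 2)) = fun x => max x 0 ^ (n + 1) * x := by
      ext y
      rcases le_total y 0 with hy | hy
      · simp [max_eq_right hy]
      · rw [max_eq_left hy, pow_succ]
    rw [e]
    simpa using h
  · have e : (fun x : ℝ => max x 0 ^ (n + 2)) =ᶠ[𝓝 x] fun x => x ^ (n + 2) := by
      filter_upwards [lt_mem_nhds h] with y hy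
      rw [max_eq_left (le_of_lt hy)]
    refine ((hasDerivAt_pow (n + 2) x).congr_of_eventuallyEq e).congr_deriv ?_
    rw [max_eq_left h.le]
    push_cast
    simp

/-- The payoff `(1 - e^{k - w})⁺`; its powers are smooth dual functions with support in
`w ≥ k`. -/
noncomputable def callPayoff (k w : ℝ) : ℝ := max (1 - Real.exp (k - w)) 0

lemma continuous_callPayoff (k : ℝ) : Continuous (callPayoff k) := by
  unfold callPayoff
  fun_prop

lemma callPayoff_nonneg (k w : ℝ) : 0 ≤ callPayoff k w := le_max_right _ _

lemma callPayoff_le_one (k w : ℝ) : callPayoff k w ≤ 1 :=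
  max_le (by linarith [Real.exp_pos (k - w)]) zero_le_one

lemma expBounded_callPayoff_pow (k : ℝ) (n : ℕ) : ExpBounded fun w => callPayoff k w ^ n :=
  .of_bounded ((continuous_callPayoff k).pow n) (A := 1) fun w => by
    rw [abs_of_nonneg (pow_nonneg (callPayoff_nonneg k w) n)]
    exact pow_le_one₀ (callPayoff_nonneg k w) (callPayoff_le_one k w)

lemma callPayoff_pow_mul (k w : ℝ) (n : ℕ) :
    callPayoff k w ^ (n + 1) * (1 - callPayoff k w)
        = callPayoff k w ^ (n + 1) * Real.exp (k - w) := by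
  unfold callPayoff
  rcases le_total (1 - Real.exp (k - w)) 0 with h | h
  · simp [max_eq_right h]
  · rw [max_eq_left h]
    ring

lemma hasDerivAt_callPayoff_pow (k w : ℝ) (n : ℕ) :
    HasDerivAt (fun w => callPayoff k w ^ (n + 2))
      ((n + 2) * (callPayoff k w ^ (n + 1) * (1 - callPayoff k w))) w := by
  have h1 : HasDerivAt (fun w => 1 - Real.exp (k - w)) (Real.exp (k - w)) w := by
    simpa using (((hasDerivAt_id w).const_sub k).exp).const_sub 1
  refine ((hasDerivAt_max_zero_pow n _).comp w h1).congr_deriv ?_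
  rw [callPayoff_pow_mul, mul_assoc, callPayoff]

/-- Large wealth can be exploited by a digital bet at earlier times, hence the value function cannot
be large at wealth `x` without being large at time `0` and wealth `1`. -/
lemma IsMertonValue.mul_gaussMean_callPayoff_le {U : ℝ → ℝ} {T l : ℝ} {M : ℝ → ℝ → ℝ}
    (hM : IsMertonValue U T l M) (hl : l ≠ 0) {t₀ : ℝ} (ht₀ : t₀ ∈ Icc 0 T) {x k : ℝ} (hx : 1 < x)
    (hk : x * Real.exp (-k) ≤ M t₀ x) :
    (x - 1) * (Real.exp (-k) / 5)
      * riseMean (fun w => callPayoff k w ^ 5) (l * √t₀) (-Real.log (deriv (M 0) 1)) ≤ M 0 1 := by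
  have h00 : (0 : ℝ) ∈ Icc 0 T := ⟨le_rfl, ht₀.1.trans ht₀.2⟩
  set m := callPayoff k with hm
  have m0 := callPayoff_nonneg k
  have m1 := callPayoff_le_one k
  have cm := continuous_callPayoff k
  set w₀ := -Real.log (deriv (M 0) 1) with hw₀
  have hw₀' : Real.exp (-w₀) = deriv (M 0) 1 := by
    rw [hw₀, neg_neg, Real.exp_log (hM.increasing 0 h00 1 one_pos)]
  have hx1 : 0 < x - 1 := sub_pos.2 hx
  have he : ∀ u : ℝ, HasDerivAt (fun u : ℝ => Real.exp (-u)) (-Real.exp (-u)) u := fun u => by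
    simpa using (hasDerivAt_neg u).exp
  have hid : ∀ u n, Real.exp (-k) * (m u ^ (n + 1) * (1 - m u))
      = Real.exp (-u) * m u ^ (n + 1) := by
    intro u n
    rw [callPayoff_pow_mul, mul_left_comm, ← Real.exp_add, mul_comm]
    simp only [hm]
    ring_nf
  have d3 : ∀ u, HasDerivAt (fun u => m u ^ 3) (3 * (m u ^ 2 * (1 - m u))) u := fun u =>
    (hasDerivAt_callPayoff_pow k u 1).congr_deriv (by norm_num [hm])
  have d4 : ∀ u, HasDerivAt (fun u => m u ^ 4) (4 * (m u ^ 3 * (1 - m u))) u := fun u =>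
    (hasDerivAt_callPayoff_pow k u 2).congr_deriv (by norm_num [hm])
  have d5 : ∀ u, HasDerivAt (fun u => m u ^ 5) (5 * (m u ^ 4 * (1 - m u))) u := fun u =>
    (hasDerivAt_callPayoff_pow k u 3).congr_deriv (by norm_num [hm])
  have dg : ∀ u, HasDerivAt (fun u => 1 + (x - 1) * m u ^ 4)
      ((x - 1) * (4 * (m u ^ 3 * (1 - m u)))) u := fun u =>
    ((d4 u).const_mul (x - 1)).const_add 1
  have dg' : ∀ u, HasDerivAt (fun u => (x - 1) * (4 * (m u ^ 3 * (1 - m u))))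
      ((x - 1) * (4 * (3 * (m u ^ 2 * (1 - m u)) - 4 * (m u ^ 3 * (1 - m u))))) u := fun u => by
    refine ((((d3 u).fun_sub (d4 u)).const_mul 4).const_mul (x - 1)).congr_of_eventuallyEq ?_
    exact .of_forall fun u => by ring
  set p : ℝ → ℝ := fun u => (x - 1) * (Real.exp (-k) / 5) * m u ^ 5
    + (x - 1) * (Real.exp (-u) * m u ^ 4) with hp
  have hp' : ∀ u, p u = (x - 1) * Real.exp (-k) * (m u ^ 5 / 5 + m u ^ 4 * (1 - m u)) := fun u => by
    simp only [hp]
    rw [← hid u 3]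
    ring
  have dp : ∀ u, HasDerivAt p (Real.exp (-u) * ((x - 1) * (4 * (m u ^ 3 * (1 - m u))))) u :=
      fun u => by
    refine (((d5 u).const_mul ((x - 1) * (Real.exp (-k) / 5))).fun_add
      (((he u).fun_mul (d4 u)).const_mul (x - 1))).congr_deriv ?_
    have := hid u 3
    norm_num at this ⊢
    linear_combination (x - 1) * this
  have Eg' : ExpBounded fun u => (x - 1) * (4 * (m u ^ 3 * (1 - m u))) :=
    (ExpBounded.const _).mul ((ExpBounded.const _).mul ((expBounded_callPayoff_pow k 3).mul
      ((ExpBounded.const 1).sub (by simpa using expBounded_callPayoff_pow k 1))))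
  have Eg'' : ExpBounded fun u =>
      (x - 1) * (4 * (3 * (m u ^ 2 * (1 - m u)) - 4 * (m u ^ 3 * (1 - m u)))) := by
    have E1 : ExpBounded fun u => 1 - m u :=
      (ExpBounded.const 1).sub (by simpa using expBounded_callPayoff_pow k 1)
    exact (ExpBounded.const _).mul ((ExpBounded.const _).mul (((ExpBounded.const 3).mul
      ((expBounded_callPayoff_pow k 2).mul E1)).sub ((ExpBounded.const 4).mul
      ((expBounded_callPayoff_pow k 3).mul E1))))
  have hmtop : Tendsto m atTop (𝓝 1) := by
    have h1 : Tendsto (fun u : ℝ => Real.exp (k - u)) atTop (𝓝 0) :=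
      Real.tendsto_exp_atBot.comp (tendsto_const_nhds.add_atBot tendsto_neg_atTop_atBot)
    have h2 : Tendsto m atTop (𝓝 (max (1 - 0) 0)) := (h1.const_sub 1).max tendsto_const_nhds
    simpa using h2
  have hmbot : Tendsto m atBot (𝓝 0) := by
    refine tendsto_const_nhds.congr' ?_
    filter_upwards [eventually_le_atBot k] with u hu
    exact (max_eq_right (sub_nonpos.2 (Real.one_le_exp (sub_nonneg.2 hu)))).symm
  have hplim : ∀ {f : Filter ℝ} {a : ℝ}, Tendsto m f (𝓝 a) → Tendsto p f
      (𝓝 ((x - 1) * Real.exp (-k) * (a ^ 5 / 5 + a ^ 4 * (1 - a)))) := fun h => by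
    rw [funext hp']
    exact (((h.pow 5).div_const 5).add ((h.pow 4).mul (h.const_sub 1))).const_mul _
  have hpow : ∀ u n, 0 ≤ m u ^ n ∧ m u ^ n ≤ 1 := fun u n =>
    ⟨pow_nonneg (m0 u) n, pow_le_one₀ (m0 u) (m1 u)⟩
  have hple : ∀ u, 0 ≤ p u ∧ p u ≤ (x - 1) * Real.exp (-k) * m u ^ 4 := fun u => by
    have hc : 0 ≤ (x - 1) * Real.exp (-k) := by positivity
    rw [hp']
    have h1 : 0 ≤ m u ^ 4 * (1 - m u) := mul_nonneg (hpow u 4).1 (by linarith [m1 u])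
    have h5 : m u ^ 5 / 5 ≤ m u ^ 4 * m u := by
      have := (hpow u 5).1
      rw [← pow_succ]
      linarith
    refine ⟨mul_nonneg hc (by linarith [(hpow u 5).1]), mul_le_mul_of_nonneg_left ?_ hc⟩
    linarith
  have key := hM.riseMean_le hl ht₀ dg dg' dp Eg' Eg''
    (fun u => mul_nonneg hx1.le (mul_nonneg (by norm_num)
      (mul_nonneg (hpow u 3).1 (by linarith [m1 u]))))
    ⟨k + 1, ?_⟩ (fun u => by have := mul_nonneg hx1.le (hpow u 4).1; linarith)
    (((hmtop.pow 4).const_mul (x - 1)).const_add 1) (hplim hmtop) (hplim hmbot) (by simp)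
    (A := (x - 1) * Real.exp (-k)) (fun u => ?_) (fun u => ?_) (t := 0) ⟨le_rfl, ht₀.1⟩ w₀
  · rw [sub_zero] at key
    set σ := l * √t₀ with hσ
    have E4 := expBounded_callPayoff_pow k 4
    have E5 := expBounded_callPayoff_pow k 5
    have hJ : driftMean (fun u => 1 + (x - 1) * m u ^ 4) σ w₀
        = 1 + (x - 1) * driftMean (fun u => m u ^ 4) σ w₀ := by
      unfold driftMean
      rw [gaussMean_add (ExpBounded.const 1) ((ExpBounded.const _).mul E4), gaussMean_const,
        gaussMean_const_mul]
    have hP : riseMean p σ w₀ = (x - 1) * (Real.exp (-k) / 5) * riseMean (fun u => m u ^ 5) σ w₀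
        + (x - 1) * (Real.exp (-w₀) * driftMean (fun u => m u ^ 4) σ w₀) := by
      rw [← riseMean_exp_neg_mul]
      unfold riseMean
      rw [gaussMean_add ((ExpBounded.const _).mul E5)
        ((ExpBounded.const _).mul (ExpBounded.exp_neg.mul E4)), gaussMean_const_mul,
        gaussMean_const_mul]
    have hJ0 : 0 ≤ driftMean (fun u => m u ^ 4) σ w₀ := gaussMean_nonneg (fun u => (hpow u 4).1) _ _
    have htan := hM.le_tangent h00 (x := 1) (y := 1 + (x - 1) * driftMean (fun u => m u ^ 4) σ w₀)
      one_pos (by positivity)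
    rw [hJ, hP] at key
    rw [← hw₀'] at htan
    linarith
  · have hmk : 0 < m (k + 1) ∧ m (k + 1) < 1 := by
      have h1 : Real.exp (k - (k + 1)) < 1 := Real.exp_lt_one_iff.2 (by linarith)
      have h2 := Real.exp_pos (k - (k + 1))
      have h3 : m (k + 1) = 1 - Real.exp (k - (k + 1)) := max_eq_left (by linarith)
      rw [h3]
      constructor <;> linarith
    have := hmk.1
    have h2 : 0 < 1 - m (k + 1) := by linarith [hmk.2]
    positivity
  · rw [abs_of_nonneg (hple u).1]
    refine (hple u).2.trans (mul_le_of_le_one_right (by positivity) (hpow u 4).2)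
  · refine (hple u).2.trans ?_
    set g := 1 + (x - 1) * m u ^ 4 with hg
    have hg0 : 0 < g := by
      have := mul_nonneg hx1.le (hpow u 4).1
      linarith
    have hgx : g ≤ x := by
      have := mul_le_of_le_one_right hx1.le (hpow u 4).2
      linarith
    have h1 := hM.mul_le_mul_of_le ht₀ hg0 hgx
    have h2 : Real.exp (-k) * g ≤ M t₀ g := by
      have h3 : x * Real.exp (-k) * g ≤ M t₀ g * x :=
        (mul_le_mul_of_nonneg_right hk hg0.le).trans h1
      have h4 : 0 < x := by linarith
      nlinarith
    have h5 := Real.exp_pos (-k)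
    nlinarith

lemma exists_le_riseMean_callPayoff :
    ∃ c > 0, ∀ k s w, 0 < s → 0 ≤ k + 1 - (w + s ^ 2 / 2) →
      c * Real.exp (-((k + 1 - (w + s ^ 2 / 2) + s) ^ 2 / (2 * s ^ 2)))
        ≤ riseMean (fun w => callPayoff k w ^ 5) s w := by
  have he1 : 0 < 1 - Real.exp (-1) := by
    have := Real.exp_lt_one_iff.2 (show (-1 : ℝ) < 0 by norm_num)
    linarith
  refine ⟨(√(2 * Real.pi))⁻¹ * (1 - Real.exp (-1)) ^ 5, by positivity, fun k s w hs hk => ?_⟩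
  set ζ := (k + 1 - (w + s ^ 2 / 2)) / s with hζ
  have hζ0 : 0 ≤ ζ := div_nonneg hk hs.le
  have hζs : s * ζ = k + 1 - (w + s ^ 2 / 2) := mul_div_cancel₀ _ hs.ne'
  have hexp : (k + 1 - (w + s ^ 2 / 2) + s) ^ 2 / (2 * s ^ 2) = (ζ + 1) ^ 2 / 2 := by
    rw [← hζs]
    field_simp
  rw [hexp]
  set F : ℝ → ℝ := fun z => gaussianPDFReal 0 1 z * callPayoff k (w + s ^ 2 / 2 + s * z) ^ 5 with hF
  have hFint : Integrable F :=
    integrable_gaussianReal_iff.1 ((expBounded_callPayoff_pow k 5).integrable s (w + s ^ 2 / 2))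
  have hF0 : ∀ z, 0 ≤ F z := fun z =>
    mul_nonneg (gaussianPDFReal_nonneg _ _ _) (pow_nonneg (callPayoff_nonneg _ _) _)
  have e : riseMean (fun w => callPayoff k w ^ 5) s w = ∫ z, F z := by
    unfold riseMean gaussMean
    rw [integral_gaussianReal_eq]
  rw [e]
  set c := (√(2 * Real.pi))⁻¹ * (1 - Real.exp (-1)) ^ 5 * Real.exp (-((ζ + 1) ^ 2 / 2)) with hc
  calc c = ∫ _ in Icc ζ (ζ + 1), c := by simp
    _ ≤ ∫ z in Icc ζ (ζ + 1), F z := by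
      refine setIntegral_mono_on (by simp) hFint.integrableOn measurableSet_Icc fun z hz => ?_
      have h1 : 1 - Real.exp (-1) ≤ callPayoff k (w + s ^ 2 / 2 + s * z) := by
        refine le_max_of_le_left ?_
        have := mul_le_mul_of_nonneg_left hz.1 hs.le
        have h2 : Real.exp (k - (w + s ^ 2 / 2 + s * z)) ≤ Real.exp (-1) :=
          Real.exp_le_exp.2 (by linarith)
        linarith
      have h2 : Real.exp (-((ζ + 1) ^ 2 / 2)) ≤ Real.exp (-z ^ 2 / 2) := by
        have : z ^ 2 ≤ (ζ + 1) ^ 2 := pow_le_pow_left₀ (hζ0.trans hz.1) hz.2 2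
        exact Real.exp_le_exp.2 (by linarith)
      simp only [hF, hc, gaussianPDFReal_standard]
      calc _ = (√(2 * Real.pi))⁻¹ * Real.exp (-((ζ + 1) ^ 2 / 2)) * (1 - Real.exp (-1)) ^ 5 :=
          by ring
        _ ≤ _ := by gcongr
    _ ≤ ∫ z, F z := setIntegral_le_integral hFint (.of_forall hF0)

/-- A growth estimate for the value function, read off in the dual variable: where the chord of the
value function from the origin is steeper than `e^{-k}`, wealth is at most Gaussian in `k`. -/
lemma IsMertonValue.exists_growth {U : ℝ → ℝ} {T l : ℝ} {M : ℝ → ℝ → ℝ}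
    (hM : IsMertonValue U T l M) (hl : l ≠ 0) (hT : 0 < T) :
    ∃ C > 0, ∀ t ∈ Ioc 0 T, ∀ k ≥ C, ∀ x ≥ 2, x * Real.exp (-k) ≤ M t x →
      x ≤ C * Real.exp (k + (k + C) ^ 2 / (2 * (l ^ 2 * t))) := by
  obtain ⟨c, hc, hlow⟩ := exists_le_riseMean_callPayoff
  set w₀ := -Real.log (deriv (M 0) 1) with hw₀
  have hM0 : 0 < M 0 1 := hM.pos ⟨le_rfl, hT.le⟩ one_pos
  set C := 10 * M 0 1 / c + (1 + |w₀| + |l| * √T + l ^ 2 * T) with hC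
  have hq : 0 < 10 * M 0 1 / c := by positivity
  have hC1 : 1 + |w₀| + |l| * √T + l ^ 2 * T ≤ C := by linarith
  have hn1 := abs_nonneg w₀
  have hn2 : 0 ≤ |l| * √T := by positivity
  have hn3 : 0 ≤ l ^ 2 * T := by positivity
  have hC2 : 10 * M 0 1 / c ≤ C := by linarith
  refine ⟨C, by linarith, fun t ht k hk x hx h => ?_⟩
  have h1 := hM.mul_gaussMean_callPayoff_le hl ⟨ht.1.le, ht.2⟩ (by linarith : 1 < x) h
  set s := |l| * √t with hs
  have hs0 : 0 < s := mul_pos (abs_pos.2 hl) (Real.sqrt_pos.2 ht.1)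
  have hs2 : s ^ 2 = l ^ 2 * t := by rw [hs, mul_pow, sq_abs, Real.sq_sqrt ht.1.le]
  have hsign : riseMean (fun w => callPayoff k w ^ 5) (l * √t) w₀
      = riseMean (fun w => callPayoff k w ^ 5) s w₀ := by
    rcases abs_choice l with h | h
    · rw [hs, h]
    · unfold riseMean
      rw [hs, h, neg_mul, gaussMean_neg, neg_sq]
  rw [hsign] at h1
  have hst : l ^ 2 * t ≤ l ^ 2 * T := mul_le_mul_of_nonneg_left ht.2 (sq_nonneg l)
  have hsT : s ≤ |l| * √T := mul_le_mul_of_nonneg_left (Real.sqrt_le_sqrt ht.2) (abs_nonneg l)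
  have hr : 0 ≤ k + 1 - (w₀ + s ^ 2 / 2) := by
    rw [hs2]
    linarith [le_abs_self w₀]
  have h2 := hlow k s w₀ hs0 hr
  have h3 : Real.exp (-((k + C) ^ 2 / (2 * (l ^ 2 * t))))
      ≤ Real.exp (-((k + 1 - (w₀ + s ^ 2 / 2) + s) ^ 2 / (2 * s ^ 2))) := by
    rw [hs2] at hr ⊢
    have h0 : 0 < l ^ 2 * t := hs2 ▸ pow_pos hs0 2
    have : k + 1 - (w₀ + l ^ 2 * t / 2) + s ≤ k + C := by linarith [neg_abs_le w₀]
    have : (k + 1 - (w₀ + l ^ 2 * t / 2) + s) ^ 2 ≤ (k + C) ^ 2 :=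
      pow_le_pow_left₀ (by linarith) this 2
    gcongr
  set E := Real.exp (-((k + C) ^ 2 / (2 * (l ^ 2 * t)))) with hE
  have hE0 : 0 < E := Real.exp_pos _
  have hek := Real.exp_pos (-k)
  have h4 : x / 2 * (Real.exp (-k) / 5) * (c * E) ≤ M 0 1 := by
    refine le_trans ?_ h1
    have h5 : c * E ≤ riseMean (fun w => callPayoff k w ^ 5) s w₀ :=
      (mul_le_mul_of_nonneg_left h3 hc.le).trans h2
    have h6 : x / 2 ≤ x - 1 := by linarith
    have h7 : 0 ≤ c * E := by positivity
    have h8 : 0 ≤ x - 1 := by linarith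
    gcongr
  have h5 : Real.exp (k + (k + C) ^ 2 / (2 * (l ^ 2 * t))) * (Real.exp (-k) * E) = 1 := by
    rw [hE, ← Real.exp_add, ← Real.exp_add, ← Real.exp_zero]
    ring_nf
  calc x = x * (Real.exp (k + (k + C) ^ 2 / (2 * (l ^ 2 * t))) * (Real.exp (-k) * E)) := by
        rw [h5, mul_one]
    _ = (10 / c) * (x / 2 * (Real.exp (-k) / 5) * (c * E))
        * Real.exp (k + (k + C) ^ 2 / (2 * (l ^ 2 * t))) := by field_simp; ring
    _ ≤ (10 / c) * M 0 1 * Real.exp (k + (k + C) ^ 2 / (2 * (l ^ 2 * t))) := by gcongr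
    _ ≤ C * Real.exp (k + (k + C) ^ 2 / (2 * (l ^ 2 * t))) := by
        gcongr
        rw [div_mul_eq_mul_div]
        exact hC2

/-! ### Confinement of maximum points -/

/-- A solution of the dual equation that blows up at time `δ`: a heat kernel at
negative times, with the square root in front written as part of the exponent. In the
dual variable it grows slightly faster than the value function can. -/
noncomputable def barrier (l T δ t w : ℝ) : ℝ :=
  Real.exp ((w + l ^ 2 * (T - t) / 2) ^ 2 / (2 * (l ^ 2 * (t - δ))) - Real.log (l ^ 2 *
      (t - δ)) / 2)

lemma barrier_pos (l T δ t w : ℝ) : 0 < barrier l T δ t w := Real.exp_pos _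

lemma hasDerivAt_barrier_right {l T δ t : ℝ} (hl : l ≠ 0) (ht : δ < t) (w : ℝ) :
    HasDerivAt (barrier l T δ t)
      (barrier l T δ t w * ((w + l ^ 2 * (T - t) / 2) / (l ^ 2 * (t - δ)))) w := by
  have hv : l ^ 2 * (t - δ) ≠ 0 := mul_ne_zero (pow_ne_zero 2 hl) (sub_pos.2 ht).ne'
  refine ((((((hasDerivAt_id w).add_const (l ^ 2 * (T - t) / 2)).pow 2).div_const _).sub_const
    (Real.log (l ^ 2 * (t - δ)) / 2)).exp).congr_deriv ?_
  unfold barrier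
  simp
  field_simp

lemma hasDerivAt_barrier_right_right {l T δ t : ℝ} (hl : l ≠ 0) (ht : δ < t) (w : ℝ) :
    HasDerivAt (fun w => barrier l T δ t w * ((w + l ^ 2 * (T - t) / 2) / (l ^ 2 * (t - δ))))
      (barrier l T δ t w * (((w + l ^ 2 * (T - t) / 2) / (l ^ 2 * (t - δ))) ^ 2
        + 1 / (l ^ 2 * (t - δ)))) w := by
  refine ((hasDerivAt_barrier_right hl ht w).fun_mul
    (((hasDerivAt_id w).add_const (l ^ 2 * (T - t) / 2)).div_const (l ^ 2 *
        (t - δ)))).congr_deriv ?_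
  simp only [id_eq]
  ring

lemma hasDerivAt_barrier_left {l T δ t : ℝ} (hl : l ≠ 0) (ht : δ < t) (w : ℝ) :
    HasDerivAt (fun t => barrier l T δ t w)
      (-(l ^ 2 / 2) * (barrier l T δ t w * ((w + l ^ 2 * (T - t) / 2) / (l ^ 2 * (t - δ)))
        + barrier l T δ t w * (((w + l ^ 2 * (T - t) / 2) / (l ^ 2 * (t - δ))) ^ 2
          + 1 / (l ^ 2 * (t - δ))))) t := by
  have hl2 : l ^ 2 ≠ 0 := pow_ne_zero 2 hl
  have htd : t - δ ≠ 0 := (sub_pos.2 ht).ne'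
  have hv : l ^ 2 * (t - δ) ≠ 0 := mul_ne_zero hl2 htd
  have d1 : HasDerivAt (fun t => l ^ 2 * (t - δ)) (l ^ 2) t := by
    simpa using ((hasDerivAt_id t).sub_const δ).const_mul (l ^ 2)
  have d2 : HasDerivAt (fun t => w + l ^ 2 * (T - t) / 2) (-(l ^ 2) / 2) t := by
    simpa using ((((hasDerivAt_id t).const_sub T).const_mul (l ^ 2)).div_const 2).const_add w
  refine ((((d2.pow 2).div (d1.const_mul 2) (by simpa using ⟨hl, htd⟩)).sub
    ((d1.log hv).div_const 2)).exp).congr_deriv ?_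
  unfold barrier
  simp
  field_simp
  ring

/-- Where the value function less `x e^{-w}` exceeds a multiple of the barrier, both variables are
confined to a compact set. -/
lemma IsMertonValue.exists_confinement {U : ℝ → ℝ} {T l : ℝ} {M : ℝ → ℝ → ℝ}
    (hM : IsMertonValue U T l M) (hl : l ≠ 0) {δ : ℝ} (hδ : 0 < δ) (hδT : 2 * δ ≤ T) {ε : ℝ}
    (hε : 0 < ε) :
    ∃ L x₁ x₂, 0 < x₁ ∧ ∀ t ∈ Icc (2 * δ) T, ∀ x > 0, ∀ w,
      ε * (barrier l T δ t w + 1) ≤ M t x - x * Real.exp (-w) →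
        w ∈ Icc (-L) L ∧ x ∈ Icc x₁ x₂ := by
  have hT : 0 < T := by linarith
  have h00 : (0 : ℝ) ∈ Icc 0 T := ⟨le_rfl, hT.le⟩
  obtain ⟨C, hC, hgrow⟩ := hM.exists_growth hl hT
  have hl2 : 0 < l ^ 2 := by positivity
  set D := deriv (M 0) 1 with hD
  have hD0 : 0 < D := hM.increasing 0 h00 1 one_pos
  have hsub : ∀ {t}, t ∈ Icc (2 * δ) T → t ∈ Icc 0 T := fun h => ⟨by linarith [h.1], h.2⟩
  have hanti : ∀ {t x}, t ∈ Icc (2 * δ) T → 0 < x → M t x ≤ M 0 x := fun ht hx =>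
    hM.antitone_time hx h00 (hsub ht) (hsub ht).1
  have htan : ∀ {t x}, t ∈ Icc (2 * δ) T → 0 < x → M t x ≤ M 0 1 + D * x := fun {t x} ht hx => by
    have := hM.le_tangent h00 one_pos hx
    linarith [hanti ht hx]
  have hvpos : ∀ {t}, t ∈ Icc (2 * δ) T → 0 < l ^ 2 * (t - δ) := fun {t} ht =>
    mul_pos hl2 (by linarith [ht.1])
  have hvT : ∀ {t}, t ∈ Icc (2 * δ) T → l ^ 2 * (t - δ) ≤ l ^ 2 * T := fun {t} ht =>
    mul_le_mul_of_nonneg_left (by linarith [ht.2]) hl2.le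
  have hlogle : ∀ {t}, t ∈ Icc (2 * δ) T → Real.log (l ^ 2 * (t - δ)) ≤ Real.log (l ^ 2 * T) :=
    fun ht => Real.log_le_log (hvpos ht) (hvT ht)
  set Λ := Real.log (l ^ 2 * T) / 2 with hΛ
  -- positive direction
  obtain ⟨L₁, hL₁⟩ : ∃ L₁, ∀ t ∈ Icc (2 * δ) T, ∀ x > 0, ∀ w ≥ L₁,
      M t x - x * Real.exp (-w) < ε * (barrier l T δ t w + 1) := by
    set A := M 0 1 + 2 * D + D * C with hA
    have hA0 : 0 < A := by
      have := hM.pos h00 one_pos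
      positivity
    -- the Gaussian exponent of the barrier, of variance `l² (t - δ)`, beats that of variance `l² t`
    -- in the growth estimate by at least `a w²`
    set a := δ / (2 * l ^ 2 * T ^ 2) with ha
    have ha0 : 0 < a := by positivity
    have hquad : Tendsto (fun w : ℝ => w * (a * w - (1 + C / (l ^ 2 * (2 * δ))))) atTop atTop :=
      tendsto_id.atTop_mul_atTop₀ (tendsto_atTop_add_const_right _ _
          (tendsto_id.const_mul_atTop ha0))
    obtain ⟨L, hL⟩ := eventually_atTop.1 ((hquad.eventually_gt_atTop
      (Real.log (A / ε) + C ^ 2 / (2 * (l ^ 2 * (2 * δ))) + Λ)).and (eventually_ge_atTop C))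
    refine ⟨L, fun t ht x hx w hw => ?_⟩
    obtain ⟨hL1, hwC⟩ := hL w hw
    have hw0 : 0 < w := by linarith
    have hB := barrier_pos l T δ t w
    by_contra! hcon
    have hMx : x * Real.exp (-w) ≤ M t x := by
      have : 0 ≤ ε * (barrier l T δ t w + 1) := by positivity
      linarith
    have ht0 : 0 < t := by linarith [ht.1]
    set α := w + (w + C) ^ 2 / (2 * (l ^ 2 * t)) with hα
    have hα0 : 1 ≤ Real.exp α := Real.one_le_exp (by positivity)
    have hMA : M t x ≤ A * Real.exp α := by
      have h1 := htan ht hx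
      have hM1 := hM.pos h00 one_pos
      have h3 : M 0 1 + 2 * D ≤ (M 0 1 + 2 * D) * Real.exp α :=
        le_mul_of_one_le_right (by positivity) hα0
      rcases le_total x 2 with h2 | h2
      · have h4 : D * x ≤ D * 2 := mul_le_mul_of_nonneg_left h2 hD0.le
        have h5 : 0 ≤ D * C * Real.exp α := by positivity
        rw [hA, add_mul]
        linarith
      · have h4 : D * x ≤ D * (C * Real.exp α) :=
          mul_le_mul_of_nonneg_left (hgrow t ⟨ht0, ht.2⟩ w hwC x h2 hMx) hD0.le
        rw [hA, add_mul]
        linarith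
    have hβ : Real.log (A / ε) + α < (w + l ^ 2 * (T - t) / 2) ^ 2 / (2 * (l ^ 2 * (t - δ)))
        - Real.log (l ^ 2 * (t - δ)) / 2 := by
      have h1 : w ^ 2 ≤ (w + l ^ 2 * (T - t) / 2) ^ 2 := by
        have : 0 ≤ l ^ 2 * (T - t) := mul_nonneg hl2.le (by linarith [ht.2])
        exact pow_le_pow_left₀ hw0.le (by linarith) 2
      have h2 : w ^ 2 / (2 * (l ^ 2 * (t - δ))) ≤ (w
          + l ^ 2 * (T - t) / 2) ^ 2 / (2 * (l ^ 2 * (t - δ))) :=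
        div_le_div_of_nonneg_right h1 (by linarith [hvpos ht])
      have h3 := hlogle ht
      have htd : 0 < t - δ := by linarith [ht.1]
      have h4 : a * w ^ 2 ≤ w ^ 2 / (2 * (l ^ 2 * (t - δ))) - w ^ 2 / (2 * (l ^ 2 * t)) := by
        have e1 : w ^ 2 / (2 * (l ^ 2 * (t - δ))) - w ^ 2 / (2 * (l ^ 2 * t))
            = δ / (2 * l ^ 2 * (t * (t - δ))) * w ^ 2 := by
          field_simp
          ring
        rw [e1, ha]
        have h5 : t * (t - δ) ≤ T ^ 2 := by
          rw [sq]
          exact mul_le_mul ht.2 (by linarith [ht.2]) htd.le hT.le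
        gcongr
      have h6 : (w + C) ^ 2 / (2 * (l ^ 2 * t)) ≤ w ^ 2 / (2 * (l ^ 2 * t))
          + w * (C / (l ^ 2 * (2 * δ))) + C ^ 2 / (2 * (l ^ 2 * (2 * δ))) := by
        have e1 : (w + C) ^ 2 / (2 * (l ^ 2 * t)) = w ^ 2 / (2 * (l ^ 2 * t))
            + w * (C / (l ^ 2 * t)) + C ^ 2 / (2 * (l ^ 2 * t)) := by
          field_simp
          ring
        rw [e1]
        have := ht.1
        gcongr
      rw [hα]
      nlinarith
    have h1 : A / ε * Real.exp α < barrier l T δ t w := by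
      unfold barrier
      rw [← Real.exp_log (div_pos hA0 hε), ← Real.exp_add]
      exact Real.exp_lt_exp.2 hβ
    have h2 : A * Real.exp α < ε * barrier l T δ t w := by
      have := mul_lt_mul_of_pos_left h1 hε
      rwa [← mul_assoc, mul_div_cancel₀ _ hε.ne'] at this
    have h3 : 0 < x * Real.exp (-w) := by positivity
    linarith
  -- negative direction
  obtain ⟨L₂, hL₂⟩ : ∃ L₂, ∀ t ∈ Icc (2 * δ) T, ∀ x > 0, ∀ w ≤ -L₂,
      M t x - x * Real.exp (-w) < ε * (barrier l T δ t w + 1) := by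
    have hM1 := hM.pos h00 one_pos
    have hq : Tendsto (fun u : ℝ => (u - l ^ 2 * T / 2) ^ 2 / (2 * (l ^ 2 * T))) atTop atTop :=
      Tendsto.atTop_div_const (by positivity)
        ((tendsto_pow_atTop two_ne_zero).comp (tendsto_atTop_add_const_right _ _ tendsto_id))
    obtain ⟨L, hL⟩ := eventually_atTop.1 ((hq.eventually_gt_atTop
      (Real.log (M 0 1 / ε) + Λ)).and (eventually_ge_atTop (max (l ^ 2 * T / 2) (Real.log D))))
    refine ⟨L, fun t ht x hx w hw => ?_⟩
    obtain ⟨hL1, hL2⟩ := hL (-w) (by linarith)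
    have hw1 : l ^ 2 * T / 2 ≤ -w := (le_max_left _ _).trans hL2
    have hw2 : D ≤ Real.exp (-w) := (Real.log_le_iff_le_exp hD0).1 ((le_max_right _ _).trans hL2)
    have h1 : M t x - x * Real.exp (-w) ≤ M 0 1 := by
      have := mul_le_mul_of_nonneg_left hw2 hx.le
      linarith [htan ht hx]
    have h2 : Real.log (M 0 1 / ε) < (w + l ^ 2 * (T - t) / 2) ^ 2 / (2 * (l ^ 2 * (t - δ)))
        - Real.log (l ^ 2 * (t - δ)) / 2 := by
      have h3 := hlogle ht
      have ht0 : 0 ≤ l ^ 2 * t := mul_nonneg hl2.le (hsub ht).1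
      have h4 : (-w - l ^ 2 * T / 2) ^ 2 ≤ (w + l ^ 2 * (T - t) / 2) ^ 2 := by
        rw [← neg_sq (w + _)]
        exact pow_le_pow_left₀ (by linarith) (by linarith) 2
      have h5 : (-w - l ^ 2 * T / 2) ^ 2 / (2 * (l ^ 2 * T))
          ≤ (w + l ^ 2 * (T - t) / 2) ^ 2 / (2 * (l ^ 2 * (t - δ))) :=
        div_le_div₀ (sq_nonneg _) h4 (by linarith [hvpos ht]) (by linarith [hvT ht])
      linarith
    have h3 : M 0 1 / ε < barrier l T δ t w := by
      unfold barrier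
      rw [← Real.exp_log (div_pos hM1 hε)]
      exact Real.exp_lt_exp.2 h2
    rw [div_lt_iff₀ hε] at h3
    linarith
  set k := max C (max L₁ L₂) with hk
  obtain ⟨x₁, hx₁, hx₁M⟩ : ∃ x₁ > 0, ∀ x > 0, x < x₁ → M 0 x < ε := by
    have h := (hM.zero_wealth 0 h00).eventually (gt_mem_nhds hε)
    obtain ⟨b, hb, H⟩ := (mem_nhdsGT_iff_exists_Ioo_subset).1 h
    exact ⟨b, hb, fun x hx hxb => H ⟨hx, hxb⟩⟩
  refine ⟨k, x₁, max 2 (C * Real.exp (k + (k + C) ^ 2 / (2 * (l ^ 2 * (2 * δ))))), hx₁,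
    fun t ht x hx w h => ?_⟩
  have hB := barrier_pos l T δ t w
  have hεB : 0 < ε * barrier l T δ t w := by positivity
  have hw1 : w ≤ k := by
    by_contra! hc
    exact absurd (hL₁ t ht x hx w
      (((le_max_left _ _).trans (le_max_right _ _)).trans hc.le)) (not_lt.2 h)
  have hw2 : -k ≤ w := by
    by_contra! hc
    have : L₂ ≤ k := (le_max_right _ _).trans (le_max_right _ _)
    exact absurd (hL₂ t ht x hx w (by linarith)) (not_lt.2 h)
  have hxw : 0 < x * Real.exp (-w) := by positivity
  refine ⟨⟨hw2, hw1⟩, ?_, ?_⟩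
  · by_contra! hc
    have := hx₁M x hx hc
    linarith [hanti ht hx]
  · rcases le_total x 2 with h2 | h2
    · exact h2.trans (le_max_left _ _)
    · have h3 : x * Real.exp (-k) ≤ M t x := by
        have : x * Real.exp (-k) ≤ x * Real.exp (-w) := by gcongr
        linarith
      have ht0 : 0 < t := by linarith [ht.1]
      refine (hgrow t ⟨ht0, ht.2⟩ k (le_max_left _ _) x h2 h3).trans ((?_ : _
          ≤ _).trans (le_max_right _ _))
      have := ht.1
      gcongr

/-! ### The dual representation dominates the value function -/

/-- The dual function `Q w = sup_x (U x - x e^{-w})` of the utility. -/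
noncomputable def dualUtility (U : ℝ → ℝ) (G : ℕ → ℝ → ℝ) (w : ℝ) : ℝ :=
  U (G 0 w) - Real.exp (-w) * G 0 w

namespace MarginalFlow

variable {U : ℝ → ℝ} {G : ℕ → ℝ → ℝ}

lemma hasDerivAt_dualUtility (hG : MarginalFlow U G) (hU : UtilityAssumption U) (w : ℝ) :
    HasDerivAt (dualUtility U G) (Real.exp (-w) * G 0 w) w := by
  have he : HasDerivAt (fun u : ℝ => Real.exp (-u)) (-Real.exp (-w)) w := by
    simpa using (hasDerivAt_neg w).exp
  exact ((hG.hasDerivAt_utility hU w).sub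
    (he.fun_mul (hG.hasDerivAt 0 (by norm_num) w))).congr_deriv (by ring)

lemma expBounded_dualUtility (hG : MarginalFlow U G) (hU : UtilityAssumption U) :
    ExpBounded (dualUtility U G) :=
  (hG.expBounded_utility hU).sub (ExpBounded.exp_neg.mul (hG.expBounded hU (by norm_num)))

lemma dualUtility_nonneg (hG : MarginalFlow U G) (hU : UtilityAssumption U) (w : ℝ) :
    0 ≤ dualUtility U G w := by
  have := hU.mul_deriv_le (hG.pos w)
  rw [hG.marginal] at this
  unfold dualUtility
  linarith

lemma le_dualUtility (hG : MarginalFlow U G) (hU : UtilityAssumption U) {x : ℝ} (hx : 0 < x)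
    (w : ℝ) : U x - x * Real.exp (-w) ≤ dualUtility U G w := by
  have := hU.le_tangent (hG.pos w) hx
  rw [hG.marginal] at this
  unfold dualUtility
  linarith

lemma riseMean_utility (hG : MarginalFlow U G) (hU : UtilityAssumption U) (s w : ℝ) :
    riseMean (fun w => U (G 0 w)) s w
      = riseMean (dualUtility U G) s w + Real.exp (-w) * driftMean (G 0) s w := by
  rw [← riseMean_exp_neg_mul]
  unfold riseMean
  rw [← gaussMean_add (hG.expBounded_dualUtility hU)
    (ExpBounded.exp_neg.mul (hG.expBounded hU (by norm_num)))]
  simp [dualUtility]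

end MarginalFlow

/-- The value function is dominated by its dual representation. At a positive maximum of the
difference, perturbed by the barrier, the second order condition is used along a single direction
in the two variables. -/
lemma IsMertonValue.le_riseMean_dualUtility {U : ℝ → ℝ} {T l : ℝ} {M : ℝ → ℝ → ℝ}
    {G : ℕ → ℝ → ℝ} (hM : IsMertonValue U T l M) (hU : UtilityAssumption U)
    (hG : MarginalFlow U G) (hl : l ≠ 0) {t₀ : ℝ} (ht₀ : t₀ ∈ Ioc 0 T) {x₀ : ℝ} (hx₀ : 0 < x₀)
    (w₀ : ℝ) :
    M t₀ x₀ ≤ x₀ * Real.exp (-w₀) + riseMean (dualUtility U G) (l * √(T - t₀)) w₀ := by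
  have hT : 0 < T := ht₀.1.trans_le ht₀.2
  -- the barrier is singular at `δ`, so the argument is carried out on `[2δ, T]`
  set δ := t₀ / 2 with hδ
  have hδ0 : 0 < δ := half_pos ht₀.1
  have hδT : 2 * δ ≤ T := by rw [hδ]; linarith [ht₀.2]
  have hl2 : 0 < l ^ 2 := by positivity
  have ht₀' : t₀ ∈ Icc (2 * δ) T := ⟨by rw [hδ]; linarith, ht₀.2⟩
  have hsub : ∀ {t}, t ∈ Icc (2 * δ) T → t ∈ Icc 0 T := fun h => ⟨by linarith [h.1], h.2⟩
  set σ : ℝ → ℝ := fun t => l * √(T - t) with hσ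
  set φ : ℝ → ℝ → ℝ := fun t w => riseMean (dualUtility U G) (σ t) w with hφ
  have hσc : Continuous σ := by fun_prop
  have hφc : Continuous fun q : ℝ × ℝ => φ q.1 q.2 :=
    (continuous_riseMean (hG.expBounded_dualUtility hU)).comp
      ((hσc.comp continuous_fst).prodMk continuous_snd)
  have hφ0 : ∀ t w, 0 ≤ φ t w := fun t w => gaussMean_nonneg (hG.dualUtility_nonneg hU) _ _
  by_contra! hlt
  change x₀ * Real.exp (-w₀) + φ t₀ w₀ < M t₀ x₀ at hlt
  set b : ℝ → ℝ → ℝ := barrier l T δ with hb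
  have hbpos : ∀ t w, 0 < b t w := fun t w => barrier_pos l T δ t w
  obtain ⟨ε, hε, hεlt⟩ : ∃ ε > 0, 0 < M t₀ x₀ - x₀ * Real.exp (-w₀) - φ t₀ w₀
      - ε * (b t₀ w₀ + (1 + T - t₀)) := by
    have h1 : 0 < b t₀ w₀ + (1 + T - t₀) := by linarith [hbpos t₀ w₀, ht₀.2]
    refine ⟨(M t₀ x₀ - x₀ * Real.exp (-w₀) - φ t₀ w₀) / (2 * (b t₀ w₀ + (1 + T - t₀))),
      by apply div_pos <;> linarith, ?_⟩
    have : (M t₀ x₀ - x₀ * Real.exp (-w₀) - φ t₀ w₀) / (2 * (b t₀ w₀ + (1 + T - t₀)))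
        * (b t₀ w₀ + (1 + T - t₀)) = (M t₀ x₀ - x₀ * Real.exp (-w₀) - φ t₀ w₀) / 2 := by
      field_simp
    rw [this]
    linarith
  set F : ℝ → ℝ → ℝ → ℝ := fun t x w =>
    M t x - x * Real.exp (-w) - φ t w - ε * (b t w + (1 + T - t)) with hF
  obtain ⟨L, x₁, x₂, hx₁, hconf⟩ := hM.exists_confinement hl hδ0 hδT hε
  have hconf' : ∀ t ∈ Icc (2 * δ) T, ∀ x > 0, ∀ w, 0 ≤ F t x w →
      w ∈ Icc (-L) L ∧ x ∈ Icc x₁ x₂ := by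
    intro t ht x hx w h
    refine hconf t ht x hx w ?_
    have h1 : ε * (b t w + 1) ≤ ε * (b t w + (1 + T - t)) :=
      mul_le_mul_of_nonneg_left (by linarith [ht.2]) hε.le
    simp only [hF] at h
    linarith [hφ0 t w]
  set K : Set (ℝ × ℝ × ℝ) := Icc (2 * δ) T ×ˢ Icc x₁ x₂ ×ˢ Icc (-L) L with hK
  have hKc : IsCompact K := isCompact_Icc.prod (isCompact_Icc.prod isCompact_Icc)
  have hFc : ContinuousOn (fun q : ℝ × ℝ × ℝ => F q.1 q.2.1 q.2.2) K := by
    have h1 : ContinuousOn (fun q : ℝ × ℝ × ℝ => M q.1 q.2.1) K :=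
      hM.continuous.comp (f := fun q : ℝ × ℝ × ℝ => (q.1, q.2.1)) (by fun_prop)
        fun q hq => ⟨hsub hq.1, hx₁.trans_le hq.2.1.1⟩
    have h2 : Continuous (fun q : ℝ × ℝ × ℝ => φ q.1 q.2.2) :=
      hφc.comp (continuous_fst.prodMk (continuous_snd.comp continuous_snd))
    have h3 : ContinuousOn (fun q : ℝ × ℝ × ℝ => b q.1 q.2.2) K := by
      have hv : ∀ q ∈ K, l ^ 2 * (q.1 - δ) ≠ 0 := fun q hq =>
        (mul_pos hl2 (by linarith [hq.1.1])).ne'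
      have hv2 : ∀ q ∈ K, 2 * (l ^ 2 * (q.1 - δ)) ≠ 0 := fun q hq =>
        mul_ne_zero two_ne_zero (hv q hq)
      refine Real.continuous_exp.comp_continuousOn (ContinuousOn.sub (ContinuousOn.div
        (by fun_prop) (by fun_prop) hv2) ((ContinuousOn.log (by fun_prop) hv).div_const 2))
    exact ((h1.sub (by fun_prop)).sub h2.continuousOn).sub
      (continuousOn_const.mul (h3.add (by fun_prop)))
  have hmem : (t₀, x₀, w₀) ∈ K :=
    have h := hconf' t₀ ht₀' x₀ hx₀ w₀ hεlt.le
    ⟨ht₀', h.2, h.1⟩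
  obtain ⟨⟨t, x, w⟩, hq, hmax⟩ := hKc.exists_isMaxOn ⟨_, hmem⟩ hFc
  have ht : t ∈ Icc (2 * δ) T := hq.1
  have hx : 0 < x := hx₁.trans_le hq.2.1.1
  have hpos : 0 < F t x w := hεlt.trans_le (hmax hmem)
  have hglob : ∀ s ∈ Icc (2 * δ) T, ∀ y > 0, ∀ u, F s y u ≤ F t x w := by
    intro s hs y hy u
    rcases le_total (F s y u) 0 with h | h
    · exact h.trans hpos.le
    · have h' := hconf' s hs y hy u h
      exact hmax (a := (s, y, u)) ⟨hs, h'.2, h'.1⟩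
  have htT : t < T := by
    refine ht.2.lt_of_ne fun h => ?_
    have h1 : φ t w = dualUtility U G w := by
      simp [hφ, hσ, h, riseMean, gaussMean_zero]
    have h2 := hG.le_dualUtility hU hx w
    have h3 : 0 < ε * (b t w + (1 + T - t)) :=
      mul_pos hε (by linarith [hbpos t w, ht.2])
    have h4 : M t x = U x := by rw [h, hM.terminal x hx]
    simp only [hF, h1, h4] at hpos
    linarith
  have htδ : δ < t := by linarith [ht.1]
  have htI := hsub ht
  -- derivatives in `w`
  have hE := fun j (hj : j ≤ 6) => hG.expBounded hU hj
  set J : ℝ → ℝ := fun u => driftMean (G 0) (σ t) u with hJ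
  set J' : ℝ → ℝ := fun u => driftMean (G 1) (σ t) u with hJ'
  have dJ : ∀ u, HasDerivAt J (J' u) u := fun u =>
    hasDerivAt_driftMean_right (hG.hasDerivAt 0 (by norm_num)) (hE 0 (by norm_num))
      (hE 1 (by norm_num)) _ u
  have de : ∀ u : ℝ, HasDerivAt (fun u : ℝ => Real.exp (-u)) (-Real.exp (-u)) u := fun u => by
    simpa using (hasDerivAt_neg u).exp
  have dφ : ∀ u, HasDerivAt (φ t) (Real.exp (-u) * J u) u := fun u => by
    simpa using hasDerivAt_riseMean_curve (hG.hasDerivAt_dualUtility hU)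
      (hG.hasDerivAt 0 (by norm_num)) (hG.expBounded_dualUtility hU) (hE 0 (by norm_num))
      (hE 1 (by norm_num)) (hasDerivAt_const u (σ t)) (hasDerivAt_id u)
  set b' : ℝ → ℝ := fun u => b t u * ((u + l ^ 2 * (T - t) / 2) / (l ^ 2 * (t - δ))) with hb'
  set b'' : ℝ := b t w * (((w + l ^ 2 * (T - t) / 2) / (l ^ 2 * (t - δ))) ^ 2
    + 1 / (l ^ 2 * (t - δ))) with hb''
  have db : ∀ u, HasDerivAt (b t) (b' u) u := fun u => hasDerivAt_barrier_right hl htδ u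
  have db' : HasDerivAt b' b'' w := hasDerivAt_barrier_right_right hl htδ w
  -- restriction to the line through the maximum in the direction `(α, 1)`
  have hline : ∀ α : ℝ, ∀ᶠ r in 𝓝 (0 : ℝ), HasDerivAt (fun r => F t (x + α * r) (w + r))
      (α * deriv (M t) (x + α * r) - α * Real.exp (-(w + r))
        + (x + α * r) * Real.exp (-(w + r)) - Real.exp (-(w + r)) * J (w + r) - ε * b' (w
            + r)) r := by
    intro α
    have h0 : ∀ᶠ r in 𝓝 (0 : ℝ), 0 < x + α * r :=
      (by fun_prop : Continuous fun r : ℝ => x + α * r).continuousAt.eventually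
        (lt_mem_nhds (by simpa using hx))
    filter_upwards [h0] with r hr
    have d1 : HasDerivAt (fun r => x + α * r) α r := by
      simpa using ((hasDerivAt_id r).const_mul α).const_add x
    have d2 : HasDerivAt (fun r => w + r) 1 r := (hasDerivAt_id r).const_add w
    have d3 := (hM.hasDerivAt htI hr).comp r d1
    have d4 := (de (w + r)).comp r d2
    have d5 := (dφ (w + r)).comp r d2
    have d6 := (db (w + r)).comp r d2
    refine (((d3.sub (d1.mul d4)).sub d5).sub ((d6.add_const (1
        + T - t)).const_mul ε)).congr_deriv ?_
    simp only [Function.comp_apply]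
    ring
  have hline' : ∀ α : ℝ, HasDerivAt (fun r => α * deriv (M t) (x + α * r) - α * Real.exp (-(w + r))
        + (x + α * r) * Real.exp (-(w + r)) - Real.exp (-(w + r)) * J (w + r) - ε * b' (w + r))
      (α ^ 2 * deriv (deriv (M t)) x + 2 * α * Real.exp (-w) - x * Real.exp (-w)
        + Real.exp (-w) * J w - Real.exp (-w) * J' w - ε * b'') 0 := by
    intro α
    have d1 : HasDerivAt (fun r => x + α * r) α 0 := by
      simpa using ((hasDerivAt_id (0 : ℝ)).const_mul α).const_add x
    have d2 : HasDerivAt (fun r => w + r) 1 0 := (hasDerivAt_id (0 : ℝ)).const_add w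
    have d3 : HasDerivAt (fun r => deriv (M t) (x + α * r)) (deriv (deriv (M t)) x * α) 0 := by
      have h : HasDerivAt (deriv (M t)) (deriv (deriv (M t)) x) (x + α * 0) := by
        simpa using hM.hasDerivAt_deriv htI hx
      exact h.comp (0 : ℝ) d1
    have d4 : HasDerivAt (fun r => Real.exp (-(w + r))) (-Real.exp (-w)) 0 :=
      ((de (w + 0)).comp (0 : ℝ) d2).congr_deriv (by simp)
    have d5 : HasDerivAt (fun r => J (w + r)) (J' w) 0 :=
      ((dJ (w + 0)).comp (0 : ℝ) d2).congr_deriv (by simp)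
    have d6 : HasDerivAt (fun r => b' (w + r)) b'' 0 := by
      have h : HasDerivAt b' b'' (w + 0) := by simpa using db'
      exact (h.comp (0 : ℝ) d2).congr_deriv (by simp)
    refine (((((d3.const_mul α).fun_sub (d4.const_mul α)).fun_add (d1.fun_mul d4)).fun_sub
      (d4.fun_mul d5)).fun_sub (d6.const_mul ε)).congr_deriv ?_
    simp only [add_zero, mul_zero]
    ring
  have hmaxline : ∀ α : ℝ, IsLocalMax (fun r => F t (x + α * r) (w + r)) 0 := by
    intro α
    have h0 : ∀ᶠ r in 𝓝 (0 : ℝ), 0 < x + α * r :=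
      (by fun_prop : Continuous fun r : ℝ => x + α * r).continuousAt.eventually
        (lt_mem_nhds (by simpa using hx))
    filter_upwards [h0] with r hr
    simpa using hglob t ht _ hr (w + r)
  have hfoc : ∀ α : ℝ, α * deriv (M t) x - α * Real.exp (-w) + x * Real.exp (-w)
      - Real.exp (-w) * J w - ε * b' w = 0 := by
    intro α
    simpa using (hmaxline α).hasDerivAt_eq_zero (hline α).self_of_nhds
  have hsoc : ∀ α : ℝ, α ^ 2 * deriv (deriv (M t)) x + 2 * α * Real.exp (-w) - x * Real.exp (-w)
        + Real.exp (-w) * J w - Real.exp (-w) * J' w - ε * b'' ≤ 0 := by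
    intro α
    have h := second_deriv_nonneg_of_isLocalMin (hmaxline α).neg
      ((hline α).mono fun r hr => hr.neg) (hline' α).neg
    linarith
  have h0 := hfoc 0
  have hMx : deriv (M t) x = Real.exp (-w) := by
    have h1 := hfoc 1
    linarith
  have hMxx := hM.concave t htI x hx
  -- the direction that maximizes the quadratic form
  have hsoc' := hsoc (-Real.exp (-w) / deriv (deriv (M t)) x)
  have e1 : (-Real.exp (-w) / deriv (deriv (M t)) x) ^ 2 * deriv (deriv (M t)) x
      + 2 * (-Real.exp (-w) / deriv (deriv (M t)) x) * Real.exp (-w)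
      = -(Real.exp (-w) ^ 2 / deriv (deriv (M t)) x) := by
    have := hMxx.ne
    field_simp
    ring
  -- first order condition in time
  have hσ' := hasDerivAt_mul_sqrt_sub (l := l) htT
  have hσσ' := mul_sqrt_sub_mul_deriv (l := l) htT
  have dφt : HasDerivAt (fun t => φ t w) (Real.exp (-w) * (-(l ^ 2 / 2) * J' w)) t := by
    refine (hasDerivAt_riseMean_curve (hG.hasDerivAt_dualUtility hU)
      (hG.hasDerivAt 0 (by norm_num)) (hG.expBounded_dualUtility hU) (hE 0 (by norm_num))
      (hE 1 (by norm_num)) hσ' (hasDerivAt_const t w)).congr_deriv ?_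
    rw [hσσ', zero_mul, add_zero]
  have dbt : HasDerivAt (fun t => b t w) (-(l ^ 2 / 2) * (b' w + b'')) t :=
    hasDerivAt_barrier_left hl htδ w
  have hsub' : Icc t T ⊆ Icc 0 T := fun s hs => ⟨htI.1.trans hs.1, hs.2⟩
  have dMt := (hM.equation t htI x hx).mono hsub'
  have dtime := ((((dMt.sub_const (x * Real.exp (-w))).fun_sub dφt.hasDerivWithinAt).fun_sub
    ((dbt.fun_add ((hasDerivAt_id t).const_sub (1 + T))).const_mul ε).hasDerivWithinAt)).fun_neg
  have htime := nonneg_of_hasDerivWithinAt_of_forall_le htT dtime fun s hs => by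
    have := hglob s ⟨ht.1.trans hs.1, hs.2⟩ x hx w
    simp only [hF] at this
    simp only [id_eq]
    linarith
  rw [hMx] at htime
  have hl2' : 0 ≤ l ^ 2 / 2 := by positivity
  have hprod := mul_nonneg hl2' (show 0 ≤ Real.exp (-w) ^ 2 / deriv (deriv (M t)) x
    + Real.exp (-w) * J' w + ε * (b' w + b'') by linarith)
  nlinarith

/-- The Merton value function is unique: it is given by the dual representation. -/
theorem IsMertonValue.eq_riseMean {U : ℝ → ℝ} {T l : ℝ} {M : ℝ → ℝ → ℝ}
    {G : ℕ → ℝ → ℝ} (hM : IsMertonValue U T l M) (hU : UtilityAssumption U)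
    (hG : MarginalFlow U G) (hT : 0 < T) {t : ℝ} (ht : t ∈ Icc 0 T) (w : ℝ) :
    M t (driftMean (G 0) (l * √(T - t)) w) = riseMean (fun w => U (G 0 w)) (l * √(T - t)) w := by
  rcases eq_or_ne l 0 with rfl | hl
  · simp only [zero_mul, driftMean, riseMean, gaussMean_zero]
    have hx := hG.pos w
    simp only [ne_eq, OfNat.ofNat_ne_zero, not_false_eq_true, zero_pow, zero_div, sub_zero,
        add_zero]
    rw [← hM.terminal _ hx]
    refine (convex_Icc 0 T).is_const_of_fderivWithin_eq_zero (𝕜 := ℝ) (f := fun s => M s (G 0 w))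
      ?_ ?_ ht ⟨hT.le, le_rfl⟩
    · exact fun s hs => (hM.equation s hs _ hx).differentiableWithinAt
    · intro s hs
      have h := (hM.equation s hs _ hx)
      simp only [ne_eq, OfNat.ofNat_ne_zero, not_false_eq_true, zero_pow, mul_zero, zero_mul] at h
      have h2 := h.hasFDerivWithinAt.fderivWithin (uniqueDiffOn_Icc hT s hs)
      rw [h2]
      ext
      simp
  · have hJ : ∀ t, 0 < driftMean (G 0) (l * √(T - t)) w := fun t =>
      gaussMean_pos (hG.expBounded hU (by norm_num)) (fun u => (hG.pos u).le) ⟨0, hG.pos _⟩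
    have hpos : ∀ t ∈ Ioc 0 T,
        M t (driftMean (G 0) (l * √(T - t)) w)
            = riseMean (fun w => U (G 0 w)) (l * √(T - t)) w := by
      intro t ht
      refine le_antisymm ?_ (hM.riseMean_utility_le hU hG hl ⟨ht.1.le, ht.2⟩ w)
      have := hM.le_riseMean_dualUtility hU hG hl ht (hJ t) w
      rw [hG.riseMean_utility hU]
      linarith
    rcases ht.1.eq_or_lt with rfl | h0
    · -- continuity at the initial time
      have hσ : Continuous fun t => l * √(T - t) := by fun_prop
      have cJ : Continuous fun t => driftMean (G 0) (l * √(T - t)) w :=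
        (continuous_driftMean (hG.expBounded hU (j :=
            0) (by norm_num))).comp (hσ.prodMk continuous_const)
      have cP : Continuous fun t => riseMean (fun w => U (G 0 w)) (l * √(T - t)) w :=
        (continuous_riseMean (hG.expBounded_utility hU)).comp (hσ.prodMk continuous_const)
      have cM : ContinuousOn (fun t => M t (driftMean (G 0) (l * √(T - t)) w)) (Icc 0 T) :=
        hM.continuous.comp (f := fun t => (t, driftMean (G 0) (l * √(T - t)) w))
          (continuous_id.prodMk cJ).continuousOn fun s hs => ⟨hs, hJ s⟩
      have h1 := (cM 0 ⟨le_rfl, hT.le⟩).mono_left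
        (nhdsWithin_mono 0 (Ioc_subset_Icc_self : Ioc 0 T ⊆ Icc 0 T))
      have h2 := (cP.tendsto 0).mono_left (nhdsWithin_le_nhds (s := Ioc 0 T))
      rw [nhdsWithin_Ioc_eq_nhdsGT hT] at h1 h2
      refine tendsto_nhds_unique (h1.congr' ?_) h2
      filter_upwards [Ioc_mem_nhdsGT hT] with s hs using hpos s hs
    · exact hpos t ⟨h0, ht.2⟩

/-! ### The explicit solution in the wealth variable -/

/-- The inverse in `w` of `driftMean (G 0) s`, which is a bijection of `ℝ` onto `(0, ∞)`; outside
`(0, ∞)` its values play no role. For `s = l √(T - t)` it is minus the logarithm of the marginal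
value at wealth `x`. -/
noncomputable def wealthInverse (G : ℕ → ℝ → ℝ) (s : ℝ) : ℝ → ℝ :=
  Function.invFun (driftMean (G 0) s)

/-- The function `driftMean (G j)` expressed in the wealth variable. For `s = l √(T - t)`, the value
for `j = 1` is the risk tolerance of the Merton value function. -/
noncomputable def wealthMean (G : ℕ → ℝ → ℝ) (j : ℕ) (s x : ℝ) : ℝ :=
  driftMean (G j) s (wealthInverse G s x)

/-- `wealthMean` normalized by the risk tolerance `wealthMean G 1`. -/
noncomputable def wealthRatio (G : ℕ → ℝ → ℝ) (j : ℕ) (s x : ℝ) : ℝ :=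
  wealthMean G j s x / wealthMean G 1 s x

/-- The derivative of the partial inverse of a function of two variables, by the inverse function
theorem for `(s, w) ↦ (s, f (s, w))`. -/
lemma _root_.HasStrictFDerivAt.hasFDerivAt_inverse_snd {f : ℝ × ℝ → ℝ} {g : ℝ → ℝ → ℝ}
    {α β s w : ℝ} (hf : HasStrictFDerivAt f
      (α • ContinuousLinearMap.fst ℝ ℝ ℝ + β • ContinuousLinearMap.snd ℝ ℝ ℝ) (s, w))
    (hβ : β ≠ 0) (hg : ∀ p, g p.1 (f p) = p.2) :
    HasFDerivAt (fun p : ℝ × ℝ => g p.1 p.2)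
      ((-α / β) • ContinuousLinearMap.fst ℝ ℝ ℝ + β⁻¹ • ContinuousLinearMap.snd ℝ ℝ ℝ)
      (s, f (s, w)) := by
  let L : (ℝ × ℝ) ≃L[ℝ] ℝ × ℝ := ContinuousLinearEquiv.equivOfInverse
    ((ContinuousLinearMap.fst ℝ ℝ ℝ).prod
      (α • ContinuousLinearMap.fst ℝ ℝ ℝ + β • ContinuousLinearMap.snd ℝ ℝ ℝ))
    ((ContinuousLinearMap.fst ℝ ℝ ℝ).prod
      ((-α / β) • ContinuousLinearMap.fst ℝ ℝ ℝ + β⁻¹ • ContinuousLinearMap.snd ℝ ℝ ℝ))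
    (fun p => by ext <;> simp; field_simp; ring) (fun p => by ext <;> simp; field_simp; ring)
  have hΨ : HasStrictFDerivAt (fun p : ℝ × ℝ => (p.1, f p)) (L : ℝ × ℝ →L[ℝ] ℝ × ℝ) (s, w) :=
    hasStrictFDerivAt_fst.prodMk hf
  have hinv := (hΨ.to_local_left_inverse (g := fun p => (p.1, g p.1 p.2))
    (.of_forall fun p => by simp [hg])).hasFDerivAt
  exact hinv.snd

namespace MarginalFlow

variable {U : ℝ → ℝ} {G : ℕ → ℝ → ℝ}

lemma driftMean_one_pos (hG : MarginalFlow U G) (hU : UtilityAssumption U) (s w : ℝ) :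
    0 < driftMean (G 1) s w :=
  gaussMean_pos (hG.expBounded hU (by norm_num)) (fun u => (hG.one_pos hU u).le)
    ⟨0, hG.one_pos hU _⟩

lemma hasDerivAt_driftMean (hG : MarginalFlow U G) (hU : UtilityAssumption U) {j : ℕ} (hj : j < 6)
    (s w : ℝ) : HasDerivAt (driftMean (G j) s) (driftMean (G (j + 1)) s w) w :=
  hasDerivAt_driftMean_right (hG.hasDerivAt j hj) (hG.expBounded hU hj.le)
    (hG.expBounded hU hj) s w

lemma strictMono_driftMean (hG : MarginalFlow U G) (hU : UtilityAssumption U) (s : ℝ) :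
    StrictMono (driftMean (G 0) s) :=
  strictMono_of_hasDerivAt_pos (hG.hasDerivAt_driftMean hU (by norm_num) s)
    (hG.driftMean_one_pos hU s)

/-- A Harnack inequality, from the bound on the logarithmic derivative. -/
lemma exists_apply_add_le (hG : MarginalFlow U G) (hU : UtilityAssumption U) :
    ∃ C, 0 ≤ C ∧ ∀ u d, G 0 (u + d) ≤ Real.exp (C * |d|) * G 0 u := by
  obtain ⟨C, hC1, hC⟩ := hG.exists_one_le_mul_zero hU
  refine ⟨C, by linarith, fun u d => ?_⟩
  rcases le_total d 0 with hd | hd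
  · have h1 := (hG.strictMono hU).monotone (show u + d ≤ u by linarith)
    have h2 : 1 ≤ Real.exp (C * |d|) := Real.one_le_exp (by positivity)
    nlinarith [hG.pos u]
  · have hanti : Antitone fun w => G 0 w * Real.exp (-(C * w)) := by
      refine antitone_of_hasDerivAt_nonpos (fun w => (hG.hasDerivAt 0 (by norm_num) w).fun_mul
        (((hasDerivAt_id w).const_mul C).fun_neg.exp)) fun w => ?_
      have := mul_nonneg (sub_nonneg.2 (hC w)) (Real.exp_pos (-(C * w))).le
      simp only [id_eq, Pi.zero_apply]
      linarith
    have h := hanti (show u ≤ u + d by linarith)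
    simp only at h
    rw [abs_of_nonneg hd]
    have e : Real.exp (C * d) = Real.exp (C * (u + d)) * Real.exp (-(C * u)) := by
      rw [← Real.exp_add]; ring_nf
    have e' : Real.exp (C * (u + d)) * Real.exp (-(C * (u + d))) = 1 := by
      rw [← Real.exp_add]; simp
    calc G 0 (u + d)
        = Real.exp (C * (u + d)) * (G 0 (u + d) * Real.exp (-(C * (u + d)))) := by
          rw [mul_left_comm, e', mul_one]
      _ ≤ Real.exp (C * (u + d)) * (G 0 u * Real.exp (-(C * u))) := by gcongr
      _ = _ := by rw [e]; ring

/-- By the Harnack inequality the mean is comparable to the value at the centre, so it has the same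
limits at the two ends of the line. -/
lemma exists_driftMean_le (hG : MarginalFlow U G) (hU : UtilityAssumption U) (s : ℝ) :
    ∃ m > 0, ∃ c, ∀ w, m * G 0 w ≤ driftMean (G 0) s w ∧ driftMean (G 0) s w ≤ c * G 0 w := by
  obtain ⟨C, hC0, hC⟩ := hG.exists_apply_add_le hU
  have b1 : ExpBounded fun d : ℝ => Real.exp (C * |d|) :=
    .of_le (by fun_prop) (A := 1) (c := C) fun d => by simp
  have b2 : ExpBounded fun d : ℝ => Real.exp (-(C * |d|)) :=
    .of_bounded (by fun_prop) (A := 1) fun d => by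
      rw [Real.abs_exp]
      exact Real.exp_le_one_iff.2 (neg_nonpos.2 (by positivity))
  have hE := hG.expBounded hU (j := 0) (by norm_num)
  refine ⟨driftMean (fun d => Real.exp (-(C * |d|))) s 0,
    gaussMean_pos b2 (fun _ => (Real.exp_pos _).le) ⟨0, Real.exp_pos _⟩,
    driftMean (fun d => Real.exp (C * |d|)) s 0, fun w => ⟨?_, ?_⟩⟩
  · unfold driftMean gaussMean
    rw [← integral_mul_const]
    refine integral_mono ((b2.integrable _ _).mul_const _) (hE.integrable _ _) fun z => ?_
    have h := hC (w - s ^ 2 / 2 + s * z) (-(0 - s ^ 2 / 2 + s * z))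
    rw [abs_neg, show w - s ^ 2 / 2 + s * z + -(0 - s ^ 2 / 2 + s * z) = w by ring] at h
    simp only
    rw [Real.exp_neg, inv_mul_le_iff₀ (Real.exp_pos _)]
    exact h
  · unfold driftMean gaussMean
    rw [← integral_mul_const]
    refine integral_mono (hE.integrable _ _) ((b1.integrable _ _).mul_const _) fun z => ?_
    have h := hC w (0 - s ^ 2 / 2 + s * z)
    rwa [show w + (0 - s ^ 2 / 2 + s * z) = w - s ^ 2 / 2 + s * z by ring] at h

lemma exists_driftMean_eq (hG : MarginalFlow U G) (hU : UtilityAssumption U) (s : ℝ) {x : ℝ}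
    (hx : 0 < x) : ∃ w, driftMean (G 0) s w = x := by
  obtain ⟨m, hm, c, h⟩ := hG.exists_driftMean_le hU s
  have hc : Continuous (driftMean (G 0) s) :=
    continuous_iff_continuousAt.2 fun w => (hG.hasDerivAt_driftMean hU
        (by norm_num) s w).continuousAt
  have h0 : Tendsto (fun w => c * G 0 w) atBot (𝓝 0) := by
    simpa using (((hG.tendsto_atBot hU).mono_right nhdsWithin_le_nhds).const_mul c)
  obtain ⟨w₁, hw₁⟩ := (h0.eventually (gt_mem_nhds hx)).exists
  obtain ⟨w₂, hw₂⟩ := (((hG.tendsto_atTop hU).const_mul_atTop hm).eventually_ge_atTop x).exists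
  exact mem_range_of_exists_le_of_exists_ge hc ⟨w₁, (h w₁).2.trans hw₁.le⟩ ⟨w₂, hw₂.trans (h w₂).1⟩

lemma driftMean_wealthInverse (hG : MarginalFlow U G) (hU : UtilityAssumption U) (s : ℝ) {x : ℝ}
    (hx : 0 < x) : driftMean (G 0) s (wealthInverse G s x) = x :=
  Function.invFun_eq (hG.exists_driftMean_eq hU s hx)

lemma wealthInverse_driftMean (hG : MarginalFlow U G) (hU : UtilityAssumption U) (s w : ℝ) :
    wealthInverse G s (driftMean (G 0) s w) = w :=
  Function.leftInverse_invFun (hG.strictMono_driftMean hU s).injective w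

lemma wealthMean_one_pos (hG : MarginalFlow U G) (hU : UtilityAssumption U) (s x : ℝ) :
    0 < wealthMean G 1 s x :=
  hG.driftMean_one_pos hU _ _

lemma hasFDerivAt_wealthInverse (hG : MarginalFlow U G) (hU : UtilityAssumption U) (s : ℝ) {x : ℝ}
    (hx : 0 < x) :
    HasFDerivAt (fun p : ℝ × ℝ => wealthInverse G p.1 p.2)
      ((-(s * (wealthMean G 2 s x / wealthMean G 1 s x - 1))) • ContinuousLinearMap.fst ℝ ℝ ℝ
        + (wealthMean G 1 s x)⁻¹ • ContinuousLinearMap.snd ℝ ℝ ℝ) (s, x) := by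
  have hβ0 : wealthMean G 1 s x ≠ 0 := (hG.wealthMean_one_pos hU s x).ne'
  have hJ := hasStrictFDerivAt_driftMean (hG.hasDerivAt 0 (by norm_num))
    (hG.hasDerivAt 1 (by norm_num)) (hG.expBounded hU (by norm_num))
    (hG.expBounded hU (by norm_num)) (hG.expBounded hU (by norm_num)) (s, wealthInverse G s x)
  have h := hJ.hasFDerivAt_inverse_snd hβ0 (fun p => hG.wealthInverse_driftMean hU p.1 p.2)
  rw [hG.driftMean_wealthInverse hU s hx] at h
  refine h.congr_fderiv ?_
  change (-(s * (wealthMean G 2 s x - wealthMean G 1 s x)) / wealthMean G 1 s x) • _ + _ = _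
  congr 2
  field_simp

lemma hasDerivAt_wealthInverse (hG : MarginalFlow U G) (hU : UtilityAssumption U) (s : ℝ) {x : ℝ}
    (hx : 0 < x) : HasDerivAt (wealthInverse G s) (wealthMean G 1 s x)⁻¹ x := by
  have h := (hG.hasFDerivAt_wealthInverse hU s hx).comp_hasDerivAt x
    ((hasDerivAt_const x s).prodMk (hasDerivAt_id x))
  exact h.congr_deriv (by simp)

lemma hasDerivAt_wealthInverse_curve (hG : MarginalFlow U G) (hU : UtilityAssumption U) {x : ℝ}
    (hx : 0 < x) {s : ℝ → ℝ} {s' z : ℝ} (hs : HasDerivAt s s' z) :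
    HasDerivAt (fun z => wealthInverse G (s z) x)
      (-(s z * s' * (wealthMean G 2 (s z) x / wealthMean G 1 (s z) x - 1))) z := by
  have h := (hG.hasFDerivAt_wealthInverse hU (s z) hx).comp_hasDerivAt z
    (hs.prodMk (hasDerivAt_const z x))
  refine h.congr_deriv ?_
  simp
  ring

lemma hasDerivAt_wealthMean (hG : MarginalFlow U G) (hU : UtilityAssumption U) {j : ℕ} (hj : j < 6)
    (s : ℝ) {x : ℝ} (hx : 0 < x) :
    HasDerivAt (wealthMean G j s) (wealthMean G (j + 1) s x / wealthMean G 1 s x) x :=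
  (hG.hasDerivAt_driftMean hU hj s (wealthInverse G s x)).comp x
    (hG.hasDerivAt_wealthInverse hU s hx)

lemma hasDerivAt_wealthMean_curve (hG : MarginalFlow U G) (hU : UtilityAssumption U) {j : ℕ}
    (hj : j < 5) {x : ℝ} (hx : 0 < x) {s : ℝ → ℝ} {s' z : ℝ} (hs : HasDerivAt s s' z) :
    HasDerivAt (fun z => wealthMean G j (s z) x)
      (s z * s' * (wealthMean G (j + 2) (s z) x
        - wealthMean G 2 (s z) x / wealthMean G 1 (s z) x * wealthMean G (j + 1) (s z) x)) z := by
  refine (hasDerivAt_driftMean_curve (hG.hasDerivAt j (by omega)) (hG.hasDerivAt (j + 1) (by omega))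
    (hG.expBounded hU (by omega)) (hG.expBounded hU (by omega)) (hG.expBounded hU (by omega)) hs
    (hG.hasDerivAt_wealthInverse_curve hU hx hs)).congr_deriv ?_
  simp only [wealthMean]
  ring

lemma hasDerivAt_wealthMean_one_curve (hG : MarginalFlow U G) (hU : UtilityAssumption U) {x : ℝ}
    (hx : 0 < x) {s : ℝ → ℝ} {s' z : ℝ} (hs : HasDerivAt s s' z) :
    HasDerivAt (fun z => wealthMean G 1 (s z) x)
      (s z * s' * (wealthRatio G 3 (s z) x - wealthRatio G 2 (s z) x ^ 2)
        * wealthMean G 1 (s z) x) z := by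
  refine (hG.hasDerivAt_wealthMean_curve hU (by norm_num) hx hs).congr_deriv ?_
  have := (hG.wealthMean_one_pos hU (s z) x).ne'
  simp only [wealthRatio]
  field_simp

lemma hasDerivAt_wealthRatio_curve (hG : MarginalFlow U G) (hU : UtilityAssumption U) {j : ℕ}
    (hj : j < 5) {x : ℝ} (hx : 0 < x) {s : ℝ → ℝ} {s' z : ℝ} (hs : HasDerivAt s s' z) :
    HasDerivAt (fun z => wealthRatio G j (s z) x)
      (s z * s' * (wealthRatio G (j + 2) (s z) x
        - wealthRatio G 2 (s z) x * wealthRatio G (j + 1) (s z) x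
        - wealthRatio G j (s z) x
          * (wealthRatio G 3 (s z) x - wealthRatio G 2 (s z) x ^ 2))) z := by
  have h1 := (hG.wealthMean_one_pos hU (s z) x).ne'
  refine ((hG.hasDerivAt_wealthMean_curve hU hj hx hs).fun_div
    (hG.hasDerivAt_wealthMean_one_curve hU hx hs) h1).congr_deriv ?_
  simp only [wealthRatio]
  field_simp

lemma exists_abs_wealthRatio_le (hG : MarginalFlow U G) (hU : UtilityAssumption U) :
    ∃ C, 1 ≤ C ∧ ∀ j, 1 ≤ j → j ≤ 6 → ∀ s x, |wealthRatio G j s x| ≤ C := by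
  obtain ⟨C, hC1, hC⟩ := hG.exists_bound hU
  refine ⟨C, hC1, fun j hj hj6 s x => ?_⟩
  have h1 := hG.wealthMean_one_pos hU s x
  rw [wealthRatio, abs_div, abs_of_pos h1, div_le_iff₀ h1]
  have h := abs_gaussMean_le ((ExpBounded.const C).mul (hG.expBounded hU (j := 1) (by norm_num)))
    (hC j hj hj6) s (wealthInverse G s x - s ^ 2 / 2)
  rwa [gaussMean_const_mul] at h

lemma exists_wealthMean_one_le (hG : MarginalFlow U G) (hU : UtilityAssumption U) :
    ∃ C, 1 ≤ C ∧ ∀ s, ∀ x > 0, wealthMean G 1 s x ≤ C * x := by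
  obtain ⟨C, hC1, hC⟩ := hG.exists_one_le_mul_zero hU
  refine ⟨C, hC1, fun s x hx => ?_⟩
  have h := gaussMean_mono (hG.expBounded hU (by norm_num))
    ((ExpBounded.const C).mul (hG.expBounded hU (j := 0) (by norm_num))) hC s
    (wealthInverse G s x - s ^ 2 / 2)
  rw [gaussMean_const_mul] at h
  have e := hG.driftMean_wealthInverse hU s hx
  unfold driftMean at e
  rwa [e] at h

end MarginalFlow

/-- The marginal Merton value at wealth `x`, where `s = l √(T - t)` carries all of the dependence
on time and on the Sharpe ratio. -/
noncomputable def marginalValue (G : ℕ → ℝ → ℝ) (s x : ℝ) : ℝ := Real.exp (-wealthInverse G s x)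

/-- The Merton value at wealth `x`, where `s = l √(T - t)`: the utility and the wealth are both
parametrized by the dual variable `w`. -/
noncomputable def dualValue (U : ℝ → ℝ) (G : ℕ → ℝ → ℝ) (s x : ℝ) : ℝ :=
  riseMean (fun w => U (G 0 w)) s (wealthInverse G s x)

lemma marginalValue_pos (G : ℕ → ℝ → ℝ) (s x : ℝ) : 0 < marginalValue G s x := Real.exp_pos _

namespace MarginalFlow

variable {U : ℝ → ℝ} {G : ℕ → ℝ → ℝ}

lemma hasDerivAt_marginalValue (hG : MarginalFlow U G) (hU : UtilityAssumption U) (s : ℝ) {x : ℝ}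
    (hx : 0 < x) :
    HasDerivAt (marginalValue G s) (-(marginalValue G s x / wealthMean G 1 s x)) x :=
  (hG.hasDerivAt_wealthInverse hU s hx).fun_neg.exp.congr_deriv (by
    rw [marginalValue, div_eq_mul_inv, mul_neg])

lemma hasDerivAt_marginalValue_curve (hG : MarginalFlow U G) (hU : UtilityAssumption U) {x : ℝ}
    (hx : 0 < x) {s : ℝ → ℝ} {s' z : ℝ} (hs : HasDerivAt s s' z) :
    HasDerivAt (fun z => marginalValue G (s z) x)
      (s z * s' * (wealthRatio G 2 (s z) x - 1) * marginalValue G (s z) x) z :=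
  (hG.hasDerivAt_wealthInverse_curve hU hx hs).fun_neg.exp.congr_deriv (by
    rw [marginalValue, wealthRatio]; ring)

lemma hasDerivAt_riseMean_utility (hG : MarginalFlow U G) (hU : UtilityAssumption U) {s w : ℝ → ℝ}
    {s' w' z : ℝ} (hs : HasDerivAt s s' z) (hw : HasDerivAt w w' z) :
    HasDerivAt (fun z => riseMean (fun w => U (G 0 w)) (s z) (w z))
      (Real.exp (-w z) * (s z * s' * driftMean (G 2) (s z) (w z)
        + w' * driftMean (G 1) (s z) (w z))) z :=
  hasDerivAt_riseMean_curve (hG.hasDerivAt_utility hU) (hG.hasDerivAt 1 (by norm_num))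
    (hG.expBounded_utility hU) (hG.expBounded hU (by norm_num)) (hG.expBounded hU (by norm_num))
    hs hw

/-- The derivative of the value in wealth is the exponential of minus the dual variable: the
envelope theorem. -/
lemma hasDerivAt_dualValue (hG : MarginalFlow U G) (hU : UtilityAssumption U) (s : ℝ) {x : ℝ}
    (hx : 0 < x) : HasDerivAt (dualValue U G s) (marginalValue G s x) x := by
  refine (hG.hasDerivAt_riseMean_utility hU (hasDerivAt_const x s)
    (hG.hasDerivAt_wealthInverse hU s hx)).congr_deriv ?_
  have := (hG.wealthMean_one_pos hU s x).ne'
  rw [marginalValue, mul_zero, zero_mul, zero_add,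
    show driftMean (G 1) s (wealthInverse G s x) = wealthMean G 1 s x from rfl,
    inv_mul_cancel₀ this, mul_one]

lemma hasDerivAt_dualValue_curve (hG : MarginalFlow U G) (hU : UtilityAssumption U) {x : ℝ}
    (hx : 0 < x) {s : ℝ → ℝ} {s' z : ℝ} (hs : HasDerivAt s s' z) :
    HasDerivAt (fun z => dualValue U G (s z) x)
      (s z * s' * (marginalValue G (s z) x * wealthMean G 1 (s z) x)) z := by
  refine (hG.hasDerivAt_riseMean_utility hU hs
    (hG.hasDerivAt_wealthInverse_curve hU hx hs)).congr_deriv ?_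
  have := (hG.wealthMean_one_pos hU (s z) x).ne'
  change Real.exp _ * (s z * s' * wealthMean G 2 (s z) x + _ * wealthMean G 1 (s z) x) = _
  rw [marginalValue]
  field_simp
  ring

/-- The value is at least marginal value times wealth, as for any concave function vanishing at
zero; here the difference is the mean of the non-negative dual utility. -/
lemma marginalValue_mul_le (hG : MarginalFlow U G) (hU : UtilityAssumption U) (s : ℝ) {x : ℝ}
    (hx : 0 < x) : marginalValue G s x * x ≤ dualValue U G s x := by
  rw [dualValue, hG.riseMean_utility hU, hG.driftMean_wealthInverse hU s hx]
  exact le_add_of_nonneg_left (gaussMean_nonneg (hG.dualUtility_nonneg hU) _ _)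

end MarginalFlow

lemma IsMertonValue.eq_dualValue {T l : ℝ} {M : ℝ → ℝ → ℝ} {U : ℝ → ℝ} {G : ℕ → ℝ → ℝ}
    (hM : IsMertonValue U T l M) (hU : UtilityAssumption U) (hG : MarginalFlow U G) (hT : 0 < T)
    {t : ℝ} (ht : t ∈ Icc 0 T) {x : ℝ} (hx : 0 < x) :
    M t x = dualValue U G (l * √(T - t)) x := by
  have h := hM.eq_riseMean hU hG hT ht (wealthInverse G (l * √(T - t)) x)
  rwa [hG.driftMean_wealthInverse hU _ hx] at h

/-! ### Polynomial growth and the slow factor -/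

namespace StateSpace

lemma isOpen_carrier (D : StateSpace) : IsOpen D.carrier := by
  cases D
  · exact isOpen_univ
  · exact isOpen_Ioi

/-- A function, at least `1`, whose powers measure polynomial growth on the state space: large near
the ends of the state space, including the end `0` of the half-line. -/
noncomputable def weight : StateSpace → ℝ → ℝ
  | .line, z => max 1 |z|
  | .halfLine, z => max z z⁻¹

lemma one_le_weight (D : StateSpace) {z : ℝ} (hz : z ∈ D.carrier) : 1 ≤ D.weight z := by
  cases D
  · exact le_max_left _ _
  · have hz' : (0 : ℝ) < z := hz
    rcases le_total 1 z with h | h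
    · exact h.trans (le_max_left _ _)
    · exact ((one_le_inv₀ hz').2 h).trans (le_max_right _ _)

lemma polyGrowth_iff (D : StateSpace) {h : ℝ → ℝ} :
    D.PolyGrowth h ↔ ∃ k : ℕ, ∃ a > 0, ∀ z ∈ D.carrier, |h z| ≤ a * D.weight z ^ k := by
  cases D
  · constructor
    · rintro ⟨k, a, ha, H⟩
      refine ⟨k, 2 * a, by positivity, fun z _ => (H z).trans ?_⟩
      have h1 : 1 ≤ max 1 |z| ^ k := one_le_pow₀ (le_max_left _ _)
      have h2 : |z| ^ k ≤ max 1 |z| ^ k := by gcongr; exact le_max_right _ _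
      change _ ≤ 2 * a * max 1 |z| ^ k
      nlinarith
    · rintro ⟨k, a, ha, H⟩
      refine ⟨k, a, ha, fun z => (H z (mem_univ z)).trans ?_⟩
      change a * max 1 |z| ^ k ≤ _
      gcongr
      have : 0 ≤ |z| ^ k := by positivity
      rcases max_cases 1 |z| with h | h <;> rw [h.1]
      · rw [one_pow]; linarith
      · linarith
  · constructor
    · rintro ⟨k, a, ha, H⟩
      refine ⟨k, 3 * a, by positivity, fun z hz => (H z hz).trans ?_⟩
      have hz' : (0 : ℝ) < z := hz
      have h1 : 1 ≤ max z z⁻¹ ^ k := one_le_pow₀ (one_le_weight .halfLine hz)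
      have h2 : z ^ k ≤ max z z⁻¹ ^ k := by gcongr; exact le_max_left _ _
      have h3 : (z ^ k)⁻¹ ≤ max z z⁻¹ ^ k := by
        rw [← inv_pow]; gcongr; exact le_max_right _ _
      change _ ≤ 3 * a * max z z⁻¹ ^ k
      nlinarith
    · rintro ⟨k, a, ha, H⟩
      refine ⟨k, a, ha, fun z hz => (H z hz).trans ?_⟩
      change a * max z z⁻¹ ^ k ≤ _
      gcongr
      have h1 : 0 ≤ z ^ k := by positivity
      have h2 : 0 ≤ (z ^ k)⁻¹ := by positivity
      rcases max_cases z z⁻¹ with h | h <;> rw [h.1]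
      · linarith
      · rw [inv_pow]; linarith

namespace PolyGrowth

variable {D : StateSpace} {f g : ℝ → ℝ}

lemma const (D : StateSpace) (c : ℝ) : D.PolyGrowth fun _ => c :=
  D.polyGrowth_iff.2 ⟨0, |c| + 1, by positivity, fun z _ => by simp⟩

lemma add (hf : D.PolyGrowth f) (hg : D.PolyGrowth g) : D.PolyGrowth fun z => f z + g z := by
  obtain ⟨k, a, ha, H⟩ := D.polyGrowth_iff.1 hf
  obtain ⟨m, b, hb, H'⟩ := D.polyGrowth_iff.1 hg
  refine D.polyGrowth_iff.2 ⟨k + m, a + b, by positivity, fun z hz => (abs_add_le _ _).trans ?_⟩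
  have h1 := D.one_le_weight hz
  calc |f z| + |g z| ≤ a * D.weight z ^ k + b * D.weight z ^ m := add_le_add (H z hz) (H' z hz)
    _ ≤ a * D.weight z ^ (k + m) + b * D.weight z ^ (k + m) := by
      gcongr <;> first | exact h1 | omega
    _ = _ := by ring

lemma mul (hf : D.PolyGrowth f) (hg : D.PolyGrowth g) : D.PolyGrowth fun z => f z * g z := by
  obtain ⟨k, a, ha, H⟩ := D.polyGrowth_iff.1 hf
  obtain ⟨m, b, hb, H'⟩ := D.polyGrowth_iff.1 hg
  refine D.polyGrowth_iff.2 ⟨k + m, a * b, by positivity, fun z hz => ?_⟩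
  have h1 := D.one_le_weight hz
  rw [abs_mul]
  calc |f z| * |g z| ≤ (a * D.weight z ^ k) * (b * D.weight z ^ m) :=
        mul_le_mul (H z hz) (H' z hz) (abs_nonneg _) (by positivity)
    _ = _ := by ring

lemma abs (hf : D.PolyGrowth f) : D.PolyGrowth fun z => |f z| := by
  obtain ⟨k, a, ha, H⟩ := D.polyGrowth_iff.1 hf
  exact D.polyGrowth_iff.2 ⟨k, a, ha, fun z hz => by simpa using H z hz⟩

lemma pow (hf : D.PolyGrowth f) (n : ℕ) : D.PolyGrowth fun z => f z ^ n := by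
  induction n with
  | zero => simpa using const D 1
  | succ n ih => simpa only [pow_succ] using ih.mul hf

end PolyGrowth

end StateSpace

lemma SharpeAssumption.hasDerivAt_iteratedDeriv {D : StateSpace} {lam : ℝ → ℝ}
    (h : SharpeAssumption D lam) {j : ℕ} (hj : j < 3) {z : ℝ} (hz : z ∈ D.carrier) :
    HasDerivAt (iteratedDeriv j lam) (iteratedDeriv (j + 1) lam z) z := by
  have key : ∀ j n : ℕ, j + n = 3 → ContDiffOn ℝ n (iteratedDeriv j lam) D.carrier := by
    intro j
    induction j with
    | zero =>
      intro n hn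
      obtain rfl : n = 3 := by omega
      simpa using h.smooth
    | succ j ih =>
      intro n hn
      rw [iteratedDeriv_succ]
      exact (ih (n + 1) (by omega)).deriv_of_isOpen D.isOpen_carrier (by norm_cast)
  have h1 := (key j (3 - j) (by omega)).contDiffAt (D.isOpen_carrier.mem_nhds hz)
  rw [iteratedDeriv_succ]
  refine (h1.differentiableAt ?_).hasDerivAt
  have : 3 - j ≠ 0 := by omega
  exact_mod_cast this

lemma abs_mul_le_mul {a b A B : ℝ} (ha : |a| ≤ A) (hb : |b| ≤ B) : |a * b| ≤ A * B := by
  rw [abs_mul]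
  exact mul_le_mul ha hb (abs_nonneg _) ((abs_nonneg _).trans ha)

lemma abs_add_le_add {a b A B : ℝ} (ha : |a| ≤ A) (hb : |b| ≤ B) : |a + b| ≤ A + B :=
  (abs_add_le a b).trans (add_le_add ha hb)

lemma abs_sub_le_add {a b A B : ℝ} (ha : |a| ≤ A) (hb : |b| ≤ B) : |a - b| ≤ A + B :=
  (abs_sub a b).trans (add_le_add ha hb)

/-- The logarithmic derivatives `A` and `B` of the marginal value and of the risk tolerance along a
curve `s`, their derivatives, and the derivative `Q` of the wealth derivative of the risk tolerance.
All of them are polynomials in `s s'`, its derivatives, and the bounded ratios `wealthRatio`. The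
ratios form a closed system: differentiating `wealthRatio G j` involves the indices up to `j + 2`,
and three derivatives, starting from `j = 2`, stay within the indices up to `6`. -/
lemma MarginalFlow.exists_rates {U : ℝ → ℝ} {G : ℕ → ℝ → ℝ} (hG : MarginalFlow U G)
    (hU : UtilityAssumption U) {x : ℝ} (hx : 0 < x) {S : Set ℝ} {s s' ρ₁ ρ₂ : ℝ → ℝ}
    (hs : ∀ z ∈ S, HasDerivAt s (s' z) z)
    (hρ : ∀ z ∈ S, HasDerivAt (fun z => s z * s' z) (ρ₁ z) z)
    (hρ₁ : ∀ z ∈ S, HasDerivAt ρ₁ (ρ₂ z) z) {C : ℝ} (hC1 : 1 ≤ C)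
    (hC : ∀ j, 1 ≤ j → j ≤ 6 → ∀ s x, |wealthRatio G j s x| ≤ C) :
    ∃ A A₁ A₂ B B₁ Q : ℝ → ℝ,
      (∀ z ∈ S, HasDerivAt (fun z => marginalValue G (s z) x) (A z * marginalValue G (s z) x) z ∧
        HasDerivAt A (A₁ z) z ∧ HasDerivAt A₁ (A₂ z) z ∧
        HasDerivAt (fun z => wealthMean G 1 (s z) x) (B z * wealthMean G 1 (s z) x) z ∧
        HasDerivAt B (B₁ z) z ∧ HasDerivAt (fun z => wealthRatio G 2 (s z) x) (Q z) z) ∧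
      ∀ z N, 1 ≤ N → |s z * s' z| ≤ N → |ρ₁ z| ≤ N → |ρ₂ z| ≤ N →
        |A z| ≤ N * (32 * C ^ 5) ∧ |A₁ z| ≤ 2 * (N * (32 * C ^ 5)) ^ 2 ∧
        |A₂ z| ≤ 5 * (N * (32 * C ^ 5)) ^ 3 ∧ |B z| ≤ N * (32 * C ^ 5) ∧
        |B₁ z| ≤ 2 * (N * (32 * C ^ 5)) ^ 2 ∧ |Q z| ≤ N * (32 * C ^ 5) := by
  set ρ : ℝ → ℝ := fun z => s z * s' z with hρdef
  set q : ℕ → ℝ → ℝ := fun j z => wealthRatio G j (s z) x with hqdef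
  -- `ρ * E j` is the derivative of `q j`
  set E : ℕ → ℝ → ℝ := fun j z => q (j + 2) z - q 2 z * q (j + 1) z - q j z * (q 3 z - q 2 z ^ 2)
    with hE
  set H : ℝ → ℝ := fun z => E 3 z - 2 * q 2 z * E 2 z with hH
  set F : ℝ → ℝ := fun z => E 4 z - (E 2 z * q 3 z + q 2 z * E 3 z)
    - (E 2 z * (q 3 z - q 2 z ^ 2) + q 2 z * H z) with hF
  have dq : ∀ j < 5, ∀ z ∈ S, HasDerivAt (q j) (ρ z * E j z) z := fun j hj z hz =>
    hG.hasDerivAt_wealthRatio_curve hU hj hx (hs z hz)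
  have dB : ∀ z ∈ S, HasDerivAt (fun z => q 3 z - q 2 z ^ 2) (ρ z * H z) z := fun z hz =>
    ((dq 3 (by norm_num) z hz).fun_sub ((dq 2 (by norm_num) z hz).fun_pow 2)).congr_deriv (by
      simp only [hH]; push_cast; ring)
  have dE : ∀ z ∈ S, HasDerivAt (E 2) (ρ z * F z) z := fun z hz =>
    (((dq 4 (by norm_num) z hz).fun_sub ((dq 2 (by norm_num) z hz).fun_mul
      (dq 3 (by norm_num) z hz))).fun_sub ((dq 2 (by norm_num) z hz).fun_mul
      (dB z hz))).congr_deriv (by simp only [hF]; ring)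
  refine ⟨fun z => ρ z * (q 2 z - 1), fun z => ρ₁ z * (q 2 z - 1) + ρ z * (ρ z * E 2 z),
    fun z => (ρ₂ z * (q 2 z - 1) + ρ₁ z * (ρ z * E 2 z))
      + (ρ₁ z * (ρ z * E 2 z) + ρ z * (ρ₁ z * E 2 z + ρ z * (ρ z * F z))),
    fun z => ρ z * (q 3 z - q 2 z ^ 2),
    fun z => ρ₁ z * (q 3 z - q 2 z ^ 2) + ρ z * (ρ z * H z), fun z => ρ z * E 2 z,
    fun z hz => ⟨hG.hasDerivAt_marginalValue_curve hU hx (hs z hz),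
      (hρ z hz).fun_mul ((dq 2 (by norm_num) z hz).sub_const 1),
      ((hρ₁ z hz).fun_mul ((dq 2 (by norm_num) z hz).sub_const 1)).fun_add
        ((hρ z hz).fun_mul ((hρ z hz).fun_mul (dE z hz))),
      hG.hasDerivAt_wealthMean_one_curve hU hx (hs z hz),
      (hρ z hz).fun_mul (dB z hz), dq 2 (by norm_num) z hz⟩, ?_⟩
  intro z N hN h0 h1 h2
  have bq : ∀ j, 1 ≤ j → j ≤ 6 → |q j z| ≤ C := fun j hj hj6 => hC j hj hj6 _ _
  have q2 := bq 2 (by norm_num) (by norm_num)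
  have q3 := bq 3 (by norm_num) (by norm_num)
  have hCp : ∀ {m n : ℕ}, m ≤ n → C ^ m ≤ C ^ n := fun h => pow_le_pow_right₀ hC1 h
  have c1 : C ≤ C ^ 5 := by simpa using hCp (show 1 ≤ 5 by norm_num)
  have c2 : C ^ 2 ≤ C ^ 5 := hCp (by norm_num)
  have c3 : C ^ 3 ≤ C ^ 5 := hCp (by norm_num)
  have c4 : C ^ 4 ≤ C ^ 5 := hCp (by norm_num)
  have c12 : C ≤ C ^ 2 := by simpa using hCp (show 1 ≤ 2 by norm_num)
  have c23 : C ^ 2 ≤ C ^ 3 := hCp (by norm_num)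
  have bA : |q 2 z - 1| ≤ 32 * C ^ 5 :=
    (abs_sub_le_add q2 (abs_one.le)).trans (by linarith)
  have bB' : |q 3 z - q 2 z ^ 2| ≤ 2 * C ^ 2 := by
    rw [sq]
    exact (abs_sub_le_add q3 (abs_mul_le_mul q2 q2)).trans (by linarith)
  have bB : |q 3 z - q 2 z ^ 2| ≤ 32 * C ^ 5 := bB'.trans (by linarith)
  have bE' : ∀ j, 2 ≤ j → j ≤ 4 → |E j z| ≤ 4 * C ^ 3 := fun j hj hj4 =>
    (abs_sub_le_add (abs_sub_le_add (bq (j + 2) (by omega) (by omega))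
      (abs_mul_le_mul q2 (bq (j + 1) (by omega) (by omega))))
      (abs_mul_le_mul (bq j (by omega) (by omega)) bB')).trans (by linarith)
  have e2 := bE' 2 (by norm_num) (by norm_num)
  have e3 := bE' 3 (by norm_num) (by norm_num)
  have e4 := bE' 4 (by norm_num) (by norm_num)
  have bE : |E 2 z| ≤ 32 * C ^ 5 := e2.trans (by linarith)
  have bH' : |H z| ≤ 12 * C ^ 4 :=
    (abs_sub_le_add e3 (abs_mul_le_mul (abs_mul_le_mul (abs_two.le) q2) e2)).trans (by
      linarith [hCp (show 3 ≤ 4 by norm_num)])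
  have bH : |H z| ≤ 32 * C ^ 5 := bH'.trans (by linarith)
  have bF : |F z| ≤ 32 * C ^ 5 :=
    (abs_sub_le_add (abs_sub_le_add e4 (abs_add_le_add (abs_mul_le_mul e2 q3)
      (abs_mul_le_mul q2 e3))) (abs_add_le_add (abs_mul_le_mul e2 bB')
      (abs_mul_le_mul q2 bH'))).trans (by linarith)
  have hK1 : 1 ≤ 32 * C ^ 5 := by linarith [one_le_pow₀ hC1 (n := 5)]
  generalize 32 * C ^ 5 = K at *
  have p1 : N * K ≤ (N * K) ^ 2 :=
    le_self_pow₀ (one_le_mul_of_one_le_of_one_le hN hK1) (by norm_num)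
  have p2 : N * (N * K) ≤ (N * K) ^ 2 := by
    nlinarith [mul_nonneg (by linarith : 0 ≤ N) (by linarith : 0 ≤ N)]
  have p3 : (N * K) ^ 2 ≤ (N * K) ^ 3 :=
    pow_le_pow_right₀ (one_le_mul_of_one_le_of_one_le hN hK1) (by norm_num)
  have p4 : N * (N * (N * K)) ≤ (N * K) ^ 3 := by
    calc N * (N * (N * K)) = N ^ 3 * K := by ring
      _ ≤ N ^ 3 * K ^ 3 := by gcongr; exact le_self_pow₀ hK1 (by norm_num)
      _ = _ := by ring
  refine ⟨abs_mul_le_mul h0 bA,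
    (abs_add_le_add (abs_mul_le_mul h1 bA) (abs_mul_le_mul h0 (abs_mul_le_mul h0 bE))).trans
      (by linarith),
    (abs_add_le_add (abs_add_le_add (abs_mul_le_mul h2 bA)
      (abs_mul_le_mul h1 (abs_mul_le_mul h0 bE)))
      (abs_add_le_add (abs_mul_le_mul h1 (abs_mul_le_mul h0 bE))
        (abs_mul_le_mul h0 (abs_add_le_add (abs_mul_le_mul h1 bE)
          (abs_mul_le_mul h0 (abs_mul_le_mul h0 bF)))))).trans (by linarith),
    abs_mul_le_mul h0 bB,
    (abs_add_le_add (abs_mul_le_mul h1 bB) (abs_mul_le_mul h0 (abs_mul_le_mul h0 bH))).trans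
      (by linarith), abs_mul_le_mul h0 bE⟩

lemma hasDerivAt_mul_logDeriv {f A : ℝ → ℝ} {A₁ z : ℝ} (hf : HasDerivAt f (A z * f z) z)
    (hA : HasDerivAt A A₁ z) : HasDerivAt (fun z => A z * f z) ((A₁ + A z ^ 2) * f z) z :=
  (hA.fun_mul hf).congr_deriv (by ring)

lemma hasDerivAt_mul_logDeriv_logDeriv {f A A₁ : ℝ → ℝ} {A₂ z : ℝ}
    (hf : HasDerivAt f (A z * f z) z) (hA : HasDerivAt A (A₁ z) z) (hA₁ : HasDerivAt A₁ A₂ z) :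
    HasDerivAt (fun z => (A₁ z + A z ^ 2) * f z)
      ((A₂ + 3 * A z * A₁ z + A z ^ 3) * f z) z :=
  ((hA₁.fun_add (hA.fun_pow 2)).fun_mul hf).congr_deriv (by push_cast; ring)

lemma differentiableAt_and_dz_eq {S : Set ℝ} (hS : IsOpen S) {F : ℝ → ℝ → ℝ → ℝ} {f f' : ℝ → ℝ}
    {t x : ℝ} (h : ∀ z ∈ S, F t x z = f z) (hf : ∀ z ∈ S, HasDerivAt f (f' z) z) {z : ℝ}
    (hz : z ∈ S) : DifferentiableAt ℝ (fun ζ => F t x ζ) z ∧ dz F t x z = f' z := by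
  have h1 : HasDerivAt (fun ζ => F t x ζ) (f' z) z :=
    (hf z hz).congr_of_eventuallyEq (Filter.eventually_of_mem (hS.mem_nhds hz) h)
  exact ⟨h1.differentiableAt, h1.deriv⟩

lemma differentiableAt_and_dx_eq {F : ℝ → ℝ → ℝ → ℝ} {f : ℝ → ℝ} {f' t x z : ℝ} (hx : 0 < x)
    (h : ∀ ξ > 0, F t ξ z = f ξ) (hf : HasDerivAt f f' x) :
    DifferentiableAt ℝ (fun ξ => F t ξ z) x ∧ dx F t x z = f' := by
  have h1 : HasDerivAt (fun ξ => F t ξ z) f' x :=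
    hf.congr_of_eventuallyEq (Filter.eventually_of_mem (Ioi_mem_nhds hx) h)
  exact ⟨h1.differentiableAt, h1.deriv⟩

/-- Existence of the derivatives in the slow factor, and their bounds, at one point `(t, x)`, for a
Sharpe ratio with three derivatives `lam₁, lam₂, lam₃` on the open set `S`; the bounds are in terms
of a common upper bound `N` of `(T - t) * lam * lam₁` and its first two derivatives. -/
lemma MarginalFlow.slow_derivatives {U : ℝ → ℝ} {G : ℕ → ℝ → ℝ} (hG : MarginalFlow U G)
    (hU : UtilityAssumption U) {T : ℝ} (hT : 0 < T) {S : Set ℝ} (hS : IsOpen S)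
    {lam lam₁ lam₂ lam₃ : ℝ → ℝ} (h₁ : ∀ z ∈ S, HasDerivAt lam (lam₁ z) z)
    (h₂ : ∀ z ∈ S, HasDerivAt lam₁ (lam₂ z) z) (h₃ : ∀ z ∈ S, HasDerivAt lam₂ (lam₃ z) z)
    {v : ℝ → ℝ → ℝ → ℝ} (hv : ∀ z ∈ S, IsMertonValue U T (lam z) (fun t x => v t x z))
    {C c : ℝ} (hC1 : 1 ≤ C) (hC : ∀ j, 1 ≤ j → j ≤ 6 → ∀ s x, |wealthRatio G j s x| ≤ C)
    (hc1 : 1 ≤ c) (hc : ∀ s, ∀ x > 0, wealthMean G 1 s x ≤ c * x)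
    {t : ℝ} (ht : t ∈ Icc 0 T) {x : ℝ} (hx : 0 < x) {z : ℝ} (hz : z ∈ S) :
    (HasDz 2 v t x z ∧ HasDz 3 (dx v) t x z ∧ HasDz 2 (dx (dx v)) t x z ∧
      HasDz 2 (riskTolerance v) t x z ∧
      DifferentiableAt ℝ (fun ξ => riskTolerance v t ξ z) x ∧
      HasDz 1 (dx (riskTolerance v)) t x z) ∧
    ∀ N d, 1 ≤ N → |(T - t) * (lam z * lam₁ z)| ≤ N →
      |(T - t) * (lam₁ z * lam₁ z + lam z * lam₂ z)| ≤ N →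
      |(T - t) * (3 * (lam₁ z * lam₂ z) + lam z * lam₃ z)| ≤ N →
      d = 12 * c * (N * (32 * C ^ 5)) ^ 3 →
      |dz v t x z| ≤ d * v t x z ∧ |dz (dx v) t x z| ≤ d * dx v t x z ∧
      |dz (dx (dx v)) t x z| ≤ d * |dx (dx v) t x z| ∧
      |dz (riskTolerance v) t x z| ≤ d * riskTolerance v t x z ∧
      |dz (dz v) t x z| ≤ d * v t x z ∧ |dz (dx (riskTolerance v)) t x z| ≤ d ∧
      |dz (dz (dx v)) t x z| ≤ d * dx v t x z ∧
      |dz (dz (riskTolerance v)) t x z| ≤ d * riskTolerance v t x z ∧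
      |dz (dz (dx (dx v))) t x z| ≤ d * |dx (dx v) t x z| ∧
      |dz (dz (dz (dx v))) t x z| ≤ d * dx v t x z := by
  -- in `s s'` the square root cancels, so that nothing degenerates at `t = T`
  set s : ℝ → ℝ := fun z => lam z * √(T - t) with hs
  set s' : ℝ → ℝ := fun z => lam₁ z * √(T - t) with hs'
  set ρ₁ : ℝ → ℝ := fun z => (T - t) * (lam₁ z * lam₁ z + lam z * lam₂ z) with hρ₁
  set ρ₂ : ℝ → ℝ := fun z => (T - t) * (3 * (lam₁ z * lam₂ z) + lam z * lam₃ z) with hρ₂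
  have hρ : ∀ z, s z * s' z = (T - t) * (lam z * lam₁ z) := fun z => by
    simp only [hs, hs']
    have := Real.mul_self_sqrt (sub_nonneg.2 ht.2)
    linear_combination lam z * lam₁ z * this
  have ds : ∀ z ∈ S, HasDerivAt s (s' z) z := fun z hz => (h₁ z hz).mul_const _
  have dρ : ∀ z ∈ S, HasDerivAt (fun z => s z * s' z) (ρ₁ z) z := fun z hz => by
    simp only [hρ]
    exact ((h₁ z hz).fun_mul (h₂ z hz)).const_mul _
  have dρ₁ : ∀ z ∈ S, HasDerivAt ρ₁ (ρ₂ z) z := fun z hz =>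
    ((((h₂ z hz).fun_mul (h₂ z hz)).fun_add ((h₁ z hz).fun_mul (h₃ z hz))).const_mul
      (T - t)).congr_deriv (by simp only [hρ₂]; ring)
  obtain ⟨A, A₁, A₂, B, B₁, Q, hrate, hbound⟩ := hG.exists_rates hU hx ds dρ dρ₁ hC1 hC
  set a : ℝ → ℝ := fun z => marginalValue G (s z) x with ha
  set r : ℝ → ℝ := fun z => wealthMean G 1 (s z) x with hr
  have da : ∀ z ∈ S, HasDerivAt a (A z * a z) z := fun z hz => (hrate z hz).1
  have dA : ∀ z ∈ S, HasDerivAt A (A₁ z) z := fun z hz => (hrate z hz).2.1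
  have dA₁ : ∀ z ∈ S, HasDerivAt A₁ (A₂ z) z := fun z hz => (hrate z hz).2.2.1
  have dr : ∀ z ∈ S, HasDerivAt r (B z * r z) z := fun z hz => (hrate z hz).2.2.2.1
  have dB : ∀ z ∈ S, HasDerivAt B (B₁ z) z := fun z hz => (hrate z hz).2.2.2.2.1
  have dQ : ∀ z ∈ S, HasDerivAt (fun z => wealthRatio G 2 (s z) x) (Q z) z :=
    fun z hz => (hrate z hz).2.2.2.2.2
  have ha0 : ∀ z, 0 < a z := fun z => marginalValue_pos _ _ _
  have hr0 : ∀ z, 0 < r z := fun z => hG.wealthMean_one_pos hU _ _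
  -- the functions in terms of the explicit solution
  have ev : ∀ z ∈ S, ∀ x > 0, v t x z = dualValue U G (s z) x := fun z hz x hx =>
    (hv z hz).eq_dualValue hU hG hT ht hx
  have evx : ∀ z ∈ S, ∀ x > 0, dx v t x z = marginalValue G (s z) x := fun z hz x hx =>
    (differentiableAt_and_dx_eq hx (ev z hz) (hG.hasDerivAt_dualValue hU _ hx)).2
  have evxx : ∀ z ∈ S, ∀ x > 0,
      dx (dx v) t x z = -(marginalValue G (s z) x / wealthMean G 1 (s z) x) := fun z hz x hx =>
    (differentiableAt_and_dx_eq hx (evx z hz) (hG.hasDerivAt_marginalValue hU _ hx)).2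
  have eR : ∀ z ∈ S, ∀ x > 0, riskTolerance v t x z = wealthMean G 1 (s z) x := by
    intro z hz x hx
    rw [riskTolerance, evx z hz x hx, evxx z hz x hx]
    have h1 := (marginalValue_pos G (s z) x).ne'
    have h2 := (hG.wealthMean_one_pos hU (s z) x).ne'
    field_simp
  have eRx := fun z (hz : z ∈ S) =>
    differentiableAt_and_dx_eq hx (eR z hz) (hG.hasDerivAt_wealthMean hU (by norm_num) (s z) hx)
  -- derivatives in the slow factor
  have dar : ∀ z ∈ S, HasDerivAt (fun z => a z * r z) ((A z + B z) * (a z * r z)) z := fun z hz =>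
    ((da z hz).fun_mul (dr z hz)).congr_deriv (by ring)
  have dquot : ∀ z ∈ S, HasDerivAt (fun z => -(a z / r z)) ((A z - B z) * -(a z / r z)) z :=
    fun z hz => ((da z hz).fun_div (dr z hz) (hr0 z).ne').fun_neg.congr_deriv (by
      have := (hr0 z).ne'
      field_simp)
  have v1 := fun z (hz : z ∈ S) => differentiableAt_and_dz_eq hS (fun z hz => ev z hz x hx)
    (fun z hz => hG.hasDerivAt_dualValue_curve hU hx (ds z hz)) hz
  have v2 := fun z (hz : z ∈ S) => differentiableAt_and_dz_eq hS (fun z hz => (v1 z hz).2)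
    (fun z hz => ((dρ z hz).fun_mul (dar z hz)).congr_deriv
      (show _ = (ρ₁ z + s z * s' z * (A z + B z)) * (a z * r z) by ring)) hz
  have x1 := fun z (hz : z ∈ S) => differentiableAt_and_dz_eq hS (fun z hz => evx z hz x hx) da hz
  have x2 := fun z (hz : z ∈ S) => differentiableAt_and_dz_eq hS (fun z hz => (x1 z hz).2)
    (fun z hz => hasDerivAt_mul_logDeriv (da z hz) (dA z hz)) hz
  have x3 := fun z (hz : z ∈ S) => differentiableAt_and_dz_eq hS (fun z hz => (x2 z hz).2)
    (fun z hz => hasDerivAt_mul_logDeriv_logDeriv (da z hz) (dA z hz) (dA₁ z hz)) hz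
  have xx1 := fun z (hz : z ∈ S) =>
    differentiableAt_and_dz_eq hS (fun z hz => evxx z hz x hx) dquot hz
  have xx2 := fun z (hz : z ∈ S) => differentiableAt_and_dz_eq hS (fun z hz => (xx1 z hz).2)
    (fun z hz => hasDerivAt_mul_logDeriv (dquot z hz) ((dA z hz).fun_sub (dB z hz))) hz
  have r1 := fun z (hz : z ∈ S) => differentiableAt_and_dz_eq hS (fun z hz => eR z hz x hx) dr hz
  have r2 := fun z (hz : z ∈ S) => differentiableAt_and_dz_eq hS (fun z hz => (r1 z hz).2)
    (fun z hz => hasDerivAt_mul_logDeriv (dr z hz) (dB z hz)) hz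
  have rx1 := fun z (hz : z ∈ S) =>
    differentiableAt_and_dz_eq hS (fun z hz => (eRx z hz).2) dQ hz
  refine ⟨⟨?_, ?_, ?_, ?_, (eRx z hz).1, ?_⟩, ?_⟩
  · intro k hk
    interval_cases k
    exacts [(v1 z hz).1, (v2 z hz).1]
  · intro k hk
    interval_cases k
    exacts [(x1 z hz).1, (x2 z hz).1, (x3 z hz).1]
  · intro k hk
    interval_cases k
    exacts [(xx1 z hz).1, (xx2 z hz).1]
  · intro k hk
    interval_cases k
    exacts [(r1 z hz).1, (r2 z hz).1]
  · intro k hk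
    interval_cases k
    exact (rx1 z hz).1
  · rintro N d hN n0 n1 n2 rfl
    rw [← hρ] at n0
    obtain ⟨bA, bA₁, bA₂, bB, bB₁, bQ⟩ := hbound z N hN n0 n1 n2
    rw [(v1 z hz).2, (v2 z hz).2, (x1 z hz).2, (x2 z hz).2, (x3 z hz).2, (xx1 z hz).2,
      (xx2 z hz).2, (r1 z hz).2, (r2 z hz).2, (rx1 z hz).2, ev z hz x hx, evx z hz x hx,
      evxx z hz x hx, eR z hz x hx]
    have hNK : N ≤ N * (32 * C ^ 5) :=
      le_mul_of_one_le_right (by linarith) (by linarith [one_le_pow₀ hC1 (n := 5)])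
    have hP1 : 1 ≤ N * (32 * C ^ 5) := hN.trans hNK
    generalize N * (32 * C ^ 5) = P at *
    have p12 : P ≤ P ^ 2 := le_self_pow₀ hP1 (by norm_num)
    have p23 : P ^ 2 ≤ P ^ 3 := pow_le_pow_right₀ hP1 (by norm_num)
    have p3 : 12 * P ^ 3 ≤ 12 * c * P ^ 3 := by gcongr; linarith
    have p3' : 0 ≤ P ^ 3 := by positivity
    -- the product of marginal value and risk tolerance is controlled by the value
    have har : a z * r z ≤ c * dualValue U G (s z) x := by
      calc a z * r z ≤ a z * (c * x) := by gcongr; exacts [(ha0 z).le, hc _ x hx]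
        _ = c * (a z * x) := by ring
        _ ≤ _ := by gcongr; exact hG.marginalValue_mul_le hU _ hx
    have har0 : 0 ≤ a z * r z := (mul_pos (ha0 z) (hr0 z)).le
    have hval : ∀ {m : ℝ}, |m| ≤ 12 * P ^ 3 →
        |m * (a z * r z)| ≤ 12 * c * P ^ 3 * dualValue U G (s z) x := fun {m} hm => by
      refine (abs_mul_le_mul hm (abs_of_nonneg har0).le).trans ?_
      calc 12 * P ^ 3 * (a z * r z) ≤ 12 * P ^ 3 * (c * dualValue U G (s z) x) := by gcongr
        _ = _ := by ring
    have hmul : ∀ {m f : ℝ}, |m| ≤ 12 * P ^ 3 → |m * f| ≤ 12 * c * P ^ 3 * |f| :=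
      fun hm => abs_mul_le_mul (hm.trans p3) le_rfl
    have hmul' : ∀ {m f : ℝ}, 0 < f → |m| ≤ 12 * P ^ 3 → |m * f| ≤ 12 * c * P ^ 3 * f :=
      fun hf hm => abs_mul_le_mul (hm.trans p3) (abs_of_pos hf).le
    have bsq : ∀ {m K : ℝ}, |m| ≤ K → |m ^ 2| ≤ K ^ 2 := fun {m K} h => by
      rw [abs_pow]; gcongr
    have bcu : |A z ^ 3| ≤ P ^ 3 := by rw [abs_pow]; gcongr
    have bAB := abs_sub_le_add bA bB
    refine ⟨hval (by linarith), hmul' (ha0 z) (by linarith), hmul (by linarith),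
      hmul' (hr0 z) (by linarith),
      hval ((abs_add_le_add n1 (abs_mul_le_mul n0 (abs_add_le_add bA bB))).trans ?_),
      by linarith,
      hmul' (ha0 z) ((abs_add_le_add bA₁ (bsq bA)).trans (by linarith)),
      hmul' (hr0 z) ((abs_add_le_add bB₁ (bsq bB)).trans (by linarith)),
      hmul ((abs_add_le_add (abs_sub_le_add bA₁ bB₁) (bsq bAB)).trans (by linarith)),
      hmul' (ha0 z) ((abs_add_le_add (abs_add_le_add bA₂ (abs_mul_le_mul (abs_mul_le_mul
        (by norm_num : |(3 : ℝ)| ≤ 3) bA) bA₁)) bcu).trans (by linarith))⟩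
    have : N * (P + P) ≤ 2 * P ^ 2 := by nlinarith
    linarith

end Merton

theorem proposition3p7 (U : ℝ → ℝ) (hU : Merton.UtilityAssumption U) (T : ℝ) (hT : 0 < T)
    (D : Merton.StateSpace) (lam : ℝ → ℝ) (hlam : Merton.SharpeAssumption D lam)
    (v : ℝ → ℝ → ℝ → ℝ)
    (hv : ∀ z ∈ D.carrier, Merton.IsMertonValue U T (lam z) (fun t x => v t x z)) :
    -- all the derivatives that occur below exist
    (∀ t ∈ Set.Icc 0 T, ∀ x > 0, ∀ z ∈ D.carrier,
      Merton.HasDz 2 v t x z ∧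
      Merton.HasDz 3 (Merton.dx v) t x z ∧
      Merton.HasDz 2 (Merton.dx (Merton.dx v)) t x z ∧
      Merton.HasDz 2 (Merton.riskTolerance v) t x z ∧
      DifferentiableAt ℝ (fun ξ => Merton.riskTolerance v t ξ z) x ∧
      Merton.HasDz 1 (Merton.dx (Merton.riskTolerance v)) t x z) ∧
    ∃ d01 d11 d21 d02 d12 d22 d13 e01 e11 e02 : ℝ → ℝ,
      (D.IsBound d01 ∧ D.IsBound d11 ∧ D.IsBound d21 ∧ D.IsBound d02 ∧ D.IsBound d12 ∧
        D.IsBound d22 ∧ D.IsBound d13 ∧ D.IsBound e01 ∧ D.IsBound e11 ∧ D.IsBound e02) ∧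
      ∀ t ∈ Set.Icc 0 T, ∀ x > 0, ∀ z ∈ D.carrier,
        |Merton.dz v t x z| ≤ d01 z * v t x z ∧
        |Merton.dz (Merton.dx v) t x z| ≤ d11 z * Merton.dx v t x z ∧
        |Merton.dz (Merton.dx (Merton.dx v)) t x z| ≤
          d21 z * |Merton.dx (Merton.dx v) t x z| ∧
        |Merton.dz (Merton.riskTolerance v) t x z| ≤ e01 z * Merton.riskTolerance v t x z ∧
        |Merton.dz (Merton.dz v) t x z| ≤ d02 z * v t x z ∧
        |Merton.dz (Merton.dx (Merton.riskTolerance v)) t x z| ≤ e11 z ∧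
        |Merton.dz (Merton.dz (Merton.dx v)) t x z| ≤ d12 z * Merton.dx v t x z ∧
        |Merton.dz (Merton.dz (Merton.riskTolerance v)) t x z| ≤
          e02 z * Merton.riskTolerance v t x z ∧
        |Merton.dz (Merton.dz (Merton.dx (Merton.dx v))) t x z| ≤
          d22 z * |Merton.dx (Merton.dx v) t x z| ∧
        |Merton.dz (Merton.dz (Merton.dz (Merton.dx v))) t x z| ≤
          d13 z * Merton.dx v t x z := by
  open Merton in
  obtain ⟨G, hG⟩ := hU.exists_marginalFlow
  obtain ⟨C, hC1, hC⟩ := hG.exists_abs_wealthRatio_le hU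
  obtain ⟨c, hc1, hc⟩ := hG.exists_wealthMean_one_le hU
  have h₁ : ∀ z ∈ D.carrier, HasDerivAt lam (iteratedDeriv 1 lam z) z := fun z hz => by
    simpa using hlam.hasDerivAt_iteratedDeriv (j := 0) (by norm_num) hz
  have key := fun {t} (ht : t ∈ Icc 0 T) {x : ℝ} (hx : 0 < x) {z} (hz : z ∈ D.carrier) =>
    hG.slow_derivatives hU hT D.isOpen_carrier h₁
      (fun z hz => hlam.hasDerivAt_iteratedDeriv (j := 1) (by norm_num) hz)
      (fun z hz => hlam.hasDerivAt_iteratedDeriv (j := 2) (by norm_num) hz)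
      hv hC1 hC hc1 hc ht hx hz
  set h : ℝ → ℝ := fun z => |iteratedDeriv 0 lam z| + |iteratedDeriv 1 lam z|
    + |iteratedDeriv 2 lam z| + |iteratedDeriv 3 lam z| with hh
  set N : ℝ → ℝ := fun z => 1 + 4 * T * h z ^ 2 with hN
  set d : ℝ → ℝ := fun z => 12 * c * (N z * (32 * C ^ 5)) ^ 3 with hd
  have hN1 : ∀ z, 1 ≤ N z := fun z => le_add_of_nonneg_right (by positivity)
  have hbd : D.IsBound d := by
    refine ⟨fun z _ => ?_, ?_⟩
    · have := hN1 z
      positivity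
    · have hg := fun j hj => (hlam.growth j hj).abs
      have hgh : D.PolyGrowth h := (((hg 0 (by norm_num)).add (hg 1 (by norm_num))).add
        (hg 2 (by norm_num))).add (hg 3 (by norm_num))
      have hgN : D.PolyGrowth N := (StateSpace.PolyGrowth.const D 1).add
        ((StateSpace.PolyGrowth.const D (4 * T)).mul (hgh.pow 2))
      exact (StateSpace.PolyGrowth.const D (12 * c)).mul
        ((hgN.mul (StateSpace.PolyGrowth.const D _)).pow 3)
  refine ⟨fun t ht x hx z hz => (key ht hx hz).1, d, d, d, d, d, d, d, d, d, d,
    ⟨hbd, hbd, hbd, hbd, hbd, hbd, hbd, hbd, hbd, hbd⟩, fun t ht x hx z hz => ?_⟩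
  have hτ : |T - t| ≤ T := abs_le.2 ⟨by linarith [ht.2], by linarith [ht.1]⟩
  have l0 : |lam z| ≤ h z := by
    simp only [hh, iteratedDeriv_zero]
    linarith [abs_nonneg (iteratedDeriv 1 lam z), abs_nonneg (iteratedDeriv 2 lam z),
      abs_nonneg (iteratedDeriv 3 lam z)]
  have l1 : |iteratedDeriv 1 lam z| ≤ h z := by
    simp only [hh, iteratedDeriv_zero]
    linarith [abs_nonneg (lam z), abs_nonneg (iteratedDeriv 2 lam z),
      abs_nonneg (iteratedDeriv 3 lam z)]
  have l2 : |iteratedDeriv 2 lam z| ≤ h z := by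
    simp only [hh, iteratedDeriv_zero]
    linarith [abs_nonneg (lam z), abs_nonneg (iteratedDeriv 1 lam z),
      abs_nonneg (iteratedDeriv 3 lam z)]
  have l3 : |iteratedDeriv 3 lam z| ≤ h z := by
    simp only [hh, iteratedDeriv_zero]
    linarith [abs_nonneg (lam z), abs_nonneg (iteratedDeriv 1 lam z),
      abs_nonneg (iteratedDeriv 2 lam z)]
  have hTh : 0 ≤ T * h z ^ 2 := by positivity
  have n3 : |(3 : ℝ)| ≤ 3 := by norm_num
  exact (key ht hx hz).2 (N z) (d z) (hN1 z)
    ((abs_mul_le_mul hτ (abs_mul_le_mul l0 l1)).trans (by simp only [hN]; linarith))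
    ((abs_mul_le_mul hτ (abs_add_le_add (abs_mul_le_mul l1 l1)
      (abs_mul_le_mul l0 l2))).trans (by simp only [hN]; linarith))
    ((abs_mul_le_mul hτ (abs_add_le_add (abs_mul_le_mul n3 (abs_mul_le_mul l1 l2))
      (abs_mul_le_mul l0 l3))).trans (by simp only [hN]; linarith)) rfl
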